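/- Let $V:\mathbb R\to[0,\infty)$ be smooth and symmetric with $0<\delta_-\le V''\le\delta_+<\infty$ and $\delta_- /\delta_+>(3/4)^{1/16}$, and let $\beta>0$, $\gamma>0$. On $\Omega=(\mathbb R^2)^{\mathbb Z}$, with configurations $\omega=(p_i,r_i)_{i\in\mathbb Z}$, let $\nu_\beta$ be the product measure with one-site density $e^{-\beta(p^2/2+V(r))}/(\sqrt{2\pi\beta^{-1}}\,Z_\beta)$, $Z_\beta=\int e^{-\beta V(r)}\,dr$, and write $\langle f\rangle_\beta=\int f\,d\nu_\beta$. Put $Y_{i,j}=p_i\partial_{r_j}-V'(r_j)\partial_{p_i}$, $X_i=Y_{i,i}$, $$A=\sum_{i\in\mathbb Z}(X_i-Y_{i,i+1}),\qquad S=\frac\gamma2\sum_{i\in\mathbb Z}\big(X_i^2+Y_{i,i+1}^2\big),\qquad L=S+A,$$ $\mathcal E_i=p_i^2/2+V(r_i)$, and let $W_{0,1}=-p_0V'(r_1)+\frac\gamma2\{p_0^2V''(r_1)-V'(r_1)^2\}$ be the energy current. Let $\tau_j$ be the shift, $\tau_jF(\omega)=F((\omega_{i+j})_i)$. Let $\mathcal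 C$ be the linear space generated by the smooth compactly supported functions $F$ of finitely many coordinates with $\langle F\rangle_\beta=0$, and $\Gamma_F=\sum_j\tau_jF$ (a formal sum; $X_0\Gamma_F=\sum_jX_0\tau_jF$ and $Y_{0,1}\Gamma_F=\sum_jY_{0,1}\tau_jF$ are finite sums). Let $\mathcal C_0$ be the set of finite sums $\sum_i(X_iF_i+Y_{i,i+1}G_i)$, where $F_i,G_i$ are smooth functions of finitely many coordinates which, together with all their images under $X_k$ and $Y_{k,k+1}$, $k\in\mathbb Z$, lie in $L^2(\nu_\beta)$. For $h\in\mathcal C_0$ set $$|\!|\!|h|\!|\!|_{-1}^2=\sup_{g\in\mathcal C,\,a\in\mathbb R}\Big\{2\sum_{i}\langle g\,\tau_ih\rangle_\beta+2a\sum_{i}i\,\langle h\,\mathcal E_i\rangle_\beta-\frac\gamma2\big\langle(a\,p_0V'(r_1)+Y_{0,1}\Gamma_g)^2\big\rangle_\beta-\frac\gamma2\big\langle(X_0\Gamma_g)^2\big\rangle_\beta\Big\},$$ and let $\mathcal H_{-1}$ be the completion of $\mathcal C_0$ (modulo the kernel) for this seminorm. The diffusion constant $\kappa_\beta$ is defined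 as the unique real number such that $$W_{0,1}+\kappa_\beta\,(p_1^2-p_0^2)\in\overline{L\mathcal C}\quad\text{in }\mathcal H_{-1},$$ that is, such that $|\!|\!|W_{0,1}+\kappa_\beta(p_1^2-p_0^2)-LF_K|\!|\!|_{-1}\to0$ for some sequence $(F_K)$ in $\mathcal C$. **Proposition.** The constant $\kappa_\beta$ is well defined (there is exactly one such real number), and $$\kappa_\beta\ \ge\ \frac{\gamma}{4\,\beta\,\langle r_0^2\rangle_\beta}.$$ -/

import Mathlib

open MeasureTheory Filter Topology

noncomputable section

/-- Data and standing assumptions of the model: a smooth, symmetric, nonnegative interaction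
potential `V` with `0 < δ₋ ≤ V'' ≤ δ₊` and `δ₋ / δ₊ > (3/4)^(1/16)`, an inverse temperature `β > 0`
and a noise strength `γ > 0`. -/
structure EnergyChain where
  V : ℝ → ℝ
  δm : ℝ
  δp : ℝ
  β : ℝ
  γ : ℝ
  V_nonneg : ∀ r, 0 ≤ V r
  V_smooth : ContDiff ℝ (⊤ : ℕ∞) V
  V_symm : ∀ r, V (-r) = V r
  δm_pos : 0 < δm
  le_V'' : ∀ r, δm ≤ deriv (deriv V) r
  V''_le : ∀ r, deriv (deriv V) r ≤ δp
  δ_ratio : ((3 : ℝ) / 4) ^ ((1 : ℝ) / 16) < δm / δp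
  β_pos : 0 < β
  γ_pos : 0 < γ

namespace EnergyChain

/-- Configurations `ω = (p_i, r_i)_{i ∈ ℤ}`: `(ω i).1 = p_i` and `(ω i).2 = r_i`. -/
abbrev Config : Type := ℤ → ℝ × ℝ

/-! ### The Gibbs measure -/

/-- `Z_β = ∫ exp (-β V(r)) dr`. -/
def Z (M : EnergyChain) : ℝ := ∫ r, Real.exp (-M.β * M.V r)

/-- The one-site Gibbs measure, of density
`exp (-β (p²/2 + V(r))) / (√(2π β⁻¹) Z_β)` with respect to `dp dr`. -/
def siteMeasure (M : EnergyChain) : Measure (ℝ × ℝ) :=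
  volume.withDensity fun x => ENNReal.ofReal
    (Real.exp (-M.β * (x.1 ^ 2 / 2 + M.V x.2)) / (√(2 * Real.pi * M.β⁻¹) * M.Z))

lemma le_V (M : EnergyChain) (r : ℝ) : M.δm / 2 * r ^ 2 ≤ M.V r := by
  have hd : Differentiable ℝ M.V := M.V_smooth.differentiable (by simp)
  have hd' : Differentiable ℝ (deriv M.V) :=
    ((contDiff_infty_iff_deriv.1 M.V_smooth).2).differentiable (by simp)
  have h1 : deriv (fun x => M.V x - M.δm / 2 * x ^ 2) = fun x => deriv M.V x - M.δm * x := by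
    funext x
    have := ((hd x).hasDerivAt).sub (((hasDerivAt_pow 2 x)).const_mul (M.δm / 2))
    refine (this.deriv).trans ?_
    simp only [Nat.cast_ofNat]
    ring
  have hc : ConvexOn ℝ Set.univ (fun x => M.V x - M.δm / 2 * x ^ 2) := by
    refine convexOn_univ_of_deriv2_nonneg (by fun_prop) ?_ ?_
    · rw [h1]; fun_prop
    · intro x
      have h2 : deriv^[2] (fun x => M.V x - M.δm / 2 * x ^ 2) x = deriv (deriv M.V) x - M.δm := by
        simp only [Function.iterate_succ, Function.iterate_zero, Function.comp_apply, id]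
        rw [h1]
        have := ((hd' x).hasDerivAt).sub ((hasDerivAt_id x).const_mul M.δm)
        refine (this.deriv).trans ?_
        simp
      rw [h2]
      linarith [M.le_V'' x]
  have := hc.2 (Set.mem_univ r) (Set.mem_univ (-r)) (show (0 : ℝ) ≤ 1 / 2 by norm_num)
    (show (0 : ℝ) ≤ 1 / 2 by norm_num) (by norm_num)
  have h0 := M.V_nonneg 0
  have hs := M.V_symm r
  simp only [smul_eq_mul] at this
  rw [show (1 : ℝ) / 2 * r + 1 / 2 * -r = 0 by ring, hs] at this
  nlinarith

lemma integrable_exp_V (M : EnergyChain) : Integrable fun r => Real.exp (-M.β * M.V r) := by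
  have hb : 0 < M.β * (M.δm / 2) := mul_pos M.β_pos (half_pos M.δm_pos)
  refine (integrable_exp_neg_mul_sq hb).mono' ?_ ?_
  · have := M.V_smooth.continuous
    exact (by fun_prop : Continuous fun r => Real.exp (-M.β * M.V r)).aestronglyMeasurable
  · refine Eventually.of_forall fun r => ?_
    rw [Real.norm_eq_abs, Real.abs_exp]
    refine Real.exp_le_exp.2 ?_
    have := mul_le_mul_of_nonneg_left (M.le_V r) M.β_pos.le
    nlinarith

lemma Z_pos (M : EnergyChain) : 0 < M.Z := integral_exp_pos M.integrable_exp_V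

instance (M : EnergyChain) : IsProbabilityMeasure M.siteMeasure := by
  constructor
  have hc := M.V_smooth.continuous
  have hp : Integrable fun p : ℝ => Real.exp (-(M.β / 2) * p ^ 2) :=
    integrable_exp_neg_mul_sq (half_pos M.β_pos)
  have hsplit : (fun x : ℝ × ℝ =>
      Real.exp (-M.β * (x.1 ^ 2 / 2 + M.V x.2)) / (√(2 * Real.pi * M.β⁻¹) * M.Z)) =
      fun x => (Real.exp (-(M.β / 2) * x.1 ^ 2) * Real.exp (-M.β * M.V x.2)) /
        (√(2 * Real.pi * M.β⁻¹) * M.Z) := by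
    funext x
    rw [← Real.exp_add]
    ring_nf
  have hint : Integrable (fun x : ℝ × ℝ =>
      Real.exp (-M.β * (x.1 ^ 2 / 2 + M.V x.2)) / (√(2 * Real.pi * M.β⁻¹) * M.Z)) := by
    rw [hsplit]
    exact (hp.mul_prod M.integrable_exp_V).div_const _
  have hsq : 0 < √(2 * Real.pi * M.β⁻¹) :=
    Real.sqrt_pos.2 (mul_pos Real.two_pi_pos (inv_pos.2 M.β_pos))
  have hval : ∫ x : ℝ × ℝ,
      Real.exp (-M.β * (x.1 ^ 2 / 2 + M.V x.2)) / (√(2 * Real.pi * M.β⁻¹) * M.Z) = 1 := by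
    rw [hsplit, integral_div, Measure.volume_eq_prod,
      integral_prod_mul (fun p : ℝ => Real.exp (-(M.β / 2) * p ^ 2))
        (fun r : ℝ => Real.exp (-M.β * M.V r)), integral_gaussian]
    have : Real.pi / (M.β / 2) = 2 * Real.pi * M.β⁻¹ := by
      have := M.β_pos.ne'
      field_simp
    rw [this]
    exact div_self (mul_pos hsq M.Z_pos).ne'
  rw [siteMeasure, withDensity_apply _ MeasurableSet.univ, Measure.restrict_univ,
    ← ofReal_integral_eq_lintegral_ofReal hint, hval, ENNReal.ofReal_one]
  refine Eventually.of_forall fun x => ?_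
  have := M.Z_pos
  positivity

/-- The product measure `ν_β` on `(ℝ²)^ℤ`; `⟨f⟩_β = ∫ f dν_β`. -/
def gibbs (M : EnergyChain) : Measure Config := Measure.infinitePi fun _ : ℤ => M.siteMeasure

/-! ### Shifts, vector fields and generators -/

/-- `(τ_j F)(ω) = F(τ_j ω)` with `(τ_j ω)_i = ω_{i+j}`. -/
def shift (j : ℤ) (F : Config → ℝ) : Config → ℝ := fun ω => F fun i => ω (i + j)

/-- `∂F/∂p_i`. -/
def dp (i : ℤ) (F : Config → ℝ) : Config → ℝ := fun ω =>
  deriv (fun t => F (Function.update ω i (t, (ω i).2))) (ω i).1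

/-- `∂F/∂r_i`. -/
def dr (i : ℤ) (F : Config → ℝ) : Config → ℝ := fun ω =>
  deriv (fun t => F (Function.update ω i ((ω i).1, t))) (ω i).2

/-- `Y_{i,j} = p_i ∂_{r_j} - V'(r_j) ∂_{p_i}`. -/
def Y (M : EnergyChain) (i j : ℤ) (F : Config → ℝ) : Config → ℝ := fun ω =>
  (ω i).1 * dr j F ω - deriv M.V (ω j).2 * dp i F ω

/-- `X_i = Y_{i,i}`. -/
def X (M : EnergyChain) (i : ℤ) (F : Config → ℝ) : Config → ℝ := M.Y i i F

/-- `S^γ F = (γ/2) ∑_i (X_i² F + Y_{i,i+1}² F)`; for local `F` only finitely many terms are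
nonzero. -/
def S (M : EnergyChain) (F : Config → ℝ) : Config → ℝ := fun ω =>
  M.γ / 2 * ∑ᶠ i : ℤ, (M.X i (M.X i F) ω + M.Y i (i + 1) (M.Y i (i + 1) F) ω)

/-- `A F = ∑_i (X_i F - Y_{i,i+1} F)`. -/
def A (M : EnergyChain) (F : Config → ℝ) : Config → ℝ := fun ω =>
  ∑ᶠ i : ℤ, (M.X i F ω - M.Y i (i + 1) F ω)

/-- `L^γ = S^γ + A`. -/
def L (M : EnergyChain) (F : Config → ℝ) : Config → ℝ := M.S F + M.A F

/-- The energy `ℰ_i = p_i²/2 + V(r_i)`. -/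
def energy (M : EnergyChain) (i : ℤ) : Config → ℝ := fun ω => (ω i).1 ^ 2 / 2 + M.V (ω i).2

/-- The microscopic energy current
`W_{0,1} = -p_0 V'(r_1) + (γ/2) (p_0² V''(r_1) - V'(r_1)²)`. -/
def current (M : EnergyChain) : Config → ℝ := fun ω =>
  -((ω 0).1 * deriv M.V (ω 1).2) +
    M.γ / 2 * ((ω 0).1 ^ 2 * deriv (deriv M.V) (ω 1).2 - deriv M.V (ω 1).2 ^ 2)

/-- The gradient `p_1² - p_0²`. -/
def gradient : Config → ℝ := fun ω => (ω 1).1 ^ 2 - (ω 0).1 ^ 2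

/-! ### Spaces of local functions -/

/-- `F` is a smooth function of finitely many coordinates. -/
def IsSmoothLocal (F : Config → ℝ) : Prop :=
  ∃ (Λ : Finset ℤ) (φ : (Λ → ℝ × ℝ) → ℝ), ContDiff ℝ (⊤ : ℕ∞) φ ∧ F = fun ω => φ fun i => ω i

/-- `F` is a smooth, compactly supported function of finitely many coordinates. -/
def IsSmoothLocalCompact (F : Config → ℝ) : Prop :=
  ∃ (Λ : Finset ℤ) (φ : (Λ → ℝ × ℝ) → ℝ),
    ContDiff ℝ (⊤ : ℕ∞) φ ∧ HasCompactSupport φ ∧ F = fun ω => φ fun i => ω i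

/-- The space `𝒞` generated by the smooth local functions with compact support and zero average
with respect to `ν_β`. (A sum of two such functions that depend on different sites need not be
compactly supported in the joint set of coordinates, so the linear span is taken.) -/
def testSpace (M : EnergyChain) : Submodule ℝ (Config → ℝ) :=
  Submodule.span ℝ {F | IsSmoothLocalCompact F ∧ ∫ ω, F ω ∂M.gibbs = 0}

/-- The space of smooth local functions `F` with `F`, `X_i F`, `Y_{i,i+1} F` in `L²(ν_β)` for
all `i`. -/
def smoothL2 (M : EnergyChain) : Set (Config → ℝ) :=
  {F | IsSmoothLocal F ∧ MemLp F 2 M.gibbs ∧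
    ∀ i : ℤ, MemLp (M.X i F) 2 M.gibbs ∧ MemLp (M.Y i (i + 1) F) 2 M.gibbs}

/-- The space `𝒞₀` of finite sums `∑_{i ∈ Λ} (X_i F_i + Y_{i,i+1} G_i)` with `F_i`, `G_i` in
`smoothL2`. -/
def fluctSpace (M : EnergyChain) : Set (Config → ℝ) :=
  {h | ∃ (Λ : Finset ℤ) (F G : ℤ → Config → ℝ),
    (∀ i ∈ Λ, F i ∈ M.smoothL2 ∧ G i ∈ M.smoothL2) ∧
    h = ∑ i ∈ Λ, (M.X i (F i) + M.Y i (i + 1) (G i))}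

/-! ### The seminorm and the diffusion constant -/

/-- `X_0 Γ_F`, where `Γ_F = ∑_j τ_j F` is a formal sum. -/
def XGamma (M : EnergyChain) (F : Config → ℝ) : Config → ℝ := fun ω =>
  ∑ᶠ j : ℤ, M.X 0 (shift j F) ω

/-- `Y_{0,1} Γ_F`. -/
def YGamma (M : EnergyChain) (F : Config → ℝ) : Config → ℝ := fun ω =>
  ∑ᶠ j : ℤ, M.Y 0 1 (shift j F) ω

/-- `≪g, h≫_* = ∑_i ⟨g, τ_i h⟩`; only finitely many terms are nonzero for local, centered
functions. -/
def starForm (M : EnergyChain) (g h : Config → ℝ) : ℝ :=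
  ∑ᶠ i : ℤ, ∫ ω, g ω * shift i h ω ∂M.gibbs

/-- `≪h≫_** = ∑_i i ⟨h, ℰ_i⟩`; only finitely many terms are nonzero for local, centered `h`. -/
def starStarForm (M : EnergyChain) (h : Config → ℝ) : ℝ :=
  ∑ᶠ i : ℤ, (i : ℝ) * ∫ ω, h ω * M.energy i ω ∂M.gibbs

/-- The square of the seminorm `|||h|||_{-1}` for `h ∈ 𝒞₀`: the supremum over `g ∈ 𝒞`, `a ∈ ℝ` of
`2≪g,h≫_* + 2a≪h≫_** - (γ/2)⟨(a p_0 V'(r_1) + Y_{0,1}Γ_g)²⟩ - (γ/2)⟨(X_0 Γ_g)²⟩`. -/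
def normSq (M : EnergyChain) (h : Config → ℝ) : EReal :=
  ⨆ (g : M.testSpace) (a : ℝ),
    ((2 * M.starForm g h + 2 * a * M.starStarForm h
      - M.γ / 2 * ∫ ω, (a * ((ω 0).1 * deriv M.V (ω 1).2) + M.YGamma g ω) ^ 2 ∂M.gibbs
      - M.γ / 2 * ∫ ω, M.XGamma g ω ^ 2 ∂M.gibbs : ℝ) : EReal)

/-- `h ∈ 𝒞₀` lies in the closure of `L𝒞` in the Hilbert space `ℋ₋₁`, the completion of `𝒞₀` for
the seminorm `|||·|||_{-1}`. -/
def MemClosureL (M : EnergyChain) (h : Config → ℝ) : Prop :=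
  h ∈ M.fluctSpace ∧
    ∃ F : ℕ → M.testSpace, Tendsto (fun K => M.normSq (h - M.L (F K))) atTop (𝓝 0)

/-- The defining property of the diffusion constant `κ_β`:
`W_{0,1} + κ_β (p_1² - p_0²)` lies in the closure of `L𝒞` in `ℋ₋₁`. -/
def IsDiffusionConstant (M : EnergyChain) (κ : ℝ) : Prop :=
  M.MemClosureL (M.current + κ • gradient)

end EnergyChain

end

/-! The problem is a Lax–Milgram argument in the Hilbert space `L² × L²`. Put `ξ g = (Y_{0,1}Γ_g,
X_0Γ_g)`, `e = (p_0 V'(r_1), 0)` and `lam = γ/2`. Each `X_i` and `Y_{i,i+1}` is antisymmetric for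
the Gibbs measure, so integrating by parts writes the two linear terms of the seminorm of `h` as
`-2⟪(u, v), ξ g + a e⟫` for an explicit pair `(u, v)` (`HasRep`). The seminorm is therefore the dual
norm `dualSq` of that functional on the span of the `ξ g` and `e`. For `W + κ (p_1² - p_0²) - L F`
the pair is `lam e + w + κ d - (lam ξ F + α F)`. Here `w = (-ℰ_1, 0)`, `d = (-p_0 r_1, p_0 r_0)` and
`α F = (-Γ_F, Γ_F)`, with `Γ_F` cut off to a finite window.

Four facts drive the abstract part. The form `⟪α f, ξ g⟫` is antisymmetric on the diagonal, and `⟪α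
f, e⟫ = -⟪w, ξ f⟫`. The vector `d` is orthogonal to every `ξ g`, because the translates of `p_1² -
p_0²` telescope. Moreover `⟪d, e⟫ = -β⁻²` is nonzero. Finally the sector condition `|⟪α f, ξ g⟫| ≤ C
‖ξ f‖ ‖ξ g‖` holds.

Existence: `lam + α` is bounded and coercive on the closure of the range of `ξ`, so its functionals
approximate that of `W` there (`FDData.exists_approx`). The resulting `ξ F_n` converge, and since
`κ` is visible only in the direction `e`, it can be tuned to cancel the remaining component.
Uniqueness: two approximating sequences have asymptotically equal `ξ F`, hence equal `e`-components,
hence equal `κ`. Lower bound: pairing with `e - ξ F` cancels all antisymmetric terms and leaves `lam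
‖e - ξ F‖² - κ β⁻²`. Cauchy–Schwarz against `d` gives `‖e - ξ F‖ ≥ β⁻²/‖d‖`, and `‖d‖² = 2 β⁻¹
⟨r_0²⟩` yields the stated constant.

The analytic input is the sector condition. Under the Gibbs measure `(p_i, r_j)` has the one-site
law for all `i, j`, and `Y_{i,j}` is the Hamiltonian field of `p²/2 + V(r)` in that pair. A change
of variable in `r` turns the energy levels into circles, on which the field is the angular
derivative up to a bounded positive factor. There the condition reduces to a Poincaré-type estimate
(`abs_integral_circle_le`) with a constant uniform in the level. -/

noncomputable section

/-- The supremum over `g`, `b` of `-2⟪v, ξ g + b e⟫ - lam ‖ξ g + b e‖²`. -/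
def dualSq {E H : Type*} [AddCommGroup E] [Module ℝ E] [NormedAddCommGroup H]
    [InnerProductSpace ℝ H] (ξ : E →ₗ[ℝ] H) (e : H) (lam : ℝ) (v : H) : EReal :=
  ⨆ (g : E) (b : ℝ), ((-2 * inner ℝ v (ξ g + b • e) - lam * ‖ξ g + b • e‖ ^ 2 : ℝ) : EReal)

/-! ### Dual norms and the abstract fluctuation-dissipation problem. -/

section Abstract

variable {E H : Type*} [AddCommGroup E] [Module ℝ E] [NormedAddCommGroup H]
  [InnerProductSpace ℝ H] {ξ : E →ₗ[ℝ] H} {e : H} {lam : ℝ}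

lemma dualSq_nonneg (v : H) : 0 ≤ dualSq ξ e lam v := by
  refine le_trans ?_ (le_iSup₂ (f := fun (g : E) (b : ℝ) =>
    ((-2 * inner ℝ v (ξ g + b • e) - lam * ‖ξ g + b • e‖ ^ 2 : ℝ) : EReal)) 0 0)
  simp

/-- If the functional `⟪v, ·⟫` has norm at most `ε` on the range of `(g, b) ↦ ξ g + b e`, its dual
square is at most `ε² / lam`. -/
lemma dualSq_le (hlam : 0 < lam) {v : H} {ε : ℝ}
    (h : ∀ g (b : ℝ), |inner ℝ v (ξ g + b • e)| ≤ ε * ‖ξ g + b • e‖) :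
    dualSq ξ e lam v ≤ ((ε ^ 2 / lam : ℝ) : EReal) := by
  refine iSup₂_le fun g b => EReal.coe_le_coe_iff.2 ?_
  have h1 := (abs_le.1 (h g b)).1
  rw [le_div_iff₀ hlam]
  nlinarith [sq_nonneg (lam * ‖ξ g + b • e‖ - ε)]

lemma le_of_dualSq_le {v : H} {η : ℝ} (h : dualSq ξ e lam v ≤ (η : EReal)) (g : E) (b : ℝ) :
    -2 * inner ℝ v (ξ g + b • e) - lam * ‖ξ g + b • e‖ ^ 2 ≤ η :=
  EReal.coe_le_coe_iff.1 ((le_iSup₂ (f := fun (g : E) (b : ℝ) =>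
    ((-2 * inner ℝ v (ξ g + b • e) - lam * ‖ξ g + b • e‖ ^ 2 : ℝ) : EReal)) g b).trans h)

/-- The test vectors form a linear space, so the quadratic bound may be applied to every multiple of
a given one and optimised over the factor. This is the converse of `dualSq_le`. -/
lemma abs_inner_le_of_dualSq_le (hlam : 0 < lam) {v : H} {ε : ℝ} (hε : 0 < ε)
    (h : dualSq ξ e lam v ≤ ((ε ^ 2 / lam : ℝ) : EReal)) (g : E) (b : ℝ) :
    |inner ℝ v (ξ g + b • e)| ≤ ε * ‖ξ g + b • e‖ := by
  set y := ξ g + b • e with hy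
  have key : ∀ t : ℝ, -2 * (t * inner ℝ v y) - lam * (t ^ 2 * ‖y‖ ^ 2) ≤ ε ^ 2 / lam := by
    intro t
    have := le_of_dualSq_le h (t • g) (t * b)
    have h2 : ξ (t • g) + (t * b) • e = t • y := by
      rw [map_smul, mul_smul, hy, smul_add]
    rw [h2, inner_smul_right, norm_smul, mul_pow, Real.norm_eq_abs, sq_abs] at this
    exact this
  rcases eq_or_ne y 0 with h0 | h0
  · simp [h0]
  have hn : 0 < ‖y‖ := norm_pos_iff.2 h0
  -- With this factor the quadratic term is exactly `ε² / lam`; the two signs give the two halves of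
  -- the absolute value.
  have k1 := key (ε / (lam * ‖y‖))
  have k2 := key (-(ε / (lam * ‖y‖)))
  have e1 : lam * ((ε / (lam * ‖y‖)) ^ 2 * ‖y‖ ^ 2) = ε ^ 2 / lam := by field_simp
  rw [e1] at k1
  rw [neg_sq, e1] at k2
  have hs : 0 < ε / (lam * ‖y‖) := by positivity
  have e2 : ε ^ 2 / lam = (ε / (lam * ‖y‖)) * (ε * ‖y‖) := by field_simp
  rw [e2] at k1 k2
  rw [abs_le]
  constructor
  · have : ε / (lam * ‖y‖) * (-(ε * ‖y‖)) ≤ ε / (lam * ‖y‖) * inner ℝ v y := by linarith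
    exact le_of_mul_le_mul_left this hs
  · have : ε / (lam * ‖y‖) * inner ℝ v y ≤ ε / (lam * ‖y‖) * (ε * ‖y‖) := by linarith
    exact le_of_mul_le_mul_left this hs

/-- The Hilbert space data of a fluctuation-dissipation problem: `ξ f` and `e` are the symmetric
parts, `α f` and `w` the antisymmetric ones, and `d` spans the orthogonal complement of the `ξ f`. -/
structure FDData (E H : Type*) [AddCommGroup E] [Module ℝ E] [NormedAddCommGroup H]
    [InnerProductSpace ℝ H] where
  ξ : E →ₗ[ℝ] H
  α : E → H
  e : H
  d : H
  w : H
  lam : ℝ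
  c : ℝ
  C : ℝ
  lam_pos : 0 < lam
  c_pos : 0 < c
  α_add : ∀ f f' g, inner ℝ (α (f + f')) (ξ g) = inner ℝ (α f) (ξ g) + inner ℝ (α f') (ξ g)
  α_smul : ∀ (t : ℝ) f g, inner ℝ (α (t • f)) (ξ g) = t * inner ℝ (α f) (ξ g)
  sector : ∀ f g, |inner ℝ (α f) (ξ g)| ≤ C * ‖ξ f‖ * ‖ξ g‖
  α_self : ∀ f, inner ℝ (α f) (ξ f) = 0
  α_e : ∀ f, inner ℝ (α f) e = -inner ℝ w (ξ f)
  w_e : inner ℝ w e = 0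
  d_ξ : ∀ g, inner ℝ d (ξ g) = 0
  d_e : inner ℝ d e = -c

namespace FDData

variable (D : FDData E H)

/-- The vector representing the functional of `W + κ ∇ - L F`. -/
def rep (κ : ℝ) (F : E) : H := D.lam • D.e + D.w + κ • D.d - (D.lam • D.ξ F + D.α F)

/-- `W + κ ∇` is approximated by `L F`, `F ∈ E`. -/
def IsLimit (κ : ℝ) : Prop :=
  ∃ F : ℕ → E, Tendsto (fun K => dualSq D.ξ D.e D.lam (D.rep κ (F K))) atTop (𝓝 0)

/-- Pairing with `d` kills `ξ g` and sees only `b e`. Quantitatively, `e` stays away from the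
closure of the range of `ξ`. -/
lemma c_le (g : E) (b : ℝ) : D.c * |b| ≤ ‖D.d‖ * ‖D.ξ g + b • D.e‖ := by
  have := abs_real_inner_le_norm D.d (D.ξ g + b • D.e)
  rw [inner_add_right, inner_smul_right, D.d_ξ, D.d_e, zero_add, abs_mul, abs_neg,
    abs_of_pos D.c_pos] at this
  linarith

lemma sector' (f g : E) : |inner ℝ (D.α f) (D.ξ g)| ≤ |D.C| * ‖D.ξ f‖ * ‖D.ξ g‖ := by
  refine (D.sector f g).trans ?_
  gcongr
  exact le_abs_self _

lemma α_sub (f f' g : E) : inner ℝ (D.α (f - f')) (D.ξ g) =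
    inner ℝ (D.α f) (D.ξ g) - inner ℝ (D.α f') (D.ξ g) := by
  rw [sub_eq_add_neg, D.α_add, ← neg_one_smul ℝ f', D.α_smul]
  ring

/-- Since `d` is orthogonal to `ξ g`, the constant `κ` disappears here; it enters only the pairing
with `e` below. -/
lemma inner_rep_ξ (κ : ℝ) (F g : E) : inner ℝ (D.rep κ F) (D.ξ g) =
    inner ℝ (D.lam • D.e + D.w) (D.ξ g) -
      (D.lam * inner ℝ (D.ξ F) (D.ξ g) + inner ℝ (D.α F) (D.ξ g)) := by
  simp only [rep, inner_sub_left, inner_add_left, inner_smul_left, D.d_ξ]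
  simp

lemma inner_rep_e (κ : ℝ) (F : E) : inner ℝ (D.rep κ F) D.e =
    D.lam * ‖D.e‖ ^ 2 - κ * D.c - D.lam * inner ℝ (D.ξ F) D.e + inner ℝ D.w (D.ξ F) := by
  simp only [rep, inner_sub_left, inner_add_left, inner_smul_left, D.d_e, D.w_e, D.α_e,
    real_inner_self_eq_norm_sq]
  simp
  ring

/-- Coercivity: `ξ F` is controlled by the functional `lam ξ F + α F`. -/
lemma coercive {F : E} {ε : ℝ}
    (h : |D.lam * inner ℝ (D.ξ F) (D.ξ F) + inner ℝ (D.α F) (D.ξ F)| ≤ ε * ‖D.ξ F‖) :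
    D.lam * ‖D.ξ F‖ ≤ ε ∨ ‖D.ξ F‖ = 0 := by
  rw [D.α_self, add_zero, real_inner_self_eq_norm_sq,
    abs_of_nonneg (mul_nonneg D.lam_pos.le (sq_nonneg _))] at h
  rcases eq_or_ne ‖D.ξ F‖ 0 with h0 | h0
  · exact Or.inr h0
  · left
    have hp : 0 < ‖D.ξ F‖ := lt_of_le_of_ne (norm_nonneg _) h0.symm
    refine le_of_mul_le_mul_right ?_ hp
    linarith [h, sq ‖D.ξ F‖, mul_assoc D.lam ‖D.ξ F‖ ‖D.ξ F‖,
      congrArg (D.lam * ·) (sq ‖D.ξ F‖)]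

lemma coercive' {F : E} {ε : ℝ} (hε : 0 ≤ ε)
    (h : |D.lam * inner ℝ (D.ξ F) (D.ξ F) + inner ℝ (D.α F) (D.ξ F)| ≤ ε * ‖D.ξ F‖) :
    ‖D.ξ F‖ ≤ ε / D.lam := by
  rw [le_div_iff₀ D.lam_pos, mul_comm]
  rcases D.coercive h with h | h
  · exact h
  · rw [h, mul_zero]; exact hε

/-- Pairing the representing vector with `x = e - ξ F` leaves `lam ‖x‖² - κ c`, which tends to zero
in the weak sense below, while `‖x‖ ≥ c / ‖d‖` because `⟪d, x⟫ = -c`. -/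
lemma lower_bound (hd : D.d ≠ 0) {κ : ℝ} (h : D.IsLimit κ) :
    D.lam * D.c / ‖D.d‖ ^ 2 ≤ κ := by
  obtain ⟨F, hF⟩ := h
  have hdn : 0 < ‖D.d‖ := norm_pos_iff.2 hd
  have hc := D.c_pos
  have hl := D.lam_pos
  -- Testing against `-t x` and letting `t → 0` only after the limit along the sequence makes the
  -- quadratic penalty harmless without any bound on `‖x‖`. The restriction `t < 2` keeps `2t - t²`
  -- positive.
  have key : ∀ t : ℝ, 0 < t → t < 2 → D.lam * (1 - t / 2) * D.c / ‖D.d‖ ^ 2 ≤ κ := by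
    intro t ht ht2
    have h1 : ∀ η : ℝ, 0 < η →
        D.lam * (2 * t - t ^ 2) * (D.c ^ 2 / ‖D.d‖ ^ 2) - 2 * t * κ * D.c ≤ η := by
      intro η hη
      have hev := hF.eventually (gt_mem_nhds (show (0 : EReal) < ((η : ℝ) : EReal) by
        exact_mod_cast hη))
      obtain ⟨K, hK⟩ := hev.exists
      have h2 := le_of_dualSq_le hK.le (t • F K) (-t)
      set x := D.e - D.ξ (F K) with hx
      have hxe : D.ξ (t • F K) + (-t) • D.e = (-t) • x := by
        rw [map_smul, hx, smul_sub]; simp [sub_eq_add_neg, add_comm]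
      -- The antisymmetric contributions vanish: `⟪α F, ξ F⟫ = 0` and `⟪w, e⟫ = 0`, and the `⟪w, ξ
      -- F⟫` coming from `w` cancels the one coming from `⟪α F, e⟫`.
      have hin : inner ℝ (D.rep κ (F K)) x = D.lam * ‖x‖ ^ 2 - κ * D.c := by
        have : ‖x‖ ^ 2 = ‖D.e‖ ^ 2 - 2 * inner ℝ (D.ξ (F K)) D.e + ‖D.ξ (F K)‖ ^ 2 := by
          rw [hx, norm_sub_sq_real, real_inner_comm]
        rw [this, hx, inner_sub_right, D.inner_rep_e, D.inner_rep_ξ, D.α_self, inner_add_left,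
          inner_smul_left, real_inner_self_eq_norm_sq, real_inner_comm D.e]
        simp
        ring
      rw [hxe, inner_smul_right, norm_smul, mul_pow, Real.norm_eq_abs, sq_abs, hin, neg_sq] at h2
      have h3 := D.c_le (-F K) 1
      have hx' : D.ξ (-F K) + (1 : ℝ) • D.e = x := by rw [map_neg, one_smul, hx]; abel
      rw [hx', abs_one, mul_one] at h3
      have h4 : D.c ^ 2 / ‖D.d‖ ^ 2 ≤ ‖x‖ ^ 2 := by
        rw [div_le_iff₀ (by positivity), ← mul_pow, mul_comm]
        exact pow_le_pow_left₀ hc.le h3 2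
      have h5 : 0 ≤ D.lam * (2 * t - t ^ 2) := mul_nonneg hl.le (by nlinarith)
      have h6 := mul_le_mul_of_nonneg_left h4 h5
      nlinarith
    have h2 := le_of_forall_pos_le_add (a := D.lam * (2 * t - t ^ 2) * (D.c ^ 2 / ‖D.d‖ ^ 2) -
      2 * t * κ * D.c) (b := 0) (by intro η hη; simpa using h1 η hη)
    have h3 : D.lam * (2 * t - t ^ 2) * (D.c ^ 2 / ‖D.d‖ ^ 2) =
        2 * t * D.c * (D.lam * (1 - t / 2) * D.c / ‖D.d‖ ^ 2) := by
      field_simp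
    rw [h3] at h2
    refine le_of_mul_le_mul_left ?_ (show 0 < 2 * t * D.c by positivity)
    linarith
  have hlim : Tendsto (fun t : ℝ => D.lam * (1 - t / 2) * D.c / ‖D.d‖ ^ 2) (𝓝[>] 0)
      (𝓝 (D.lam * D.c / ‖D.d‖ ^ 2)) := by
    have : Continuous fun t : ℝ => D.lam * (1 - t / 2) * D.c / ‖D.d‖ ^ 2 := by fun_prop
    have h := (this.tendsto 0).mono_left (nhdsWithin_le_nhds (s := Set.Ioi 0))
    simpa using h
  refine le_of_tendsto hlim ?_
  filter_upwards [Ioo_mem_nhdsGT (show (0 : ℝ) < 2 by norm_num)] with t ht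
  exact key t ht.1 ht.2

/-- On the range of `ξ` the two functionals differ only by `lam ξ G + α G` with `G = F - F'`, so
coercivity makes `ξ G` small. The pairings with `e` then differ by `(κ - κ') c` up to terms
controlled by `‖ξ G‖`. -/
lemma unique {κ κ' : ℝ} (h : D.IsLimit κ) (h' : D.IsLimit κ') : κ = κ' := by
  obtain ⟨F, hF⟩ := h
  obtain ⟨F', hF'⟩ := h'
  have hl := D.lam_pos
  -- The first summand collects the two errors in the pairing with `e`; the second comes from `‖ξ G‖
  -- ≤ 2 ε / lam`.
  set B := 2 * ‖D.e‖ + (D.lam * ‖D.e‖ + ‖D.w‖) * (2 / D.lam) with hB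
  have key : ∀ ε : ℝ, 0 < ε → |κ - κ'| * D.c ≤ ε * B := by
    intro ε hε
    have hpos : (0 : EReal) < ((ε ^ 2 / D.lam : ℝ) : EReal) := by
      exact_mod_cast (by positivity : 0 < ε ^ 2 / D.lam)
    obtain ⟨K, h1, h2⟩ := ((hF.eventually (gt_mem_nhds hpos)).and
      (hF'.eventually (gt_mem_nhds hpos))).exists
    have k1 := abs_inner_le_of_dualSq_le hl hε h1.le
    have k2 := abs_inner_le_of_dualSq_le hl hε h2.le
    set G := F K - F' K with hG
    have e1 := k1 G 0
    have e2 := k2 G 0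
    simp only [zero_smul, add_zero] at e1 e2
    rw [D.inner_rep_ξ] at e1 e2
    have e3 : |D.lam * inner ℝ (D.ξ G) (D.ξ G) + inner ℝ (D.α G) (D.ξ G)| ≤
        (2 * ε) * ‖D.ξ G‖ := by
      have : D.lam * inner ℝ (D.ξ G) (D.ξ G) + inner ℝ (D.α G) (D.ξ G) =
          (inner ℝ (D.lam • D.e + D.w) (D.ξ G) - (D.lam * inner ℝ (D.ξ (F' K)) (D.ξ G) +
            inner ℝ (D.α (F' K)) (D.ξ G))) - (inner ℝ (D.lam • D.e + D.w) (D.ξ G) -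
            (D.lam * inner ℝ (D.ξ (F K)) (D.ξ G) + inner ℝ (D.α (F K)) (D.ξ G))) := by
        have a1 : inner ℝ (D.α G) (D.ξ G) =
          inner ℝ (D.α (F K)) (D.ξ G) - inner ℝ (D.α (F' K)) (D.ξ G) := D.α_sub _ _ _
        have a2 : inner ℝ (D.ξ G) (D.ξ G) =
          inner ℝ (D.ξ (F K)) (D.ξ G) - inner ℝ (D.ξ (F' K)) (D.ξ G) := by
            rw [← inner_sub_left, ← map_sub]
        rw [a1, a2]; ring
      rw [this]
      refine (abs_sub _ _).trans ?_
      linarith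
    have e4 := D.coercive' (by positivity) e3
    have f1 := k1 0 1
    have f2 := k2 0 1
    simp only [map_zero, one_smul, zero_add] at f1 f2
    rw [D.inner_rep_e] at f1 f2
    have g1 := abs_real_inner_le_norm (D.ξ G) D.e
    have g2 := abs_real_inner_le_norm D.w (D.ξ G)
    have a1 : inner ℝ (D.ξ G) D.e = inner ℝ (D.ξ (F K)) D.e - inner ℝ (D.ξ (F' K)) D.e := by
      rw [← inner_sub_left, ← map_sub]
    have a2 : inner ℝ D.w (D.ξ G) = inner ℝ D.w (D.ξ (F K)) - inner ℝ D.w (D.ξ (F' K)) := by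
      rw [← inner_sub_right, ← map_sub]
    rw [a1] at g1
    rw [a2] at g2
    have g3 : |D.lam * (inner ℝ (D.ξ (F K)) D.e - inner ℝ (D.ξ (F' K)) D.e)| ≤
        D.lam * (‖D.ξ G‖ * ‖D.e‖) := by
      rw [abs_mul, abs_of_pos hl]
      exact mul_le_mul_of_nonneg_left g1 hl.le
    have g4 : |κ - κ'| * D.c ≤ 2 * (ε * ‖D.e‖) + D.lam * (‖D.ξ G‖ * ‖D.e‖) + ‖D.w‖ * ‖D.ξ G‖ := by
      have hm : |κ - κ'| * D.c = |(κ - κ') * D.c| := by rw [abs_mul, abs_of_pos D.c_pos]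
      rw [hm]
      rw [abs_le] at f1 f2 g2 g3 ⊢
      constructor <;> linarith [f1.1, f1.2, f2.1, f2.2, g2.1, g2.2, g3.1, g3.2]
    have g5 := mul_le_mul_of_nonneg_left e4
      (show 0 ≤ D.lam * ‖D.e‖ + ‖D.w‖ by positivity)
    have : ε * B = 2 * (ε * ‖D.e‖) + (D.lam * ‖D.e‖ + ‖D.w‖) * (2 * ε / D.lam) := by
      rw [hB]; ring
    rw [this]
    linarith
  have h0 : |κ - κ'| * D.c ≤ 0 := by
    refine le_of_forall_pos_le_add fun η hη => ?_
    have := key (η / (B + 1)) (by positivity)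
    refine this.trans ?_
    rw [zero_add, div_mul_eq_mul_div, div_le_iff₀ (by positivity)]
    nlinarith
  have h1 : |κ - κ'| ≤ 0 := by
    by_contra hcon
    push Not at hcon
    have := mul_pos hcon D.c_pos
    linarith
  exact sub_eq_zero.1 (abs_nonpos_iff.1 h1)

/-- The functional of `W` on the `ξ g` is approximated by those of `L F`. -/
lemma exists_approx [CompleteSpace H] {ε : ℝ} (hε : 0 < ε) :
    ∃ F : E, ∀ g, |inner ℝ (D.rep 0 F) (D.ξ g)| ≤ ε * ‖D.ξ g‖ := by
  -- Functionals on the range of `ξ` are represented in its closure `K`. Projecting is essential: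
  -- the sector condition controls the component of `α F` in `K`, not `α F` itself.
  set K : Submodule ℝ H := (LinearMap.range D.ξ).topologicalClosure with hK
  have hξK : ∀ g, D.ξ g ∈ K := fun g =>
    (LinearMap.range D.ξ).le_topologicalClosure (LinearMap.mem_range_self _ g)
  have : CompleteSpace K := (Submodule.isClosed_topologicalClosure _).completeSpace_coe
  have hproj : ∀ (v : H) g, inner ℝ (K.orthogonalProjectionOnto v : H) (D.ξ g) =
      inner ℝ v (D.ξ g) := by
    intro v g
    have := Submodule.starProjection_inner_eq_zero v (D.ξ g) (hξK g)
    rw [inner_sub_left, sub_eq_zero] at this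
    exact this.symm
  -- The representatives in `K` of the functionals of `L F`; the claim is that they are dense.
  let R : Submodule ℝ K :=
    { carrier := {y | ∃ F : E, ∀ g, inner ℝ (y : H) (D.ξ g) =
        D.lam * inner ℝ (D.ξ F) (D.ξ g) + inner ℝ (D.α F) (D.ξ g)}
      add_mem' := by
        rintro a b ⟨F, hF⟩ ⟨F', hF'⟩
        refine ⟨F + F', fun g => ?_⟩
        rw [Submodule.coe_add, inner_add_left, hF, hF', map_add, inner_add_left, D.α_add]
        ring
      zero_mem' := by
        refine ⟨0, fun g => ?_⟩
        have := D.α_smul 0 0 g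
        rw [zero_smul, zero_mul] at this
        simp [this]
      smul_mem' := by
        rintro t a ⟨F, hF⟩
        refine ⟨t • F, fun g => ?_⟩
        rw [Submodule.coe_smul, inner_smul_left, hF, map_smul, inner_smul_left, D.α_smul]
        simp
        ring }
  have hR : R.topologicalClosure = ⊤ := by
    rw [Submodule.topologicalClosure_eq_top_iff, Submodule.eq_bot_iff]
    intro v hv
    -- If `v` is orthogonal to `R`, then `lam ξ F + α F` annihilates `v` for every `F`. Formally
    -- taking `ξ F = v` would give `lam ‖v‖² = 0`; since `v` is only a limit of such vectors, the
    -- argument is run on an approximating sequence.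
    have hvR : ∀ F, D.lam * inner ℝ (D.ξ F) (v : H) +
        inner ℝ (K.orthogonalProjectionOnto (D.α F) : H) (v : H) = 0 := by
      intro F
      have h1 : K.orthogonalProjectionOnto (D.lam • D.ξ F + D.α F) ∈ R := by
        refine ⟨F, fun g => ?_⟩
        rw [hproj, inner_add_left, inner_smul_left]
        simp
      have h2 := (Submodule.mem_orthogonal R v).1 hv _ h1
      rw [Submodule.coe_inner, map_add, map_smul, Submodule.coe_add, Submodule.coe_smul,
        inner_add_left, inner_smul_left] at h2
      have h3 : (K.orthogonalProjectionOnto (D.ξ F) : H) = D.ξ F :=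
        Submodule.starProjection_eq_self_iff.2 (hξK F)
      rw [h3] at h2
      simpa using h2
    have hKcl : ∀ y ∈ K, y ∈ closure (Set.range D.ξ) := by
      intro y hy
      rwa [hK, ← SetLike.mem_coe, Submodule.topologicalClosure_coe, LinearMap.coe_range] at hy
    have hcl : (v : H) ∈ closure (Set.range D.ξ) := hKcl _ v.2
    -- The sector condition extends by continuity from the range of `ξ` to its closure.
    have hproj_le : ∀ F, ∀ y ∈ closure (Set.range D.ξ),
        |inner ℝ (K.orthogonalProjectionOnto (D.α F) : H) y| ≤ |D.C| * ‖D.ξ F‖ * ‖y‖ := by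
      intro F y hy
      refine closure_minimal (t := {y | |inner ℝ (K.orthogonalProjectionOnto (D.α F) : H) y| ≤
        |D.C| * ‖D.ξ F‖ * ‖y‖}) ?_ ?_ hy
      · rintro _ ⟨g, rfl⟩
        rw [Set.mem_ofPred_eq, hproj]
        exact D.sector' F g
      · exact isClosed_le (by fun_prop) (by fun_prop)
    obtain ⟨u, hu, hlim⟩ := mem_closure_iff_seq_limit.1 hcl
    choose F hF using hu
    -- Because `⟪α F_n, ξ F_n⟫ = 0`, the term `⟪α F_n, v⟫` only sees `u n - v`; the same replacement
    -- in `⟪u n, v⟫` leaves `‖u n‖²`.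
    have hbound : ∀ n, D.lam * ‖u n‖ ^ 2 ≤ (D.lam + |D.C|) * ‖u n‖ * ‖u n - v‖ := by
      intro n
      have h1 := hvR (F n)
      have h2 := D.α_self (F n)
      rw [← hproj] at h2
      have hsub : u n - (v : H) ∈ closure (Set.range D.ξ) :=
        hKcl _ (K.sub_mem (hF n ▸ hξK (F n)) v.2)
      have h3 := hproj_le (F n) _ hsub
      rw [inner_sub_right, ← hF n, h2, hF n] at h3
      rw [hF n] at h1
      have h4 := abs_real_inner_le_norm (u n) (u n - v)
      rw [inner_sub_right, real_inner_self_eq_norm_sq] at h4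
      have h5 := mul_le_mul_of_nonneg_left (abs_le.1 h4).2 D.lam_pos.le
      have h6 := (abs_le.1 h3).2
      nlinarith
    have hl1 : Tendsto (fun n => D.lam * ‖u n‖ ^ 2) atTop (𝓝 (D.lam * ‖(v : H)‖ ^ 2)) :=
      (hlim.norm.pow 2).const_mul _
    have hl2 : Tendsto (fun n => (D.lam + |D.C|) * ‖u n‖ * ‖u n - v‖) atTop (𝓝 0) := by
      have h1 : Tendsto (fun n => ‖u n - v‖) atTop (𝓝 0) := by
        have := (hlim.sub_const (v : H)).norm
        simpa using this
      have := (hlim.norm.const_mul (D.lam + |D.C|)).mul h1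
      simpa using this
    have h0 := le_of_tendsto_of_tendsto' hl1 hl2 hbound
    have h1 : ‖(v : H)‖ ^ 2 ≤ 0 := by
      by_contra hcon
      push Not at hcon
      have := mul_pos D.lam_pos hcon
      linarith
    have h2 : ‖(v : H)‖ = 0 := by nlinarith [norm_nonneg (v : H)]
    exact Subtype.ext (norm_eq_zero.1 h2)
  have hmem : K.orthogonalProjectionOnto (D.lam • D.e + D.w) ∈ closure (R : Set K) := by
    have : K.orthogonalProjectionOnto (D.lam • D.e + D.w) ∈ R.topologicalClosure := by
      rw [hR]; trivial
    rwa [← SetLike.mem_coe, Submodule.topologicalClosure_coe] at this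
  obtain ⟨y, ⟨F, hF⟩, hy⟩ := Metric.mem_closure_iff.1 hmem ε hε
  refine ⟨F, fun g => ?_⟩
  rw [D.inner_rep_ξ, ← hF, ← hproj, ← inner_sub_left]
  refine (abs_real_inner_le_norm _ _).trans ?_
  gcongr
  rw [dist_eq_norm] at hy
  exact hy.le

/-- The `F n` solve the equation on the range of `ξ` up to `1/(n+1)`. Coercivity makes `ξ (F n)`
Cauchy, so the pairing with `e` converges and one real parameter suffices to make its limit zero. -/
lemma exists_isLimit [CompleteSpace H] : ∃ κ, D.IsLimit κ := by
  have hl := D.lam_pos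
  have hc := D.c_pos
  choose F hF using fun n : ℕ => D.exists_approx (ε := 1 / ((n : ℝ) + 1)) (by positivity)
  have hε : Tendsto (fun n : ℕ => 1 / ((n : ℝ) + 1)) atTop (𝓝 0) :=
    tendsto_one_div_add_atTop_nhds_zero_nat
  -- the sequence `ξ (F n)` is Cauchy
  have hdiff : ∀ m n, ‖D.ξ (F m) - D.ξ (F n)‖ ≤
      (1 / ((m : ℝ) + 1) + 1 / ((n : ℝ) + 1)) / D.lam := by
    intro m n
    have h1 := hF m (F m - F n)
    have h2 := hF n (F m - F n)
    rw [D.inner_rep_ξ] at h1 h2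
    have := D.coercive' (F := F m - F n) (ε := 1 / ((m : ℝ) + 1) + 1 / ((n : ℝ) + 1))
      (by positivity) ?_
    · rwa [map_sub] at this
    · set y := D.ξ (F m - F n) with hy
      have a1 : inner ℝ (D.α (F m - F n)) y = inner ℝ (D.α (F m)) y - inner ℝ (D.α (F n)) y :=
        D.α_sub _ _ _
      have a2 : inner ℝ y y = inner ℝ (D.ξ (F m)) y - inner ℝ (D.ξ (F n)) y := by
        conv_lhs => rw [hy, map_sub, ← map_sub, ← hy]
        rw [← inner_sub_left, ← map_sub]
      rw [a1, a2]
      rw [abs_le] at h1 h2 ⊢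
      constructor <;> linarith [h1.1, h1.2, h2.1, h2.2]
  have hcauchy : CauchySeq fun n => D.ξ (F n) := by
    refine Metric.cauchySeq_iff'.2 fun η hη => ?_
    have hev : ∀ᶠ n : ℕ in atTop, 1 / ((n : ℝ) + 1) < η * D.lam / 2 :=
      hε.eventually (gt_mem_nhds (by positivity))
    obtain ⟨N, hN⟩ := eventually_atTop.1 hev
    refine ⟨N, fun n hn => ?_⟩
    rw [dist_eq_norm]
    refine (hdiff n N).trans_lt ?_
    rw [div_lt_iff₀ hl]
    linarith [hN n hn, hN N le_rfl]
  obtain ⟨u, hu⟩ := cauchySeq_tendsto_of_complete hcauchy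
  -- The value for which the limit of `⟪rep κ (F n), e⟫` vanishes; the division is possible because
  -- `⟪d, e⟫ = -c` is nonzero.
  set κ := (D.lam * ‖D.e‖ ^ 2 - D.lam * inner ℝ u D.e + inner ℝ D.w u) / D.c with hκ
  have hs : Tendsto (fun n => inner ℝ (D.rep κ (F n)) D.e) atTop (𝓝 0) := by
    have h1 : Tendsto (fun n => D.lam * ‖D.e‖ ^ 2 - κ * D.c - D.lam * inner ℝ (D.ξ (F n)) D.e +
        inner ℝ D.w (D.ξ (F n))) atTop (𝓝 (D.lam * ‖D.e‖ ^ 2 - κ * D.c -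
          D.lam * inner ℝ u D.e + inner ℝ D.w u)) :=
      ((tendsto_const_nhds.sub ((hu.inner tendsto_const_nhds).const_mul _)).add
        (tendsto_const_nhds.inner hu))
    have h2 : D.lam * ‖D.e‖ ^ 2 - κ * D.c - D.lam * inner ℝ u D.e + inner ℝ D.w u = 0 := by
      rw [hκ]; field_simp; ring
    rw [h2] at h1
    simpa only [D.inner_rep_e] using h1
  -- By `c_le`, both `|b|` and `‖ξ g‖` are bounded by multiples of `‖ξ g + b e‖`, so smallness on
  -- the `ξ g` and on `e` separately gives smallness of the functional on their sum.
  set B := 1 + ‖D.d‖ / D.c * ‖D.e‖ with hB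
  set δ : ℕ → ℝ := fun n => 1 / ((n : ℝ) + 1) * B +
    |inner ℝ (D.rep κ (F n)) D.e| * (‖D.d‖ / D.c) with hδ
  have hδlim : Tendsto δ atTop (𝓝 0) := by
    have := (hε.mul_const B).add (hs.abs.mul_const (‖D.d‖ / D.c))
    rwa [abs_zero, zero_mul, zero_mul, add_zero] at this
  have hle : ∀ n g (b : ℝ), |inner ℝ (D.rep κ (F n)) (D.ξ g + b • D.e)| ≤
      δ n * ‖D.ξ g + b • D.e‖ := by
    intro n g b
    have h1 : inner ℝ (D.rep κ (F n)) (D.ξ g) = inner ℝ (D.rep 0 (F n)) (D.ξ g) := by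
      rw [D.inner_rep_ξ, D.inner_rep_ξ]
    have hb : |b| ≤ ‖D.d‖ / D.c * ‖D.ξ g + b • D.e‖ := by
      rw [div_mul_eq_mul_div, le_div_iff₀ hc, mul_comm]
      exact D.c_le g b
    have hg : ‖D.ξ g‖ ≤ B * ‖D.ξ g + b • D.e‖ := by
      have h2 : ‖D.ξ g‖ ≤ ‖D.ξ g + b • D.e‖ + |b| * ‖D.e‖ := by
        have h3 := norm_sub_le (D.ξ g + b • D.e) (b • D.e)
        rwa [add_sub_cancel_right, norm_smul, Real.norm_eq_abs] at h3
      have h4 := mul_le_mul_of_nonneg_right hb (norm_nonneg D.e)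
      rw [hB]
      nlinarith
    rw [inner_add_right, inner_smul_right, h1]
    refine (abs_add_le _ _).trans ?_
    rw [abs_mul]
    have h5 := (hF n g).trans (mul_le_mul_of_nonneg_left hg (by positivity))
    have h6 := mul_le_mul_of_nonneg_right hb (abs_nonneg (inner ℝ (D.rep κ (F n)) D.e))
    simp only [hδ]
    linarith
  refine ⟨κ, F, ?_⟩
  have hlim2 : Tendsto (fun n => ((δ n ^ 2 / D.lam : ℝ) : EReal)) atTop (𝓝 0) := by
    have : Tendsto (fun n => δ n ^ 2 / D.lam) atTop (𝓝 0) := by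
      simpa using (hδlim.pow 2).div_const D.lam
    exact_mod_cast (continuous_coe_real_ereal.tendsto 0).comp this
  exact tendsto_of_tendsto_of_tendsto_of_le_of_le tendsto_const_nhds hlim2
    (fun n => dualSq_nonneg _) (fun n => dualSq_le hl (hle n))

end FDData

end Abstract

end

noncomputable section

namespace EnergyChain

/-! ### The potential -/

section Potential

variable (M : EnergyChain)

lemma contDiff_deriv_V : ContDiff ℝ (⊤ : ℕ∞) (deriv M.V) :=
  (contDiff_infty_iff_deriv.1 M.V_smooth).2

lemma differentiable_V : Differentiable ℝ M.V := M.V_smooth.differentiable (by simp)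

lemma differentiable_deriv_V : Differentiable ℝ (deriv M.V) :=
  M.contDiff_deriv_V.differentiable (by simp)

lemma hasDerivAt_V (r : ℝ) : HasDerivAt M.V (deriv M.V r) r := (M.differentiable_V r).hasDerivAt

lemma hasDerivAt_deriv_V (r : ℝ) : HasDerivAt (deriv M.V) (deriv (deriv M.V) r) r :=
  (M.differentiable_deriv_V r).hasDerivAt

lemma δp_pos : 0 < M.δp := M.δm_pos.trans_le ((M.le_V'' 0).trans (M.V''_le 0))

lemma deriv_V_neg (r : ℝ) : deriv M.V (-r) = -deriv M.V r := by
  have h1 := (M.hasDerivAt_V (-r)).comp r (hasDerivAt_neg r)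
  have h2 : (M.V ∘ Neg.neg) = M.V := funext M.V_symm
  have h3 := (M.hasDerivAt_V r)
  have h4 : HasDerivAt M.V (deriv M.V (-r) * -1) r :=
    h1.congr_of_eventuallyEq (Eventually.of_forall fun x => (congrFun h2 x).symm)
  have := h4.unique h3
  linarith

@[simp] lemma deriv_V_zero : deriv M.V 0 = 0 := by
  have := M.deriv_V_neg 0
  rw [neg_zero] at this
  linarith

lemma le_deriv_V {r : ℝ} (hr : 0 ≤ r) : M.δm * r ≤ deriv M.V r := by
  have hm : Monotone fun x => deriv M.V x - M.δm * x := by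
    refine monotone_of_hasDerivAt_nonneg (f' := fun x => deriv (deriv M.V) x - M.δm) (fun x => ?_)
      fun x => sub_nonneg.2 (M.le_V'' x)
    have := (M.hasDerivAt_deriv_V x).sub ((hasDerivAt_id x).const_mul M.δm)
    rwa [mul_one] at this
  have := hm hr
  simp at this
  exact this

lemma deriv_V_le {r : ℝ} (hr : 0 ≤ r) : deriv M.V r ≤ M.δp * r := by
  have hm : Monotone fun x => M.δp * x - deriv M.V x := by
    refine monotone_of_hasDerivAt_nonneg (f' := fun x => M.δp - deriv (deriv M.V) x) (fun x => ?_)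
      fun x => sub_nonneg.2 (M.V''_le x)
    have := ((hasDerivAt_id x).const_mul M.δp).sub (M.hasDerivAt_deriv_V x)
    rwa [mul_one] at this
  have := hm hr
  simp at this
  exact this

lemma abs_deriv_V_le (r : ℝ) : |deriv M.V r| ≤ M.δp * |r| := by
  rcases le_total 0 r with h | h
  · rw [abs_of_nonneg h, abs_of_nonneg ((mul_nonneg M.δm_pos.le h).trans (M.le_deriv_V h))]
    exact M.deriv_V_le h
  · have h' : 0 ≤ -r := neg_nonneg.2 h
    have h1 := M.le_deriv_V h'
    have h2 := M.deriv_V_le h'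
    rw [M.deriv_V_neg] at h1 h2
    have h3 : 0 ≤ M.δm * -r := mul_nonneg M.δm_pos.le h'
    rw [abs_of_nonpos h, abs_of_nonpos (by linarith)]
    exact h2

lemma le_V_sub {r : ℝ} (hr : 0 ≤ r) : M.δm * r ^ 2 ≤ 2 * (M.V r - M.V 0) := by
  have hm : MonotoneOn (fun x => 2 * M.V x - M.δm * x ^ 2) (Set.Ici 0) := by
    refine monotoneOn_of_deriv_nonneg (convex_Ici 0) ?_ ?_ ?_
    · have := M.differentiable_V.continuous
      fun_prop
    · have := M.differentiable_V
      fun_prop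
    · intro x hx
      rw [interior_Ici] at hx
      have h1 := ((M.hasDerivAt_V x).const_mul 2).sub ((hasDerivAt_pow 2 x).const_mul M.δm)
      have h2 := h1.deriv
      have h3 := M.le_deriv_V (le_of_lt hx)
      refine le_of_le_of_eq ?_ h2.symm
      simp
      linarith
  have := hm Set.self_mem_Ici hr hr
  simp at this
  linarith

lemma V_sub_le {r : ℝ} (hr : 0 ≤ r) : 2 * (M.V r - M.V 0) ≤ M.δp * r ^ 2 := by
  have hm : MonotoneOn (fun x => M.δp * x ^ 2 - 2 * M.V x) (Set.Ici 0) := by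
    refine monotoneOn_of_deriv_nonneg (convex_Ici 0) ?_ ?_ ?_
    · have := M.differentiable_V.continuous
      fun_prop
    · have := M.differentiable_V
      fun_prop
    · intro x hx
      rw [interior_Ici] at hx
      have h1 := ((hasDerivAt_pow 2 x).const_mul M.δp).sub ((M.hasDerivAt_V x).const_mul 2)
      have h2 := h1.deriv
      have h3 := M.deriv_V_le (le_of_lt hx)
      refine le_of_le_of_eq ?_ h2.symm
      simp
      linarith
  have := hm Set.self_mem_Ici hr hr
  simp at this
  linarith

/-- The coordinate `q` with `V = V 0 + q² / 2`. -/
def arc (r : ℝ) : ℝ := if 0 ≤ r then √(2 * (M.V r - M.V 0)) else -√(2 * (M.V r - M.V 0))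

lemma arc_neg (r : ℝ) : M.arc (-r) = -M.arc r := by
  unfold arc
  rw [M.V_symm]
  rcases lt_trichotomy r 0 with h | h | h
  · rw [if_pos (by linarith), if_neg (by linarith), neg_neg]
  · simp [h]
  · rw [if_neg (by linarith), if_pos (by linarith)]

lemma V_sub_nonneg (r : ℝ) : 0 ≤ 2 * (M.V r - M.V 0) := by
  rcases le_total 0 r with h | h
  · exact le_trans (mul_nonneg M.δm_pos.le (sq_nonneg _)) (M.le_V_sub h)
  · rw [← M.V_symm]
    exact le_trans (mul_nonneg M.δm_pos.le (sq_nonneg _)) (M.le_V_sub (neg_nonneg.2 h))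

lemma arc_sq (r : ℝ) : M.arc r ^ 2 = 2 * (M.V r - M.V 0) := by
  unfold arc
  split_ifs
  · exact Real.sq_sqrt (M.V_sub_nonneg r)
  · rw [neg_sq]; exact Real.sq_sqrt (M.V_sub_nonneg r)

lemma le_arc {r : ℝ} (hr : 0 ≤ r) : √M.δm * r ≤ M.arc r := by
  rw [arc, if_pos hr]
  refine Real.le_sqrt_of_sq_le ?_
  rw [mul_pow, Real.sq_sqrt M.δm_pos.le]
  exact M.le_V_sub hr

lemma arc_le {r : ℝ} (hr : 0 ≤ r) : M.arc r ≤ √M.δp * r := by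
  rw [arc, if_pos hr]
  refine Real.sqrt_le_iff.2 ⟨by positivity, ?_⟩
  rw [mul_pow, Real.sq_sqrt M.δp_pos.le]
  exact M.V_sub_le hr

/-- The derivative of `arc`. -/
def arcDeriv (r : ℝ) : ℝ := if r = 0 then √(deriv (deriv M.V) 0) else deriv M.V r / M.arc r

lemma arcDeriv_neg (r : ℝ) : M.arcDeriv (-r) = M.arcDeriv r := by
  simp [arcDeriv, arc_neg, deriv_V_neg, neg_div_neg_eq]

/-- Combine `V'(r) ≥ δm r` with `arc r ≤ √δp r`. The inverse of this bound is the constant `B` with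
`Q' ≤ B`, the quantitative input from the potential in the sector condition. -/
lemma le_arcDeriv (r : ℝ) : M.δm / √M.δp ≤ M.arcDeriv r := by
  have hp : ∀ x : ℝ, 0 < x → M.δm / √M.δp ≤ M.arcDeriv x := by
    intro x hx
    have ha : 0 < M.arc x :=
      lt_of_lt_of_le (mul_pos (Real.sqrt_pos.2 M.δm_pos) hx) (M.le_arc hx.le)
    rw [arcDeriv, if_neg hx.ne', div_le_div_iff₀ (Real.sqrt_pos.2 M.δp_pos) ha]
    have h1 := mul_le_mul_of_nonneg_left (M.arc_le hx.le) M.δm_pos.le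
    have h2 := mul_le_mul_of_nonneg_right (M.le_deriv_V hx.le) (Real.sqrt_nonneg M.δp)
    linarith
  rcases lt_trichotomy r 0 with h | h | h
  · rw [← M.arcDeriv_neg]; exact hp _ (by linarith)
  · rw [h, arcDeriv, if_pos rfl]
    have h1 : √M.δm ≤ √(deriv (deriv M.V) 0) := Real.sqrt_le_sqrt (M.le_V'' 0)
    refine le_trans ?_ h1
    rw [div_le_iff₀ (Real.sqrt_pos.2 M.δp_pos)]
    have h2 : √M.δm ≤ √M.δp := Real.sqrt_le_sqrt ((M.le_V'' 0).trans (M.V''_le 0))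
    calc M.δm = √M.δm * √M.δm := (Real.mul_self_sqrt M.δm_pos.le).symm
      _ ≤ √M.δm * √M.δp := by gcongr
  · exact hp r h

lemma hasDerivAt_arc (r : ℝ) : HasDerivAt M.arc (M.arcDeriv r) r := by
  have hp : ∀ x : ℝ, 0 < x → HasDerivAt M.arc (M.arcDeriv x) x := by
    intro x hx
    have ha : 0 < 2 * (M.V x - M.V 0) :=
      lt_of_lt_of_le (mul_pos M.δm_pos (by positivity)) (M.le_V_sub hx.le)
    have h1 : HasDerivAt (fun y => √(2 * (M.V y - M.V 0)))
        (2 * deriv M.V x / (2 * √(2 * (M.V x - M.V 0)))) x :=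
      (((M.hasDerivAt_V x).sub_const _).const_mul 2).sqrt ha.ne'
    have h2 : M.arcDeriv x = 2 * deriv M.V x / (2 * √(2 * (M.V x - M.V 0))) := by
      rw [arcDeriv, if_neg hx.ne', arc, if_pos hx.le, mul_div_mul_left _ _ two_ne_zero]
    rw [h2]
    refine h1.congr_of_eventuallyEq ?_
    filter_upwards [lt_mem_nhds hx] with y hy
    rw [arc, if_pos hy.le]
  rcases lt_trichotomy r 0 with h | h | h
  · have h1 := ((hp (-r) (by linarith)).comp r (hasDerivAt_neg r)).neg
    have h2 : -(M.arc ∘ fun y => -y) = M.arc := by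
      funext y; simp [arc_neg]
    rw [h2, arcDeriv_neg] at h1
    simpa using h1
  · subst h
    rw [hasDerivAt_iff_tendsto_slope]
    -- At the origin `V'/arc` has the form `0/0`. The slope of `arc` is the square root of this
    -- quotient, whose limit is given by l'Hôpital's rule.
    have hlim : Tendsto (fun x => (2 * (M.V x - M.V 0)) / x ^ 2) (𝓝[≠] 0)
        (𝓝 (deriv (deriv M.V) 0)) := by
      refine HasDerivAt.lhopital_zero_nhdsNE (f' := fun x => 2 * deriv M.V x)
        (g' := fun x => 2 * x) ?_ ?_ ?_ ?_ ?_ ?_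
      · exact Eventually.of_forall fun x => ((M.hasDerivAt_V x).sub_const _).const_mul 2
      · refine Eventually.of_forall fun x => ?_
        simpa using hasDerivAt_pow 2 x
      · filter_upwards [self_mem_nhdsWithin] with x hx
        simpa using hx
      · have : Continuous fun x => 2 * (M.V x - M.V 0) := by
          have := M.differentiable_V.continuous
          fun_prop
        simpa using (this.tendsto 0).mono_left (nhdsWithin_le_nhds (s := {0}ᶜ))
      · have : Continuous fun x : ℝ => x ^ 2 := by fun_prop
        simpa using (this.tendsto 0).mono_left (nhdsWithin_le_nhds (s := {0}ᶜ))
      · have h1 := hasDerivAt_iff_tendsto_slope.1 (M.hasDerivAt_deriv_V 0)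
        refine h1.congr' ?_
        filter_upwards with x
        rw [slope_def_field, deriv_V_zero, sub_zero, sub_zero, mul_div_mul_left _ _ two_ne_zero]
    have h2 := (Real.continuous_sqrt.tendsto _).comp hlim
    rw [arcDeriv, if_pos rfl]
    refine h2.congr' ?_
    filter_upwards [self_mem_nhdsWithin] with x hx
    have h0 : M.arc 0 = 0 := by simp [arc]
    rw [slope_def_field, h0, sub_zero, sub_zero, Function.comp_apply,
      Real.sqrt_div' _ (sq_nonneg x), Real.sqrt_sq_eq_abs, arc]
    rcases lt_or_gt_of_ne (show x ≠ 0 from hx) with h | h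
    · rw [if_neg (by linarith), abs_of_neg h, neg_div, div_neg]
    · rw [if_pos h.le, abs_of_pos h]
  · exact hp r h

/-- The inverse `Q` of `arc`: a change of variables turning the energy levels into circles. -/
lemma exists_straightening : ∃ (Q Q' : ℝ → ℝ) (B : ℝ), Function.Bijective Q ∧
    (∀ s, HasDerivAt Q (Q' s) s) ∧ (∀ s, 0 < Q' s) ∧ (∀ s, Q' s ≤ B) ∧
    (∀ s, M.V (Q s) = M.V 0 + s ^ 2 / 2) ∧ ∀ s, Q' s * deriv M.V (Q s) = s := by
  have hpos : ∀ r, 0 < M.arcDeriv r := fun r =>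
    lt_of_lt_of_le (div_pos M.δm_pos (Real.sqrt_pos.2 M.δp_pos)) (M.le_arcDeriv r)
  have hcont : Continuous M.arc :=
    continuous_iff_continuousAt.2 fun r => (M.hasDerivAt_arc r).continuousAt
  have hmono : StrictMono M.arc := strictMono_of_hasDerivAt_pos M.hasDerivAt_arc hpos
  have htop : Tendsto M.arc atTop atTop := by
    refine tendsto_atTop_mono' _ ?_ (tendsto_id.const_mul_atTop (Real.sqrt_pos.2 M.δm_pos))
    filter_upwards [eventually_ge_atTop 0] with r hr
    exact M.le_arc hr
  have hbot : Tendsto M.arc atBot atBot := by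
    have h1 := tendsto_neg_atTop_atBot.comp (htop.comp tendsto_neg_atBot_atTop)
    refine h1.congr fun r => ?_
    simp [arc_neg]
  have hsurj := hcont.surjective htop hbot
  let e := hmono.orderIsoOfSurjective _ hsurj
  have he : ∀ s, M.arc (e.symm s) = s := fun s => e.apply_symm_apply s
  have hQ : ∀ s, HasDerivAt e.symm (M.arcDeriv (e.symm s))⁻¹ s := fun s =>
    HasDerivAt.of_local_left_inverse e.symm.continuous.continuousAt
      (M.hasDerivAt_arc _) (hpos _).ne' (Eventually.of_forall he)
  have hV : ∀ s, M.V (e.symm s) = M.V 0 + s ^ 2 / 2 := by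
    intro s
    have := M.arc_sq (e.symm s)
    rw [he] at this
    linarith
  refine ⟨e.symm, fun s => (M.arcDeriv (e.symm s))⁻¹, (M.δm / √M.δp)⁻¹, e.symm.bijective, hQ,
    fun s => inv_pos.2 (hpos _), fun s => ?_, hV, fun s => ?_⟩
  · exact inv_anti₀ (div_pos M.δm_pos (Real.sqrt_pos.2 M.δp_pos)) (M.le_arcDeriv _)
  · have h1 := (M.hasDerivAt_V (e.symm s)).comp s (hQ s)
    have h2 : (M.V ∘ e.symm) = fun s => M.V 0 + s ^ 2 / 2 := funext hV
    rw [h2] at h1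
    have h3 : HasDerivAt (fun s : ℝ => M.V 0 + s ^ 2 / 2) s s := by
      have := ((hasDerivAt_pow 2 s).div_const 2).const_add (M.V 0)
      simpa using this
    have := h1.unique h3
    rw [mul_comm]
    exact this

end Potential

/-! ### Circles -/

/-- Closing up `G` makes `∫ b = 0`, so `F` may be replaced by `F - F(-ℓ)`, which is at most `∫ |a|`.
The product `(∫ |a|)(∫ |b|)` is then split by the arithmetic-geometric mean inequality and
Cauchy–Schwarz. -/
lemma abs_integral_circle_le {F G a b : ℝ → ℝ} {ℓ : ℝ} (hℓ : 0 < ℓ)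
    (hF : ∀ t, HasDerivAt F (a t) t) (hG : ∀ t, HasDerivAt G (b t) t)
    (hGp : G (-ℓ) = G ℓ)
    (ha : IntegrableOn (fun t => a t ^ 2) (Set.Ioo (-ℓ) ℓ))
    (hb : IntegrableOn (fun t => b t ^ 2) (Set.Ioo (-ℓ) ℓ)) :
    |∫ t in Set.Ioo (-ℓ) ℓ, F t * b t| ≤
      ℓ * ((∫ t in Set.Ioo (-ℓ) ℓ, a t ^ 2) + ∫ t in Set.Ioo (-ℓ) ℓ, b t ^ 2) := by
  have hle : -ℓ ≤ ℓ := by linarith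
  have ha_eq : a = deriv F := funext fun t => (hF t).deriv.symm
  have hb_eq : b = deriv G := funext fun t => (hG t).deriv.symm
  have ham : Measurable a := ha_eq ▸ measurable_deriv F
  have hbm : Measurable b := hb_eq ▸ measurable_deriv G
  -- Cauchy–Schwarz on an interval of length `2ℓ`, read off from the nonnegativity of the variance
  -- of `|f|`.
  have key : ∀ f : ℝ → ℝ, Measurable f → IntegrableOn (fun t => f t ^ 2) (Set.Ioo (-ℓ) ℓ) →
      IntegrableOn f (Set.Ioo (-ℓ) ℓ) ∧
      (∫ t in Set.Ioo (-ℓ) ℓ, |f t|) ^ 2 ≤ 2 * ℓ * ∫ t in Set.Ioo (-ℓ) ℓ, f t ^ 2 := by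
    intro f hf hf2
    have hm : MemLp f 2 (volume.restrict (Set.Ioo (-ℓ) ℓ)) :=
      (memLp_two_iff_integrable_sq hf.aestronglyMeasurable).2 hf2
    have hi : IntegrableOn f (Set.Ioo (-ℓ) ℓ) := hm.integrable (by norm_num)
    refine ⟨hi, ?_⟩
    set A := ∫ t in Set.Ioo (-ℓ) ℓ, |f t| with hA
    have h0 : 0 ≤ ∫ t in Set.Ioo (-ℓ) ℓ, (|f t| - A / (2 * ℓ)) ^ 2 :=
      integral_nonneg fun t => sq_nonneg _
    have h1 : ∀ t, (|f t| - A / (2 * ℓ)) ^ 2 =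
        f t ^ 2 - 2 * (A / (2 * ℓ)) * |f t| + (A / (2 * ℓ)) ^ 2 := by
      intro t; rw [sub_sq, sq_abs]; ring
    simp_rw [h1] at h0
    have hi' : IntegrableOn (fun t => 2 * (A / (2 * ℓ)) * |f t|) (Set.Ioo (-ℓ) ℓ) :=
      hi.abs.const_mul _
    have hsub : IntegrableOn (fun t => f t ^ 2 - 2 * (A / (2 * ℓ)) * |f t|) (Set.Ioo (-ℓ) ℓ) :=
      hf2.sub hi'
    rw [integral_add hsub (integrableOn_const (by simp)), integral_sub hf2 hi',
      integral_const_mul, ← hA, setIntegral_const, measureReal_def, Real.volume_Ioo,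
      ENNReal.toReal_ofReal (by linarith), smul_eq_mul] at h0
    have h2 : (∫ t in Set.Ioo (-ℓ) ℓ, f t ^ 2) - 2 * (A / (2 * ℓ)) * A +
        (ℓ - -ℓ) * (A / (2 * ℓ)) ^ 2 = (∫ t in Set.Ioo (-ℓ) ℓ, f t ^ 2) - A ^ 2 / (2 * ℓ) := by
      field_simp; ring
    rw [h2, sub_nonneg, div_le_iff₀ (by positivity)] at h0
    linarith
  obtain ⟨hai, ha2⟩ := key a ham ha
  obtain ⟨hbi, hb2⟩ := key b hbm hb
  have hFc : Continuous F := continuous_iff_continuousAt.2 fun t => (hF t).continuousAt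
  have hb0 : ∫ t in Set.Ioo (-ℓ) ℓ, b t = 0 := by
    rw [← integral_Ioc_eq_integral_Ioo, ← intervalIntegral.integral_of_le hle,
      intervalIntegral.integral_eq_sub_of_hasDerivAt (fun t _ => hG t), hGp, sub_self]
    rw [intervalIntegrable_iff_integrableOn_Ioo_of_le hle]
    exact hbi
  have hosc : ∀ t ∈ Set.Ioo (-ℓ) ℓ, |F t - F (-ℓ)| ≤ ∫ t in Set.Ioo (-ℓ) ℓ, |a t| := by
    intro t ht
    have hsub : Set.Ioo (-ℓ) t ⊆ Set.Ioo (-ℓ) ℓ := Set.Ioo_subset_Ioo_right ht.2.le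
    rw [← intervalIntegral.integral_eq_sub_of_hasDerivAt (fun t _ => hF t),
      intervalIntegral.integral_of_le ht.1.le, integral_Ioc_eq_integral_Ioo]
    · refine (abs_integral_le_integral_abs).trans ?_
      exact setIntegral_mono_set hai.abs (Eventually.of_forall fun t => abs_nonneg _)
        (LE.le.eventuallyLE hsub)
    · rw [intervalIntegrable_iff_integrableOn_Ioo_of_le ht.1.le]
      exact hai.mono_set hsub
  have hFb : IntegrableOn (fun t => F t * b t) (Set.Ioo (-ℓ) ℓ) := by
    have h1 : IntegrableOn b (Set.Icc (-ℓ) ℓ) := by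
      rwa [integrableOn_Icc_iff_integrableOn_Ioo]
    exact (h1.continuousOn_mul hFc.continuousOn isCompact_Icc).mono_set Set.Ioo_subset_Icc_self
  set A := ∫ t in Set.Ioo (-ℓ) ℓ, |a t| with hA
  set B := ∫ t in Set.Ioo (-ℓ) ℓ, |b t| with hB
  have h1 : ∫ t in Set.Ioo (-ℓ) ℓ, F t * b t = ∫ t in Set.Ioo (-ℓ) ℓ, (F t - F (-ℓ)) * b t := by
    simp_rw [sub_mul]
    rw [integral_sub hFb (hbi.const_mul _), integral_const_mul, hb0]
    ring
  have h2 : |∫ t in Set.Ioo (-ℓ) ℓ, F t * b t| ≤ A * B := by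
    rw [h1]
    refine (abs_integral_le_integral_abs).trans ?_
    rw [hB, ← integral_const_mul]
    refine setIntegral_mono_on ?_ (hbi.abs.const_mul _) measurableSet_Ioo fun t ht => ?_
    · have : IntegrableOn (fun t => (F t - F (-ℓ)) * b t) (Set.Ioo (-ℓ) ℓ) := by
        simp_rw [sub_mul]
        exact hFb.sub (hbi.const_mul _)
      exact this.abs
    · rw [abs_mul]
      exact mul_le_mul_of_nonneg_right (hosc t ht) (abs_nonneg _)
  nlinarith [sq_nonneg (A - B)]

lemma integral_circle_eq_zero {G b : ℝ → ℝ} {ℓ : ℝ} (hℓ : 0 < ℓ)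
    (hG : ∀ t, HasDerivAt G (b t) t) (hGp : G (-ℓ) = G ℓ)
    (hb : IntegrableOn b (Set.Ioo (-ℓ) ℓ)) : ∫ t in Set.Ioo (-ℓ) ℓ, b t = 0 := by
  have hle : -ℓ ≤ ℓ := by linarith
  rw [← integral_Ioc_eq_integral_Ioo, ← intervalIntegral.integral_of_le hle,
    intervalIntegral.integral_eq_sub_of_hasDerivAt (fun t _ => hG t), hGp, sub_self]
  rwa [intervalIntegrable_iff_integrableOn_Ioo_of_le hle]

end EnergyChain

end

/-! ### Polar coordinates on the energy levels of one pair `(p, r)`. -/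

noncomputable section

namespace EnergyChain

/-- The Hamiltonian vector field `p ∂_r - V'(r) ∂_p` on functions of one pair `(p, r)`. -/
def flowDeriv (M : EnergyChain) (f : ℝ × ℝ → ℝ) (x : ℝ × ℝ) : ℝ :=
  x.1 * deriv (fun t => f (x.1, t)) x.2 - deriv M.V x.2 * deriv (fun t => f (t, x.2)) x.1

/-- The map `(ρ, θ) ↦ (ρ cos θ, Q (ρ sin θ))`. -/
def straightPolar (Q : ℝ → ℝ) (y : ℝ × ℝ) : ℝ × ℝ :=
  (y.1 * Real.cos y.2, Q (y.1 * Real.sin y.2))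

/-- The radial part of the Gibbs measure in the coordinates `straightPolar`. -/
def radialMeasure (M : EnergyChain) : Measure ℝ :=
  (volume.restrict (Set.Ioi 0)).withDensity fun ρ => ENNReal.ofReal
    (ρ * (Real.exp (-M.β * (M.V 0 + ρ ^ 2 / 2)) / (√(2 * Real.pi * M.β⁻¹) * M.Z)))

/-- The Lebesgue measure on angles. -/
def angleMeasure : Measure ℝ := volume.restrict (Set.Ioo (-Real.pi) Real.pi)

instance (M : EnergyChain) : SFinite M.radialMeasure := by
  unfold radialMeasure; infer_instance

instance : IsFiniteMeasure angleMeasure := by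
  unfold angleMeasure; infer_instance

section Polar

variable (M : EnergyChain) {Q Q' : ℝ → ℝ}

lemma lintegral_comp_straight (hbij : Function.Bijective Q) (hQ : ∀ s, HasDerivAt Q (Q' s) s)
    (hpos : ∀ s, 0 < Q' s) (g : ℝ → ENNReal) :
    ∫⁻ r, g r = ∫⁻ s, ENNReal.ofReal (Q' s) * g (Q s) := by
  have h := lintegral_image_eq_lintegral_abs_deriv_mul (s := Set.univ) MeasurableSet.univ
    (fun s _ => (hQ s).hasDerivWithinAt) (hbij.1.injOn) g
  rw [Set.image_univ, hbij.2.range_eq, Measure.restrict_univ] at h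
  rw [h]
  simp_rw [fun s => abs_of_pos (hpos s)]

/-- Substituting `r = Q q` turns the energy into `V 0 + (p² + q²)/2`, so in polar coordinates the
Gibbs weight is purely radial and the angle enters the density only through the Jacobian `Q'`. -/
lemma siteMeasure_eq_map (hbij : Function.Bijective Q) (hQ : ∀ s, HasDerivAt Q (Q' s) s)
    (hpos : ∀ s, 0 < Q' s) (hV : ∀ s, M.V (Q s) = M.V 0 + s ^ 2 / 2) :
    M.siteMeasure = ((M.radialMeasure.prod angleMeasure).withDensity
      fun y => ENNReal.ofReal (Q' (y.1 * Real.sin y.2))).map (straightPolar Q) := by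
  have hQc : Continuous Q := continuous_iff_continuousAt.2 fun s => (hQ s).continuousAt
  have hQ'eq : Q' = deriv Q := funext fun s => (hQ s).deriv.symm
  have hQ'm : Measurable Q' := hQ'eq ▸ measurable_deriv Q
  have hVc : Continuous M.V := M.differentiable_V.continuous
  have hPc : Continuous (straightPolar Q) := by unfold straightPolar; fun_prop
  set N := √(2 * Real.pi * M.β⁻¹) * M.Z with hN
  set D : ℝ × ℝ → ENNReal := fun x =>
    ENNReal.ofReal (Real.exp (-M.β * (x.1 ^ 2 / 2 + M.V x.2)) / N) with hD
  have hDm : Measurable D := by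
    refine Measurable.ennreal_ofReal (Continuous.measurable ?_)
    fun_prop
  have hwm : Measurable fun y : ℝ × ℝ => ENNReal.ofReal (Q' (y.1 * Real.sin y.2)) :=
    (hQ'm.comp (by fun_prop)).ennreal_ofReal
  have hrm : Measurable fun ρ : ℝ => ENNReal.ofReal
      (ρ * (Real.exp (-M.β * (M.V 0 + ρ ^ 2 / 2)) / N)) := by
    refine Measurable.ennreal_ofReal (Continuous.measurable ?_)
    fun_prop
  refine Measure.ext_of_lintegral _ fun f hf => ?_
  rw [lintegral_map hf hPc.measurable]
  change _ = ∫⁻ y, (f ∘ straightPolar Q) y ∂_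
  rw [lintegral_withDensity_eq_lintegral_mul _ hwm
    (hf.comp hPc.measurable), lintegral_prod _ (by
      exact (hwm.mul (hf.comp hPc.measurable)).aemeasurable)]
  have hinner : Measurable fun ρ : ℝ => ∫⁻ θ, ((fun y : ℝ × ℝ =>
      ENNReal.ofReal (Q' (y.1 * Real.sin y.2))) * (f ∘ straightPolar Q)) (ρ, θ) ∂angleMeasure :=
    (hwm.mul (hf.comp hPc.measurable)).lintegral_prod_right'
  rw [radialMeasure, lintegral_withDensity_eq_lintegral_mul _ hrm hinner]
  rw [siteMeasure, lintegral_withDensity_eq_lintegral_mul _ hDm hf, Measure.volume_eq_prod,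
    lintegral_prod _ (hDm.mul hf).aemeasurable]
  have h1 : ∀ p : ℝ, ∫⁻ r, (D * f) (p, r) =
      ∫⁻ s, ENNReal.ofReal (Q' s) * (D * f) (p, Q s) := fun p =>
    lintegral_comp_straight hbij hQ hpos fun r => (D * f) (p, r)
  simp_rw [h1]
  have hm2 : Measurable fun x : ℝ × ℝ => ENNReal.ofReal (Q' x.2) * (D * f) (x.1, Q x.2) :=
    ((hQ'm.comp measurable_snd).ennreal_ofReal).mul ((hDm.mul hf).comp (by fun_prop))
  rw [← lintegral_prod (fun x : ℝ × ℝ => ENNReal.ofReal (Q' x.2) * (D * f) (x.1, Q x.2))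
    hm2.aemeasurable, ← Measure.volume_eq_prod, ← lintegral_comp_polarCoord_symm]
  have ht : polarCoord.target = Set.Ioi (0 : ℝ) ×ˢ Set.Ioo (-Real.pi) Real.pi := rfl
  rw [ht, Measure.volume_eq_prod, ← Measure.prod_restrict, lintegral_prod]
  · refine setLIntegral_congr_fun measurableSet_Ioi fun ρ hρ => ?_
    rw [Pi.mul_apply, ← lintegral_const_mul _ (by
      exact (hwm.mul (hf.comp hPc.measurable)).comp measurable_prodMk_left)]
    refine lintegral_congr fun θ => ?_
    have hρ0 : (0 : ℝ) ≤ ρ := le_of_lt hρ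
    simp only [polarCoord_symm_apply, Pi.mul_apply, Function.comp_apply, straightPolar, hD,
      smul_eq_mul]
    rw [hV, ENNReal.ofReal_mul hρ0]
    have : (ρ * Real.cos θ) ^ 2 / 2 + (M.V 0 + (ρ * Real.sin θ) ^ 2 / 2) =
        M.V 0 + ρ ^ 2 / 2 := by
      have := Real.sin_sq_add_cos_sq θ
      linear_combination (ρ ^ 2 / 2) * this
    rw [this]
    ring
  · refine Measurable.aemeasurable ?_
    have : Measurable fun x : ℝ × ℝ => polarCoord.symm x := continuous_polarCoord_symm.measurable
    exact (measurable_fst.ennreal_ofReal).mul (hm2.comp this)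

lemma integrable_siteMeasure_iff (hbij : Function.Bijective Q)
    (hQ : ∀ s, HasDerivAt Q (Q' s) s) (hpos : ∀ s, 0 < Q' s)
    (hV : ∀ s, M.V (Q s) = M.V 0 + s ^ 2 / 2) {h : ℝ × ℝ → ℝ} (hm : Measurable h) :
    Integrable h M.siteMeasure ↔ Integrable (fun y : ℝ × ℝ =>
      Q' (y.1 * Real.sin y.2) * h (straightPolar Q y)) (M.radialMeasure.prod angleMeasure) := by
  have hQc : Continuous Q := continuous_iff_continuousAt.2 fun s => (hQ s).continuousAt
  have hQ'eq : Q' = deriv Q := funext fun s => (hQ s).deriv.symm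
  have hQ'm : Measurable Q' := hQ'eq ▸ measurable_deriv Q
  have hPc : Continuous (straightPolar Q) := by unfold straightPolar; fun_prop
  have hwm : Measurable fun y : ℝ × ℝ => ENNReal.ofReal (Q' (y.1 * Real.sin y.2)) :=
    (hQ'm.comp (by fun_prop)).ennreal_ofReal
  rw [M.siteMeasure_eq_map hbij hQ hpos hV, integrable_map_measure hm.aestronglyMeasurable
    hPc.aemeasurable, integrable_withDensity_iff_integrable_smul' hwm
    (Eventually.of_forall fun _ => ENNReal.ofReal_lt_top)]
  refine integrable_congr (Eventually.of_forall fun y => ?_)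
  simp [ENNReal.toReal_ofReal (hpos _).le]

lemma integral_siteMeasure_eq (hbij : Function.Bijective Q)
    (hQ : ∀ s, HasDerivAt Q (Q' s) s) (hpos : ∀ s, 0 < Q' s)
    (hV : ∀ s, M.V (Q s) = M.V 0 + s ^ 2 / 2) {h : ℝ × ℝ → ℝ} (hm : Measurable h) :
    ∫ x, h x ∂M.siteMeasure = ∫ y : ℝ × ℝ,
      Q' (y.1 * Real.sin y.2) * h (straightPolar Q y) ∂(M.radialMeasure.prod angleMeasure) := by
  have hQc : Continuous Q := continuous_iff_continuousAt.2 fun s => (hQ s).continuousAt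
  have hQ'eq : Q' = deriv Q := funext fun s => (hQ s).deriv.symm
  have hQ'm : Measurable Q' := hQ'eq ▸ measurable_deriv Q
  have hPc : Continuous (straightPolar Q) := by unfold straightPolar; fun_prop
  have hwm : Measurable fun y : ℝ × ℝ => ENNReal.ofReal (Q' (y.1 * Real.sin y.2)) :=
    (hQ'm.comp (by fun_prop)).ennreal_ofReal
  rw [M.siteMeasure_eq_map hbij hQ hpos hV, integral_map hPc.aemeasurable
    hm.aestronglyMeasurable, integral_withDensity_eq_integral_toReal_smul hwm
    (Eventually.of_forall fun _ => ENNReal.ofReal_lt_top)]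
  refine integral_congr_ae (Eventually.of_forall fun y => ?_)
  simp [ENNReal.toReal_ofReal (hpos _).le]

lemma flowDeriv_eq {f : ℝ × ℝ → ℝ} (hf : ContDiff ℝ 1 f) (x : ℝ × ℝ) :
    M.flowDeriv f x = x.1 * fderiv ℝ f x (0, 1) - deriv M.V x.2 * fderiv ℝ f x (1, 0) := by
  have hd : HasFDerivAt f (fderiv ℝ f x) x := (hf.differentiable one_ne_zero x).hasFDerivAt
  have h1 : HasDerivAt (fun t => f (x.1, t)) (fderiv ℝ f x (0, 1)) x.2 :=
    HasFDerivAt.comp_hasDerivAt (x := x.2) (f := fun t => (x.1, t)) hd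
      ((hasDerivAt_const x.2 x.1).prodMk (hasDerivAt_id x.2))
  have h2 : HasDerivAt (fun t => f (t, x.2)) (fderiv ℝ f x (1, 0)) x.1 :=
    HasFDerivAt.comp_hasDerivAt (x := x.1) (f := fun t => (t, x.2)) hd
      ((hasDerivAt_id x.1).prodMk (hasDerivAt_const x.1 x.2))
  rw [flowDeriv, h1.deriv, h2.deriv]

lemma continuous_flowDeriv {f : ℝ × ℝ → ℝ} (hf : ContDiff ℝ 1 f) :
    Continuous (M.flowDeriv f) := by
  have h1 : Continuous fun x => fderiv ℝ f x := hf.continuous_fderiv one_ne_zero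
  have h2 := M.differentiable_deriv_V.continuous
  rw [funext (M.flowDeriv_eq hf)]
  fun_prop

/-- Along circles, `∂_θ` is `Q'` times the Hamiltonian vector field. -/
lemma hasDerivAt_straightPolar (hQ : ∀ s, HasDerivAt Q (Q' s) s)
    (hQV : ∀ s, Q' s * deriv M.V (Q s) = s) {f : ℝ × ℝ → ℝ} (hf : ContDiff ℝ 1 f) (ρ θ : ℝ) :
    HasDerivAt (fun θ => f (straightPolar Q (ρ, θ)))
      (Q' (ρ * Real.sin θ) * M.flowDeriv f (straightPolar Q (ρ, θ))) θ := by
  set x := straightPolar Q (ρ, θ) with hx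
  have hd : HasFDerivAt f (fderiv ℝ f x) x := (hf.differentiable one_ne_zero x).hasFDerivAt
  have h1 : HasDerivAt (fun θ => straightPolar Q (ρ, θ))
      (ρ * -Real.sin θ, Q' (ρ * Real.sin θ) * (ρ * Real.cos θ)) θ := by
    refine HasDerivAt.prodMk ((Real.hasDerivAt_cos θ).const_mul ρ) ?_
    exact (hQ (ρ * Real.sin θ)).comp θ ((Real.hasDerivAt_sin θ).const_mul ρ)
  have h2 := HasFDerivAt.comp_hasDerivAt (x := θ) (f := fun θ => straightPolar Q (ρ, θ)) hd h1
  have h3 : ((ρ * -Real.sin θ, Q' (ρ * Real.sin θ) * (ρ * Real.cos θ)) : ℝ × ℝ) =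
      (ρ * -Real.sin θ) • (1, 0) + (Q' (ρ * Real.sin θ) * (ρ * Real.cos θ)) • (0, 1) := by
    simp
  rw [h3, map_add, map_smul, map_smul, smul_eq_mul, smul_eq_mul] at h2
  refine h2.congr_deriv ?_
  rw [M.flowDeriv_eq hf]
  have h4 : x.1 = ρ * Real.cos θ := rfl
  have h5 : x.2 = Q (ρ * Real.sin θ) := rfl
  have h6 := hQV (ρ * Real.sin θ)
  rw [h4, h5]
  linear_combination (fderiv ℝ f x (1, 0)) * h6

lemma straightPolar_pi (ρ : ℝ) : straightPolar Q (ρ, -Real.pi) = straightPolar Q (ρ, Real.pi) := by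
  simp [straightPolar]

end Polar

variable (M : EnergyChain)

/-- The Hamiltonian vector field preserves the Gibbs measure. -/
lemma integral_flowDeriv {f : ℝ × ℝ → ℝ} (hf : ContDiff ℝ 1 f)
    (hi : Integrable (M.flowDeriv f) M.siteMeasure) : ∫ x, M.flowDeriv f x ∂M.siteMeasure = 0 := by
  obtain ⟨Q, Q', B, hbij, hQ, hpos, hB, hV, hQV⟩ := M.exists_straightening
  have hm := (M.continuous_flowDeriv hf).measurable
  rw [M.integrable_siteMeasure_iff hbij hQ hpos hV hm] at hi
  rw [M.integral_siteMeasure_eq hbij hQ hpos hV hm, integral_prod _ hi]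
  refine integral_eq_zero_of_ae ?_
  filter_upwards [hi.prod_right_ae] with ρ hρ
  -- The density `Q'` times the vector field is exactly the angular derivative, whose integral over
  -- a full circle vanishes.
  exact integral_circle_eq_zero Real.pi_pos (M.hasDerivAt_straightPolar hQ hQV hf ρ)
    (by rw [straightPolar_pi]) hρ

/-- The Poincaré inequality on the energy levels, in the form of a sector condition. -/
lemma exists_sector_site : ∃ C : ℝ, 0 ≤ C ∧ ∀ f g : ℝ × ℝ → ℝ, ContDiff ℝ 1 f → ContDiff ℝ 1 g →
    Integrable (fun x => f x * M.flowDeriv g x) M.siteMeasure →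
    Integrable (fun x => M.flowDeriv f x ^ 2) M.siteMeasure →
    Integrable (fun x => M.flowDeriv g x ^ 2) M.siteMeasure →
    |∫ x, f x * M.flowDeriv g x ∂M.siteMeasure| ≤
      C * ((∫ x, M.flowDeriv f x ^ 2 ∂M.siteMeasure) +
        ∫ x, M.flowDeriv g x ^ 2 ∂M.siteMeasure) := by
  obtain ⟨Q, Q', B, hbij, hQ, hpos, hB, hV, hQV⟩ := M.exists_straightening
  have hQ'eq : Q' = deriv Q := funext fun s => (hQ s).deriv.symm
  have hQ'm : Measurable Q' := hQ'eq ▸ measurable_deriv Q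
  have hQc : Continuous Q := continuous_iff_continuousAt.2 fun s => (hQ s).continuousAt
  have hPc : Continuous (straightPolar Q) := by unfold straightPolar; fun_prop
  have hB0 : 0 ≤ B := (hpos 0).le.trans (hB 0)
  refine ⟨Real.pi * B, by positivity, fun f g hf hg hfg hf2 hg2 => ?_⟩
  have hmf := (M.continuous_flowDeriv hf).measurable
  have hmg := (M.continuous_flowDeriv hg).measurable
  have hm0 : Measurable fun x => f x * M.flowDeriv g x := hf.continuous.measurable.mul hmg
  rw [M.integrable_siteMeasure_iff hbij hQ hpos hV hm0] at hfg
  rw [M.integrable_siteMeasure_iff hbij hQ hpos hV (hmf.pow_const 2)] at hf2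
  rw [M.integrable_siteMeasure_iff hbij hQ hpos hV (hmg.pow_const 2)] at hg2
  rw [M.integral_siteMeasure_eq hbij hQ hpos hV hm0,
    M.integral_siteMeasure_eq hbij hQ hpos hV (hmf.pow_const 2),
    M.integral_siteMeasure_eq hbij hQ hpos hV (hmg.pow_const 2),
    integral_prod _ hfg, integral_prod _ hf2, integral_prod _ hg2]
  -- square integrability of the angular derivative
  have key : ∀ k : ℝ × ℝ → ℝ, Measurable (M.flowDeriv k) → ∀ ρ,
      Integrable (fun θ => Q' (ρ * Real.sin θ) *
        M.flowDeriv k (straightPolar Q (ρ, θ)) ^ 2) angleMeasure →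
      IntegrableOn (fun θ => (Q' (ρ * Real.sin θ) *
        M.flowDeriv k (straightPolar Q (ρ, θ))) ^ 2) (Set.Ioo (-Real.pi) Real.pi) ∧
      ∫ θ in Set.Ioo (-Real.pi) Real.pi, (Q' (ρ * Real.sin θ) *
        M.flowDeriv k (straightPolar Q (ρ, θ))) ^ 2 ≤
      B * ∫ θ, Q' (ρ * Real.sin θ) *
        M.flowDeriv k (straightPolar Q (ρ, θ)) ^ 2 ∂angleMeasure := by
    intro k hk ρ hi
    -- The squared angular derivative carries `Q'²`: one factor is the density of the measure, the
    -- other is bounded by `B`.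
    have hle : ∀ θ, (Q' (ρ * Real.sin θ) * M.flowDeriv k (straightPolar Q (ρ, θ))) ^ 2 ≤
        B * (Q' (ρ * Real.sin θ) * M.flowDeriv k (straightPolar Q (ρ, θ)) ^ 2) := by
      intro θ
      have h1 : 0 ≤ Q' (ρ * Real.sin θ) * M.flowDeriv k (straightPolar Q (ρ, θ)) ^ 2 :=
        mul_nonneg (hpos _).le (sq_nonneg _)
      have := mul_le_mul_of_nonneg_right (hB (ρ * Real.sin θ)) h1
      nlinarith
    have hint : IntegrableOn (fun θ => (Q' (ρ * Real.sin θ) *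
        M.flowDeriv k (straightPolar Q (ρ, θ))) ^ 2) (Set.Ioo (-Real.pi) Real.pi) := by
      refine Integrable.mono' (hi.const_mul B) ?_ (Eventually.of_forall fun θ => ?_)
      · refine Measurable.aestronglyMeasurable (Measurable.pow_const (Measurable.mul
          (hQ'm.comp (by fun_prop)) (hk.comp (hPc.measurable.comp measurable_prodMk_left))) 2)
      · rw [Real.norm_eq_abs, abs_of_nonneg (sq_nonneg _)]
        exact hle θ
    refine ⟨hint, ?_⟩
    rw [← integral_const_mul]
    exact integral_mono hint (hi.const_mul B) hle
  rw [← integral_add hf2.integral_prod_left hg2.integral_prod_left, ← integral_const_mul]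
  refine abs_integral_le_integral_abs.trans ?_
  refine integral_mono_ae hfg.integral_prod_left.abs
    ((hf2.integral_prod_left.add hg2.integral_prod_left).const_mul _) ?_
  filter_upwards [hf2.prod_right_ae, hg2.prod_right_ae] with ρ h1 h2
  obtain ⟨k1, k2⟩ := key f hmf ρ h1
  obtain ⟨k3, k4⟩ := key g hmg ρ h2
  -- On each circle, take `F` and `G` to be `f` and `g` as functions of the angle; the left side
  -- needs just one factor `Q'`, so it matches the measure exactly.
  have h3 := abs_integral_circle_le Real.pi_pos (M.hasDerivAt_straightPolar hQ hQV hf ρ)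
    (M.hasDerivAt_straightPolar hQ hQV hg ρ) (by rw [straightPolar_pi]) k1 k3
  have h4 : ∫ θ in Set.Ioo (-Real.pi) Real.pi, f (straightPolar Q (ρ, θ)) *
      (Q' (ρ * Real.sin θ) * M.flowDeriv g (straightPolar Q (ρ, θ))) =
      ∫ θ, Q' (ρ * Real.sin θ) * (f (straightPolar Q (ρ, θ)) *
        M.flowDeriv g (straightPolar Q (ρ, θ))) ∂angleMeasure := by
    refine integral_congr_ae (Eventually.of_forall fun θ => ?_)
    simp only
    ring
  rw [h4] at h3
  refine h3.trans ?_
  have := mul_le_mul_of_nonneg_left (add_le_add k2 k4) Real.pi_pos.le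
  refine this.trans (le_of_eq ?_)
  ring

end EnergyChain

end

noncomputable section

namespace EnergyChain

/-! ### Structure of the Gibbs measure -/

instance (M : EnergyChain) : IsProbabilityMeasure M.gibbs := by
  unfold gibbs; infer_instance

section Measure

variable (M : EnergyChain)

/-- The law of `r` at one site. -/
def posMeasure : Measure ℝ :=
  volume.withDensity fun r => ENNReal.ofReal (Real.exp (-M.β * M.V r) / M.Z)

/-- The law of `p` at one site. -/
def momMeasure : Measure ℝ := ProbabilityTheory.gaussianReal 0 M.β⁻¹.toNNReal

instance : IsProbabilityMeasure M.momMeasure := by unfold momMeasure; infer_instance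

instance : SFinite M.posMeasure := by unfold posMeasure; infer_instance

/-- Independence of `p` and `r` at one site makes `(p_i, r_j)` have the one-site law even for `i ≠
j`, so `Y_{i,i+1}` can be treated exactly like `X_i`. -/
lemma siteMeasure_eq_prod : M.siteMeasure = M.momMeasure.prod M.posMeasure := by
  have hβ := M.β_pos
  have hv : M.β⁻¹.toNNReal ≠ 0 := (Real.toNNReal_pos.2 (inv_pos.2 hβ)).ne'
  have hVc : Continuous M.V := M.differentiable_V.continuous
  rw [momMeasure, ProbabilityTheory.gaussianReal_of_var_ne_zero _ hv, posMeasure,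
    prod_withDensity (ProbabilityTheory.measurable_gaussianPDF _ _)
      (Measurable.ennreal_ofReal (Continuous.measurable (by fun_prop))),
    ← Measure.volume_eq_prod, siteMeasure]
  congr 1
  funext x
  rw [ProbabilityTheory.gaussianPDF, ← ENNReal.ofReal_mul
    (ProbabilityTheory.gaussianPDFReal_nonneg _ _ _), ProbabilityTheory.gaussianPDFReal]
  congr 1
  have h1 : Real.exp (-M.β * (x.1 ^ 2 / 2 + M.V x.2)) =
      Real.exp (-(x.1 - 0) ^ 2 / (2 * M.β⁻¹)) * Real.exp (-M.β * M.V x.2) := by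
    rw [← Real.exp_add]
    congr 1
    field_simp
    ring
  rw [h1]
  have hs : √(2 * Real.pi * M.β⁻¹) ≠ 0 := (Real.sqrt_pos.2 (by positivity)).ne'
  have hZ := M.Z_pos.ne'
  rw [Real.coe_toNNReal _ (inv_pos.2 hβ).le]
  field_simp

instance : IsProbabilityMeasure M.posMeasure := by
  have h : (M.siteMeasure).map Prod.snd = M.posMeasure := by
    rw [siteMeasure_eq_prod, Measure.map_snd_prod, measure_univ, one_smul]
  rw [← h]
  exact Measure.isProbabilityMeasure_map measurable_snd.aemeasurable

/-- Replacing `p_i` and `r_j` in the configuration `ω`. -/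
def resample (i j : ℤ) (ω : Config) (x : ℝ × ℝ) : Config := fun k =>
  (if k = i then x.1 else (ω k).1, if k = j then x.2 else (ω k).2)

lemma measurePreserving_update (i : ℤ) :
    MeasurePreserving (fun y : Config × (ℝ × ℝ) => Function.update y.1 i y.2)
      (M.gibbs.prod M.siteMeasure) M.gibbs := by
  have hm : Measurable fun y : Config × (ℝ × ℝ) => Function.update y.1 i y.2 := by
    refine measurable_pi_lambda _ fun k => ?_
    by_cases hk : k = i
    · subst hk; simpa using measurable_snd
    · simp only [Function.update_of_ne hk]; fun_prop
  refine ⟨hm, ?_⟩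
  refine Measure.eq_infinitePi _ fun s t ht => ?_
  rw [Measure.map_apply hm (.pi s.countable_toSet fun _ _ => ht _)]
  have : (fun y : Config × (ℝ × ℝ) => Function.update y.1 i y.2) ⁻¹' ((s : Set ℤ).pi t) =
      (((s.erase i : Finset ℤ) : Set ℤ).pi t) ×ˢ (if i ∈ s then t i else Set.univ) := by
    ext y
    simp only [Set.mem_preimage, Set.mem_pi, Finset.mem_coe, Set.mem_prod, Finset.mem_erase]
    constructor
    · intro h
      refine ⟨fun k hk => ?_, ?_⟩
      · have := h k hk.2
        rwa [Function.update_of_ne hk.1] at this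
      · split_ifs with hi
        · simpa using h i hi
        · trivial
    · rintro ⟨h1, h2⟩ k hk
      by_cases hki : k = i
      · subst hki
        rw [if_pos hk] at h2
        simpa using h2
      · rw [Function.update_of_ne hki]
        exact h1 k ⟨hki, hk⟩
  rw [this, Measure.prod_prod, gibbs, Measure.infinitePi_pi _ fun k _ => ht k]
  split_ifs with hi
  · rw [mul_comm, Finset.mul_prod_erase s (fun k => M.siteMeasure (t k)) hi]
  · rw [measure_univ, mul_one, Finset.erase_eq_of_notMem hi]

lemma measurePreserving_swap_mom :
    MeasurePreserving (fun y : (Config × (ℝ × ℝ)) × ℝ => (y.1.1, (y.2, y.1.2.2)))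
      ((M.gibbs.prod M.siteMeasure).prod M.momMeasure) (M.gibbs.prod M.siteMeasure) := by
  have h1 : MeasurePreserving (fun y : (ℝ × ℝ) × ℝ => (y.2, y.1.2))
      (M.siteMeasure.prod M.momMeasure) M.siteMeasure := by
    rw [siteMeasure_eq_prod]
    have h2 : MeasurePreserving (Prod.map (Prod.snd : ℝ × ℝ → ℝ) (id : ℝ → ℝ))
        ((M.momMeasure.prod M.posMeasure).prod M.momMeasure) (M.posMeasure.prod M.momMeasure) :=
      measurePreserving_snd.prod (MeasurePreserving.id _)
    exact Measure.measurePreserving_swap.comp h2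
  have h3 := ((MeasurePreserving.id M.gibbs).prod h1).comp
    (measurePreserving_prodAssoc M.gibbs M.siteMeasure M.momMeasure)
  exact h3

lemma measurePreserving_swap_pos :
    MeasurePreserving (fun y : (Config × (ℝ × ℝ)) × ℝ => (y.1.1, (y.1.2.1, y.2)))
      ((M.gibbs.prod M.siteMeasure).prod M.posMeasure) (M.gibbs.prod M.siteMeasure) := by
  have h1 : MeasurePreserving (fun y : (ℝ × ℝ) × ℝ => (y.1.1, y.2))
      (M.siteMeasure.prod M.posMeasure) M.siteMeasure := by
    rw [siteMeasure_eq_prod]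
    exact measurePreserving_fst.prod (MeasurePreserving.id _)
  have h3 := ((MeasurePreserving.id M.gibbs).prod h1).comp
    (measurePreserving_prodAssoc M.gibbs M.siteMeasure M.posMeasure)
  exact h3

/-- If `g` is measure preserving, so is any map `f` with `f ∘ g` measure preserving. -/
lemma _root_.MeasureTheory.MeasurePreserving.of_comp_eq {α β γ : Type*} [MeasurableSpace α]
    [MeasurableSpace β] [MeasurableSpace γ] {μa : Measure α} {μb : Measure β} {μc : Measure γ}
    {g : α → β} {f : β → γ} {h : α → γ} (hg : MeasurePreserving g μa μb) (hf : Measurable f)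
    (hh : MeasurePreserving h μa μc) (hfg : f ∘ g = h) : MeasurePreserving f μb μc := by
  refine ⟨hf, ?_⟩
  rw [← hg.map_eq, Measure.map_map hf hg.measurable, hfg, hh.map_eq]

/-- Write a Gibbs configuration as one whose site `i` has been replaced by a fresh sample.
Overwriting the momentum of that sample by another fresh momentum does not change its law. -/
lemma measurePreserving_update_mom (i : ℤ) :
    MeasurePreserving (fun y : Config × ℝ => Function.update y.1 i (y.2, (y.1 i).2))
      (M.gibbs.prod M.momMeasure) M.gibbs := by
  refine MeasurePreserving.of_comp_eq
    ((M.measurePreserving_update i).prod (MeasurePreserving.id M.momMeasure)) ?_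
    ((M.measurePreserving_update i).comp M.measurePreserving_swap_mom) ?_
  · refine measurable_pi_lambda _ fun k => ?_
    by_cases hk : k = i
    · subst hk; simp only [Function.update_self]; fun_prop
    · simp only [Function.update_of_ne hk]; fun_prop
  · funext y
    simp [Function.update_idem]

lemma measurePreserving_update_pos (i : ℤ) :
    MeasurePreserving (fun y : Config × ℝ => Function.update y.1 i ((y.1 i).1, y.2))
      (M.gibbs.prod M.posMeasure) M.gibbs := by
  refine MeasurePreserving.of_comp_eq
    ((M.measurePreserving_update i).prod (MeasurePreserving.id M.posMeasure)) ?_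
    ((M.measurePreserving_update i).comp M.measurePreserving_swap_pos) ?_
  · refine measurable_pi_lambda _ fun k => ?_
    by_cases hk : k = i
    · subst hk; simp only [Function.update_self]; fun_prop
    · simp only [Function.update_of_ne hk]; fun_prop
  · funext y
    simp [Function.update_idem]

/-- Resampling `p_i` and `r_j` preserves the Gibbs measure. -/
lemma measurePreserving_resample (i j : ℤ) :
    MeasurePreserving (fun y : Config × (ℝ × ℝ) => resample i j y.1 y.2)
      (M.gibbs.prod M.siteMeasure) M.gibbs := by
  have h1 := (M.measurePreserving_update_pos j).comp
    ((M.measurePreserving_update_mom i).prod (MeasurePreserving.id M.posMeasure))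
  rw [siteMeasure_eq_prod]
  have h2 := h1.comp ((measurePreserving_prodAssoc M.gibbs M.momMeasure M.posMeasure).symm)
  convert h2 using 1
  funext y
  funext k
  simp only [resample, Function.comp_apply, MeasurableEquiv.prodAssoc, Prod.map, id,
    Function.update_apply]
  by_cases hi : k = i <;> by_cases hj : k = j <;> simp [hi, hj]
  all_goals try (subst hi; simp_all)
  all_goals try (subst hj; simp_all)

/-- The shift preserves the Gibbs measure. -/
lemma measurePreserving_shift (j : ℤ) :
    MeasurePreserving (fun (ω : Config) (i : ℤ) => ω (i + j)) M.gibbs M.gibbs := by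
  refine ⟨by fun_prop, ?_⟩
  refine Measure.eq_infinitePi _ fun s t ht => ?_
  rw [Measure.map_apply (by fun_prop) (.pi s.countable_toSet fun _ _ => ht _)]
  have : (fun (ω : Config) (i : ℤ) => ω (i + j)) ⁻¹' ((s : Set ℤ).pi t) =
      ((s.map (addRightEmbedding j) : Finset ℤ) : Set ℤ).pi (fun k => t (k - j)) := by
    ext ω
    simp only [Set.mem_preimage, Set.mem_pi, Finset.mem_coe, Finset.mem_map, addRightEmbedding_apply]
    constructor
    · rintro h _ ⟨i, hi, rfl⟩
      rw [add_sub_cancel_right]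
      exact h i hi
    · intro h i hi
      have := h (i + j) ⟨i, hi, rfl⟩
      rwa [add_sub_cancel_right] at this
  rw [this, gibbs, Measure.infinitePi_pi _ fun k _ => ht _, Finset.prod_map]
  simp

/-- The shift is a measurable equivalence, so the identity holds for arbitrary `F`, with no
measurability to check. -/
lemma integral_shift (j : ℤ) (F : Config → ℝ) :
    ∫ ω, shift j F ω ∂M.gibbs = ∫ ω, F ω ∂M.gibbs := by
  let e : Config ≃ᵐ Config :=
    { toFun := fun ω i => ω (i + j)
      invFun := fun ω i => ω (i - j)
      left_inv := fun ω => by funext i; simp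
      right_inv := fun ω => by funext i; simp
      measurable_toFun := by simp only [Equiv.coe_fn_mk]; fun_prop
      measurable_invFun := by simp only [Equiv.coe_fn_symm_mk]; fun_prop }
  exact MeasurePreserving.integral_comp (f := e) (M.measurePreserving_shift j)
    e.measurableEmbedding F

lemma integrable_resample {F : Config → ℝ} (i j : ℤ) (hF : Integrable F M.gibbs) :
    Integrable (fun y : Config × (ℝ × ℝ) => F (resample i j y.1 y.2))
      (M.gibbs.prod M.siteMeasure) :=
  (M.measurePreserving_resample i j).integrable_comp_of_integrable hF

lemma integral_resample {F : Config → ℝ} (i j : ℤ) (hF : Integrable F M.gibbs) :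
    ∫ ω, F ω ∂M.gibbs = ∫ ω, ∫ x, F (resample i j ω x) ∂M.siteMeasure ∂M.gibbs := by
  have h := M.measurePreserving_resample i j
  rw [← integral_prod _ (M.integrable_resample i j hF)]
  have h2 : AEStronglyMeasurable F
      ((M.gibbs.prod M.siteMeasure).map fun y => resample i j y.1 y.2) := by
    rw [h.map_eq]; exact hF.aestronglyMeasurable
  rw [← h.map_eq]
  rw [integral_map h.measurable.aemeasurable h2]
  rw [h.map_eq]

end Measure

end EnergyChain

end

noncomputable section

namespace EnergyChain

/-! ### Functions of polynomial growth -/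

/-- The weight `1 + ∑_{i ∈ Λ} (|p_i| + |r_i|)`. -/
def weight (Λ : Finset ℤ) (ω : Config) : ℝ := 1 + ∑ i ∈ Λ, (|(ω i).1| + |(ω i).2|)

lemma one_le_weight (Λ : Finset ℤ) (ω : Config) : 1 ≤ weight Λ ω := by
  unfold weight
  have : 0 ≤ ∑ i ∈ Λ, (|(ω i).1| + |(ω i).2|) := Finset.sum_nonneg fun i _ => by positivity
  linarith

lemma weight_mono {Λ Λ' : Finset ℤ} (h : Λ ⊆ Λ') (ω : Config) : weight Λ ω ≤ weight Λ' ω := by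
  unfold weight
  have := Finset.sum_le_sum_of_subset_of_nonneg (f := fun i => |(ω i).1| + |(ω i).2|) h
    fun i _ _ => by positivity
  linarith

/-- `F` is bounded by a polynomial in finitely many coordinates. -/
def PolyBdd (F : Config → ℝ) : Prop :=
  ∃ (Λ : Finset ℤ) (C : ℝ) (n : ℕ), 0 ≤ C ∧ ∀ ω, |F ω| ≤ C * weight Λ ω ^ n

namespace PolyBdd

variable {F G : Config → ℝ}

lemma mono (hG : PolyBdd G) (h : ∀ ω, |F ω| ≤ |G ω|) : PolyBdd F := by
  obtain ⟨Λ, C, n, hC, hb⟩ := hG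
  exact ⟨Λ, C, n, hC, fun ω => (h ω).trans (hb ω)⟩

lemma of_bounded {C : ℝ} (h : ∀ ω, |F ω| ≤ C) : PolyBdd F :=
  ⟨∅, |C|, 0, abs_nonneg _, fun ω => by simpa using (h ω).trans (le_abs_self C)⟩

lemma add (hF : PolyBdd F) (hG : PolyBdd G) : PolyBdd (F + G) := by
  obtain ⟨Λ, C, n, hC, hb⟩ := hF
  obtain ⟨Λ', C', n', hC', hb'⟩ := hG
  classical
  refine ⟨Λ ∪ Λ', C + C', n + n', by positivity, fun ω => ?_⟩
  have h0 := one_le_weight (Λ ∪ Λ') ω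
  have h1 : weight Λ ω ^ n ≤ weight (Λ ∪ Λ') ω ^ (n + n') :=
    (pow_le_pow_left₀ (zero_le_one.trans (one_le_weight _ _))
      (weight_mono Finset.subset_union_left ω) n).trans (pow_le_pow_right₀ h0 (by omega))
  have h2 : weight Λ' ω ^ n' ≤ weight (Λ ∪ Λ') ω ^ (n + n') :=
    (pow_le_pow_left₀ (zero_le_one.trans (one_le_weight _ _))
      (weight_mono Finset.subset_union_right ω) n').trans (pow_le_pow_right₀ h0 (by omega))
  calc |(F + G) ω| ≤ |F ω| + |G ω| := abs_add_le _ _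
    _ ≤ C * weight (Λ ∪ Λ') ω ^ (n + n') + C' * weight (Λ ∪ Λ') ω ^ (n + n') :=
        add_le_add ((hb ω).trans (mul_le_mul_of_nonneg_left h1 hC))
          ((hb' ω).trans (mul_le_mul_of_nonneg_left h2 hC'))
    _ = _ := by ring

lemma mul (hF : PolyBdd F) (hG : PolyBdd G) : PolyBdd (F * G) := by
  obtain ⟨Λ, C, n, hC, hb⟩ := hF
  obtain ⟨Λ', C', n', hC', hb'⟩ := hG
  classical
  refine ⟨Λ ∪ Λ', C * C', n + n', by positivity, fun ω => ?_⟩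
  have h1 : weight Λ ω ^ n ≤ weight (Λ ∪ Λ') ω ^ n :=
    pow_le_pow_left₀ (zero_le_one.trans (one_le_weight _ _))
      (weight_mono Finset.subset_union_left ω) n
  have h2 : weight Λ' ω ^ n' ≤ weight (Λ ∪ Λ') ω ^ n' :=
    pow_le_pow_left₀ (zero_le_one.trans (one_le_weight _ _))
      (weight_mono Finset.subset_union_right ω) n'
  have h3 : 0 ≤ weight (Λ ∪ Λ') ω ^ n := pow_nonneg (zero_le_one.trans (one_le_weight _ _)) _
  calc |(F * G) ω| = |F ω| * |G ω| := abs_mul _ _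
    _ ≤ (C * weight (Λ ∪ Λ') ω ^ n) * (C' * weight (Λ ∪ Λ') ω ^ n') :=
        mul_le_mul ((hb ω).trans (mul_le_mul_of_nonneg_left h1 hC))
          ((hb' ω).trans (mul_le_mul_of_nonneg_left h2 hC')) (abs_nonneg _)
          (mul_nonneg hC h3)
    _ = _ := by ring

lemma const (c : ℝ) : PolyBdd fun _ => c := of_bounded fun _ => le_rfl

lemma neg (hF : PolyBdd F) : PolyBdd (-F) := hF.mono fun ω => by simp

lemma sub (hF : PolyBdd F) (hG : PolyBdd G) : PolyBdd (F - G) := by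
  rw [sub_eq_add_neg]; exact hF.add hG.neg

lemma mom (i : ℤ) : PolyBdd fun ω => (ω i).1 :=
  ⟨{i}, 1, 1, zero_le_one, fun ω => by
    rw [weight, Finset.sum_singleton, one_mul, pow_one]
    linarith [abs_nonneg (ω i).2]⟩

lemma pos (i : ℤ) : PolyBdd fun ω => (ω i).2 :=
  ⟨{i}, 1, 1, zero_le_one, fun ω => by
    rw [weight, Finset.sum_singleton, one_mul, pow_one]
    linarith [abs_nonneg (ω i).1]⟩

lemma shift (hF : PolyBdd F) (j : ℤ) : PolyBdd (shift j F) := by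
  obtain ⟨Λ, C, n, hC, hb⟩ := hF
  refine ⟨Λ.map (addRightEmbedding j), C, n, hC, fun ω => ?_⟩
  refine (hb fun i => ω (i + j)).trans (le_of_eq ?_)
  simp [weight]

end PolyBdd

section Moments

variable (M : EnergyChain)

lemma memLp_mom (q : ℕ) (i : ℤ) : MemLp (fun ω : Config => (ω i).1) q M.gibbs := by
  have h1 : MemLp id q M.momMeasure := by
    have := ProbabilityTheory.memLp_id_gaussianReal (μ := 0) (v := M.β⁻¹.toNNReal) (q : NNReal)
    rw [momMeasure]
    simpa using this
  have h2 : MeasurePreserving (fun ω : Config => (ω i).1) M.gibbs M.momMeasure := by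
    have h3 : MeasurePreserving (Prod.fst : ℝ × ℝ → ℝ) M.siteMeasure M.momMeasure := by
      rw [siteMeasure_eq_prod]; exact measurePreserving_fst
    exact h3.comp (measurePreserving_eval_infinitePi (fun _ : ℤ => M.siteMeasure) i)
  exact h1.comp_measurePreserving h2

/-- Uniform convexity gives `V r ≥ δm r² / 2`, so the density is dominated by a Gaussian. -/
lemma integrable_pow_posMeasure (n : ℕ) : Integrable (fun r : ℝ => |r| ^ n) M.posMeasure := by
  have hVc : Continuous M.V := M.differentiable_V.continuous
  have hm : Measurable fun r => ENNReal.ofReal (Real.exp (-M.β * M.V r) / M.Z) :=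
    Measurable.ennreal_ofReal (Continuous.measurable (by fun_prop))
  rw [posMeasure, integrable_withDensity_iff_integrable_smul' hm
    (Eventually.of_forall fun _ => ENNReal.ofReal_lt_top)]
  have hb : 0 < M.β * (M.δm / 2) := mul_pos M.β_pos (half_pos M.δm_pos)
  have h1 := (integrable_rpow_mul_exp_neg_mul_sq hb
    (s := (n : ℝ)) (by have : (0 : ℝ) ≤ n := Nat.cast_nonneg n; linarith)).norm.const_mul (M.Z⁻¹)
  refine h1.mono' (Continuous.aestronglyMeasurable ?_) (Eventually.of_forall fun r => ?_)
  · have : (fun r => (ENNReal.ofReal (Real.exp (-M.β * M.V r) / M.Z)).toReal • |r| ^ n) =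
        fun r => Real.exp (-M.β * M.V r) / M.Z * |r| ^ n := by
      funext r
      rw [ENNReal.toReal_ofReal (div_nonneg (Real.exp_pos _).le M.Z_pos.le), smul_eq_mul]
    rw [this]
    fun_prop
  · rw [ENNReal.toReal_ofReal (div_nonneg (Real.exp_pos _).le M.Z_pos.le), smul_eq_mul,
      Real.rpow_natCast, norm_mul, norm_mul, norm_pow, norm_pow, Real.norm_eq_abs,
      Real.norm_eq_abs, Real.norm_eq_abs, Real.norm_eq_abs, abs_abs, Real.abs_exp,
      abs_of_nonneg (div_nonneg (Real.exp_pos _).le M.Z_pos.le)]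
    have h2 : Real.exp (-M.β * M.V r) ≤ Real.exp (-(M.β * (M.δm / 2)) * r ^ 2) := by
      refine Real.exp_le_exp.2 ?_
      have := mul_le_mul_of_nonneg_left (M.le_V r) M.β_pos.le
      nlinarith
    have hZ := inv_pos.2 M.Z_pos
    rw [div_eq_inv_mul, mul_assoc, mul_comm (|r| ^ n)]
    gcongr

lemma memLp_pos (q : ℕ) (i : ℤ) : MemLp (fun ω : Config => (ω i).2) q M.gibbs := by
  have h1 : MemLp id q M.posMeasure := by
    rcases Nat.eq_zero_or_pos q with hq | hq
    · subst hq
      simpa using measurable_id.aestronglyMeasurable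
    · refine (integrable_norm_rpow_iff measurable_id.aestronglyMeasurable
        (by exact_mod_cast hq.ne') (by simp)).1 ?_
      simpa using M.integrable_pow_posMeasure q
  have h2 : MeasurePreserving (fun ω : Config => (ω i).2) M.gibbs M.posMeasure := by
    have h3 : MeasurePreserving (Prod.snd : ℝ × ℝ → ℝ) M.siteMeasure M.posMeasure := by
      rw [siteMeasure_eq_prod]; exact measurePreserving_snd
    exact h3.comp (measurePreserving_eval_infinitePi (fun _ : ℤ => M.siteMeasure) i)
  exact h1.comp_measurePreserving h2

lemma integrable_weight_pow (Λ : Finset ℤ) (n : ℕ) :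
    Integrable (fun ω => weight Λ ω ^ n) M.gibbs := by
  have h1 : MemLp (weight Λ) n M.gibbs := by
    have h2 : ∀ i ∈ Λ, MemLp (fun ω : Config => |(ω i).1| + |(ω i).2|) n M.gibbs := fun i _ =>
      (M.memLp_mom n i).abs.add (M.memLp_pos n i).abs
    have h3 := memLp_finsetSum Λ h2
    have h4 : MemLp (fun _ : Config => (1 : ℝ)) n M.gibbs := memLp_const 1
    have h5 : weight Λ = (fun _ => (1 : ℝ)) +
        fun ω : Config => ∑ i ∈ Λ, (|(ω i).1| + |(ω i).2|) := rfl
    rw [h5]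
    exact h4.add h3
  rcases Nat.eq_zero_or_pos n with hn | hn
  · subst hn; simp
  · have := h1.integrable_norm_pow hn.ne'
    refine this.congr (Eventually.of_forall fun ω => ?_)
    simp only
    rw [Real.norm_of_nonneg (zero_le_one.trans (one_le_weight Λ ω))]

lemma PolyBdd.integrable {F : Config → ℝ} (hF : PolyBdd F) (hm : Measurable F) :
    Integrable F M.gibbs := by
  obtain ⟨Λ, C, n, hC, hb⟩ := hF
  exact ((M.integrable_weight_pow Λ n).const_mul C).mono' hm.aestronglyMeasurable
    (Eventually.of_forall hb)

lemma PolyBdd.memLp {F : Config → ℝ} (hF : PolyBdd F) (hm : Measurable F) :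
    MemLp F 2 M.gibbs := by
  refine (memLp_two_iff_integrable_sq hm.aestronglyMeasurable).2 ?_
  have := (hF.mul hF).integrable M (hm.mul hm)
  refine this.congr (Eventually.of_forall fun ω => ?_)
  simp [sq]

end Moments

/-! ### Calculus of smooth local functions -/

/-- The derivative of `t ↦ (update ω i (t, r_i))` in the coordinates `Λ`. -/
def dirMom (Λ : Finset ℤ) (i : ℤ) : Λ → ℝ × ℝ := fun k => if (k : ℤ) = i then (1, 0) else 0

/-- The derivative of `t ↦ (update ω i (p_i, t))` in the coordinates `Λ`. -/
def dirPos (Λ : Finset ℤ) (i : ℤ) : Λ → ℝ × ℝ := fun k => if (k : ℤ) = i then (0, 1) else 0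

lemma hasDerivAt_update_mom (Λ : Finset ℤ) (i : ℤ) (ω : Config) (t : ℝ) :
    HasDerivAt (fun t => fun k : Λ => Function.update ω i (t, (ω i).2) k) (dirMom Λ i) t := by
  refine hasDerivAt_pi.2 fun k => ?_
  by_cases hk : (k : ℤ) = i
  · simp only [dirMom, hk, Function.update_self, if_true]
    exact (hasDerivAt_id t).prodMk (hasDerivAt_const t _)
  · simp only [dirMom, hk, Function.update_of_ne (h := hk), if_false]
    exact hasDerivAt_const t _

lemma hasDerivAt_update_pos (Λ : Finset ℤ) (i : ℤ) (ω : Config) (t : ℝ) :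
    HasDerivAt (fun t => fun k : Λ => Function.update ω i ((ω i).1, t) k) (dirPos Λ i) t := by
  refine hasDerivAt_pi.2 fun k => ?_
  by_cases hk : (k : ℤ) = i
  · simp only [dirPos, hk, Function.update_self, if_true]
    exact (hasDerivAt_const t _).prodMk (hasDerivAt_id t)
  · simp only [dirPos, hk, Function.update_of_ne (h := hk), if_false]
    exact hasDerivAt_const t _

lemma hasDerivAt_mom_of_contDiff {Λ : Finset ℤ} {φ : (Λ → ℝ × ℝ) → ℝ}
    (hφ : ContDiff ℝ (⊤ : ℕ∞) φ) (i : ℤ) (ω : Config) :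
    HasDerivAt (fun t => φ fun k => Function.update ω i (t, (ω i).2) k)
      (fderiv ℝ φ (fun k => ω k) (dirMom Λ i)) (ω i).1 := by
  have h1 : HasFDerivAt φ (fderiv ℝ φ (fun k => ω k))
      (fun k : Λ => Function.update ω i ((ω i).1, (ω i).2) k) := by
    rw [Prod.mk.eta, Function.update_eq_self]
    exact (hφ.differentiable (by simp) _).hasFDerivAt
  exact h1.comp_hasDerivAt (ω i).1 (hasDerivAt_update_mom Λ i ω (ω i).1)

lemma hasDerivAt_pos_of_contDiff {Λ : Finset ℤ} {φ : (Λ → ℝ × ℝ) → ℝ}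
    (hφ : ContDiff ℝ (⊤ : ℕ∞) φ) (i : ℤ) (ω : Config) :
    HasDerivAt (fun t => φ fun k => Function.update ω i ((ω i).1, t) k)
      (fderiv ℝ φ (fun k => ω k) (dirPos Λ i)) (ω i).2 := by
  have h1 : HasFDerivAt φ (fderiv ℝ φ (fun k => ω k))
      (fun k : Λ => Function.update ω i ((ω i).1, (ω i).2) k) := by
    rw [Prod.mk.eta, Function.update_eq_self]
    exact (hφ.differentiable (by simp) _).hasFDerivAt
  exact h1.comp_hasDerivAt (ω i).2 (hasDerivAt_update_pos Λ i ω (ω i).2)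

lemma dp_local {Λ : Finset ℤ} {φ : (Λ → ℝ × ℝ) → ℝ} (hφ : ContDiff ℝ (⊤ : ℕ∞) φ) (i : ℤ) :
    dp i (fun ω => φ fun k => ω k) = fun ω => fderiv ℝ φ (fun k => ω k) (dirMom Λ i) :=
  funext fun ω => (hasDerivAt_mom_of_contDiff hφ i ω).deriv

lemma dr_local {Λ : Finset ℤ} {φ : (Λ → ℝ × ℝ) → ℝ} (hφ : ContDiff ℝ (⊤ : ℕ∞) φ) (i : ℤ) :
    dr i (fun ω => φ fun k => ω k) = fun ω => fderiv ℝ φ (fun k => ω k) (dirPos Λ i) :=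
  funext fun ω => (hasDerivAt_pos_of_contDiff hφ i ω).deriv

lemma contDiff_fderiv_apply_const {Λ : Finset ℤ} {φ : (Λ → ℝ × ℝ) → ℝ}
    (hφ : ContDiff ℝ (⊤ : ℕ∞) φ) (v : Λ → ℝ × ℝ) :
    ContDiff ℝ (⊤ : ℕ∞) fun x => fderiv ℝ φ x v :=
  (hφ.fderiv_right (m := (⊤ : ℕ∞)) (by simp)).clm_apply contDiff_const

namespace IsSmoothLocal

variable {F G : Config → ℝ}

lemma dp (hF : IsSmoothLocal F) (i : ℤ) : IsSmoothLocal (dp i F) := by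
  obtain ⟨Λ, φ, hφ, rfl⟩ := hF
  exact ⟨Λ, _, contDiff_fderiv_apply_const hφ (dirMom Λ i), dp_local hφ i⟩

lemma dr (hF : IsSmoothLocal F) (i : ℤ) : IsSmoothLocal (dr i F) := by
  obtain ⟨Λ, φ, hφ, rfl⟩ := hF
  exact ⟨Λ, _, contDiff_fderiv_apply_const hφ (dirPos Λ i), dr_local hφ i⟩

lemma continuous (hF : IsSmoothLocal F) : Continuous F := by
  obtain ⟨Λ, φ, hφ, rfl⟩ := hF
  exact hφ.continuous.comp (by fun_prop)

lemma measurable (hF : IsSmoothLocal F) : Measurable F := hF.continuous.measurable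

lemma hasDerivAt_mom (hF : IsSmoothLocal F) (i : ℤ) (ω : Config) :
    HasDerivAt (fun t => F (Function.update ω i (t, (ω i).2))) (EnergyChain.dp i F ω) (ω i).1 := by
  obtain ⟨Λ, φ, hφ, rfl⟩ := hF
  rw [dp_local hφ]
  exact hasDerivAt_mom_of_contDiff hφ i ω

lemma hasDerivAt_pos (hF : IsSmoothLocal F) (i : ℤ) (ω : Config) :
    HasDerivAt (fun t => F (Function.update ω i ((ω i).1, t))) (EnergyChain.dr i F ω) (ω i).2 := by
  obtain ⟨Λ, φ, hφ, rfl⟩ := hF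
  rw [dr_local hφ]
  exact hasDerivAt_pos_of_contDiff hφ i ω

lemma enlarge {Λ Λ' : Finset ℤ} (h : Λ ⊆ Λ') {φ : (Λ → ℝ × ℝ) → ℝ}
    (hφ : ContDiff ℝ (⊤ : ℕ∞) φ) :
    ContDiff ℝ (⊤ : ℕ∞) fun x : Λ' → ℝ × ℝ => φ fun k => x ⟨k, h k.2⟩ :=
  hφ.comp (contDiff_pi.2 fun k => contDiff_apply ℝ (ℝ × ℝ) (⟨k, h k.2⟩ : Λ'))

lemma comp₂ (hF : IsSmoothLocal F) (hG : IsSmoothLocal G) {op : ℝ × ℝ → ℝ}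
    (hop : ContDiff ℝ (⊤ : ℕ∞) op) : IsSmoothLocal fun ω => op (F ω, G ω) := by
  classical
  obtain ⟨Λ, φ, hφ, rfl⟩ := hF
  obtain ⟨Λ', φ', hφ', rfl⟩ := hG
  exact ⟨Λ ∪ Λ', _, hop.comp ((enlarge Finset.subset_union_left hφ).prodMk
    (enlarge Finset.subset_union_right hφ')), rfl⟩

lemma add (hF : IsSmoothLocal F) (hG : IsSmoothLocal G) : IsSmoothLocal (F + G) :=
  hF.comp₂ hG (contDiff_fst.add contDiff_snd)

lemma mul (hF : IsSmoothLocal F) (hG : IsSmoothLocal G) : IsSmoothLocal (F * G) :=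
  hF.comp₂ hG (contDiff_fst.mul contDiff_snd)

lemma sub (hF : IsSmoothLocal F) (hG : IsSmoothLocal G) : IsSmoothLocal (F - G) :=
  hF.comp₂ hG (contDiff_fst.sub contDiff_snd)

lemma const (c : ℝ) : IsSmoothLocal fun _ => c := ⟨∅, fun _ => c, contDiff_const, rfl⟩

lemma of_site {f : ℝ × ℝ → ℝ} (hf : ContDiff ℝ (⊤ : ℕ∞) f) (i : ℤ) :
    IsSmoothLocal fun ω => f (ω i) :=
  ⟨{i}, fun x => f (x ⟨i, Finset.mem_singleton_self i⟩),
    hf.comp (contDiff_apply ℝ (ℝ × ℝ) _), rfl⟩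

lemma mom (i : ℤ) : IsSmoothLocal fun ω => (ω i).1 := of_site contDiff_fst i

lemma deriv_V (M : EnergyChain) (i : ℤ) : IsSmoothLocal fun ω => deriv M.V (ω i).2 :=
  of_site (M.contDiff_deriv_V.comp contDiff_snd) i

lemma shift (hF : IsSmoothLocal F) (j : ℤ) : IsSmoothLocal (shift j F) := by
  obtain ⟨Λ, φ, hφ, rfl⟩ := hF
  refine ⟨Λ.map (addRightEmbedding j), fun x => φ fun k => x ⟨k + j, ?_⟩, ?_, rfl⟩
  · simp
  · exact hφ.comp (contDiff_pi.2 fun k => contDiff_apply ℝ (ℝ × ℝ) _)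

lemma Y (hF : IsSmoothLocal F) (M : EnergyChain) (i j : ℤ) : IsSmoothLocal (M.Y i j F) :=
  ((mom i).mul (hF.dr j)).sub ((deriv_V M j).mul (hF.dp i))

/-- A smooth local function is smooth in the pair `(p_i, r_j)`. -/
lemma contDiff_resample (hF : IsSmoothLocal F) (i j : ℤ) (ω : Config) :
    ContDiff ℝ (⊤ : ℕ∞) fun x => F (resample i j ω x) := by
  obtain ⟨Λ, φ, hφ, rfl⟩ := hF
  refine hφ.comp (contDiff_pi.2 fun k => ?_)
  unfold resample
  refine ContDiff.prodMk ?_ ?_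
  · split_ifs
    · exact contDiff_fst
    · exact contDiff_const
  · split_ifs
    · exact contDiff_snd
    · exact contDiff_const

/-- The sites on which a local function depends. -/
lemma exists_support (hF : IsSmoothLocal F) : ∃ Λ : Finset ℤ, ∀ ω ω' : Config,
    (∀ k ∈ Λ, ω k = ω' k) → F ω = F ω' := by
  obtain ⟨Λ, φ, hφ, rfl⟩ := hF
  exact ⟨Λ, fun ω ω' h => congrArg φ (funext fun k => h k k.2)⟩

end IsSmoothLocal

section Calculus

variable (M : EnergyChain) {F G : Config → ℝ}

lemma dp_mul (hF : IsSmoothLocal F) (hG : IsSmoothLocal G) (i : ℤ) :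
    dp i (F * G) = dp i F * G + F * dp i G := by
  funext ω
  have := ((hF.hasDerivAt_mom i ω).mul (hG.hasDerivAt_mom i ω)).deriv
  simp only [Prod.mk.eta, Function.update_eq_self] at this
  exact this

lemma dr_mul (hF : IsSmoothLocal F) (hG : IsSmoothLocal G) (i : ℤ) :
    dr i (F * G) = dr i F * G + F * dr i G := by
  funext ω
  have := ((hF.hasDerivAt_pos i ω).mul (hG.hasDerivAt_pos i ω)).deriv
  simp only [Prod.mk.eta, Function.update_eq_self] at this
  exact this

lemma dp_add (hF : IsSmoothLocal F) (hG : IsSmoothLocal G) (i : ℤ) :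
    dp i (F + G) = dp i F + dp i G :=
  funext fun ω => ((hF.hasDerivAt_mom i ω).add (hG.hasDerivAt_mom i ω)).deriv

lemma dr_add (hF : IsSmoothLocal F) (hG : IsSmoothLocal G) (i : ℤ) :
    dr i (F + G) = dr i F + dr i G :=
  funext fun ω => ((hF.hasDerivAt_pos i ω).add (hG.hasDerivAt_pos i ω)).deriv

lemma dp_const (c : ℝ) (i : ℤ) : dp i (fun _ => c) = 0 := by
  funext ω; simp [dp]

lemma dr_const (c : ℝ) (i : ℤ) : dr i (fun _ => c) = 0 := by
  funext ω; simp [dr]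

lemma dp_pair (h : ℝ → ℝ → ℝ) (i j k : ℤ) (ω : Config) :
    dp k (fun ω => h (ω i).1 (ω j).2) ω =
      if k = i then deriv (fun t => h t (ω j).2) (ω i).1 else 0 := by
  unfold dp
  have h2 : ∀ t, (Function.update ω k (t, (ω k).2) j).2 = (ω j).2 := by
    intro t
    by_cases hj : j = k
    · subst hj; simp
    · rw [Function.update_of_ne hj]
  simp_rw [h2]
  by_cases hk : k = i
  · subst hk; simp
  · rw [if_neg hk]
    simp [Function.update_of_ne (Ne.symm hk)]

lemma dr_pair (h : ℝ → ℝ → ℝ) (i j k : ℤ) (ω : Config) :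
    dr k (fun ω => h (ω i).1 (ω j).2) ω =
      if k = j then deriv (fun t => h (ω i).1 t) (ω j).2 else 0 := by
  unfold dr
  have h2 : ∀ t, (Function.update ω k ((ω k).1, t) i).1 = (ω i).1 := by
    intro t
    by_cases hj : i = k
    · subst hj; simp
    · rw [Function.update_of_ne hj]
  simp_rw [h2]
  by_cases hk : k = j
  · subst hk; simp
  · rw [if_neg hk]
    simp [Function.update_of_ne (Ne.symm hk)]

/-- Site `i` of a configuration is site `i - j` of its translate by `j`; this fixes the index
convention of all the shift rules below. -/
lemma shift_update (F : Config → ℝ) (i j : ℤ) (ω : Config) (y : ℝ × ℝ) :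
    shift j F (Function.update ω i y) = F (Function.update (fun k => ω (k + j)) (i - j) y) := by
  unfold shift
  congr 1
  funext k
  by_cases hk : k + j = i
  · have : k = i - j := by omega
    subst this
    simp
  · rw [Function.update_of_ne hk, Function.update_of_ne (by omega)]

lemma dp_shift (F : Config → ℝ) (i j : ℤ) : dp i (shift j F) = shift j (dp (i - j) F) := by
  funext ω
  unfold dp
  simp_rw [shift_update]
  simp [shift]

lemma dr_shift (F : Config → ℝ) (i j : ℤ) : dr i (shift j F) = shift j (dr (i - j) F) := by
  funext ω
  unfold dr
  simp_rw [shift_update]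
  simp [shift]

lemma shift_shift (F : Config → ℝ) (i j : ℤ) : shift i (shift j F) = shift (i + j) F := by
  funext ω
  unfold shift
  simp only [add_assoc, add_comm i j]

lemma shift_zero (F : Config → ℝ) : shift 0 F = F := by
  funext ω; simp [shift]

lemma Y_shift (F : Config → ℝ) (i j k : ℤ) :
    M.Y i j (shift k F) = shift k (M.Y (i - k) (j - k) F) := by
  funext ω
  simp only [Y, dp_shift, dr_shift]
  simp [shift, Y]

lemma Y_add (hF : IsSmoothLocal F) (hG : IsSmoothLocal G) (i j : ℤ) :
    M.Y i j (F + G) = M.Y i j F + M.Y i j G := by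
  funext ω
  simp only [Y, dp_add hF hG, dr_add hF hG, Pi.add_apply]
  ring

lemma Y_mul (hF : IsSmoothLocal F) (hG : IsSmoothLocal G) (i j : ℤ) :
    M.Y i j (F * G) = M.Y i j F * G + F * M.Y i j G := by
  funext ω
  simp only [Y, dp_mul hF hG, dr_mul hF hG, Pi.add_apply, Pi.mul_apply]
  ring

lemma Y_const (c : ℝ) (i j : ℤ) : M.Y i j (fun _ => c) = 0 := by
  funext ω
  simp [Y, dp_const, dr_const]

lemma Y_smul (hF : IsSmoothLocal F) (c : ℝ) (i j : ℤ) : M.Y i j (c • F) = c • M.Y i j F := by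
  have h : c • F = (fun _ => c) * F := by funext ω; simp
  rw [h, Y_mul M (IsSmoothLocal.const c) hF, Y_const]
  funext ω
  simp

lemma Y_sum {ι : Type*} (s : Finset ι) {f : ι → Config → ℝ} (hf : ∀ k ∈ s, IsSmoothLocal (f k))
    (i j : ℤ) : M.Y i j (∑ k ∈ s, f k) = ∑ k ∈ s, M.Y i j (f k) ∧
      IsSmoothLocal (∑ k ∈ s, f k) := by
  classical
  induction s using Finset.induction_on with
  | empty => exact ⟨M.Y_const 0 i j, IsSmoothLocal.const 0⟩
  | insert a s ha ih =>
    obtain ⟨h1, h2⟩ := ih fun k hk => hf k (Finset.mem_insert_of_mem hk)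
    rw [Finset.sum_insert ha, Finset.sum_insert ha]
    have h3 := hf a (Finset.mem_insert_self a s)
    exact ⟨by rw [M.Y_add h3 h2, h1], h3.add h2⟩

/-- In the pair `(p_i, r_j)`, the operator `Y_{i,j}` is the Hamiltonian vector field. -/
lemma Y_resample (F : Config → ℝ) (i j : ℤ) (ω : Config) (x : ℝ × ℝ) :
    M.Y i j F (resample i j ω x) = M.flowDeriv (fun x => F (resample i j ω x)) x := by
  unfold Y flowDeriv dp dr
  have h1 : (resample i j ω x i).1 = x.1 := by simp [resample]
  have h2 : (resample i j ω x j).2 = x.2 := by simp [resample]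
  have h3 : ∀ t, Function.update (resample i j ω x) j ((resample i j ω x j).1, t) =
      resample i j ω (x.1, t) := by
    intro t
    funext k
    by_cases hk : k = j
    · subst hk; simp [resample]
    · simp [resample, hk]
  have h4 : ∀ t, Function.update (resample i j ω x) i (t, (resample i j ω x i).2) =
      resample i j ω (t, x.2) := by
    intro t
    funext k
    by_cases hk : k = i
    · subst hk; simp [resample]
    · simp [resample, hk]
  simp_rw [h3, h4, h1, h2]

/-- `Y_{i,j}` kills functions that depend neither on site `i` nor on site `j`. -/
lemma Y_eq_zero {Λ : Finset ℤ} (hΛ : ∀ ω ω' : Config, (∀ k ∈ Λ, ω k = ω' k) → F ω = F ω')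
    {i j : ℤ} (hi : i ∉ Λ) (hj : j ∉ Λ) : M.Y i j F = 0 := by
  funext ω
  have key : ∀ k ∉ Λ, ∀ y, F (Function.update ω k y) = F ω := by
    intro k hk y
    refine hΛ _ _ fun l hl => ?_
    rw [Function.update_of_ne]
    rintro rfl
    exact hk hl
  simp [Y, dp, dr, key i hi, key j hj]

end Calculus

/-! ### Smooth local functions with derivatives of polynomial growth -/

/-- Smooth local functions with first derivatives of polynomial growth. -/
structure Tame (F : Config → ℝ) : Prop where
  smooth : IsSmoothLocal F
  bdd : PolyBdd F
  bdd_dp : ∀ i, PolyBdd (dp i F)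
  bdd_dr : ∀ i, PolyBdd (dr i F)

namespace Tame

variable {F G : Config → ℝ}

lemma add (hF : Tame F) (hG : Tame G) : Tame (F + G) :=
  ⟨hF.smooth.add hG.smooth, hF.bdd.add hG.bdd,
    fun i => by rw [dp_add hF.smooth hG.smooth]; exact (hF.bdd_dp i).add (hG.bdd_dp i),
    fun i => by rw [dr_add hF.smooth hG.smooth]; exact (hF.bdd_dr i).add (hG.bdd_dr i)⟩

lemma mul (hF : Tame F) (hG : Tame G) : Tame (F * G) :=
  ⟨hF.smooth.mul hG.smooth, hF.bdd.mul hG.bdd,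
    fun i => by
      rw [dp_mul hF.smooth hG.smooth]
      exact ((hF.bdd_dp i).mul hG.bdd).add (hF.bdd.mul (hG.bdd_dp i)),
    fun i => by
      rw [dr_mul hF.smooth hG.smooth]
      exact ((hF.bdd_dr i).mul hG.bdd).add (hF.bdd.mul (hG.bdd_dr i))⟩

lemma const (c : ℝ) : Tame fun _ => c :=
  ⟨IsSmoothLocal.const c, PolyBdd.const c, fun i => by rw [dp_const]; exact PolyBdd.const 0,
    fun i => by rw [dr_const]; exact PolyBdd.const 0⟩

lemma smul (hF : Tame F) (c : ℝ) : Tame (c • F) := by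
  have h : c • F = (fun _ => c) * F := by funext ω; simp
  rw [h]; exact (const c).mul hF

lemma neg (hF : Tame F) : Tame (-F) := by
  rw [← neg_one_smul ℝ F]; exact hF.smul _

lemma sub (hF : Tame F) (hG : Tame G) : Tame (F - G) := by
  rw [sub_eq_add_neg]; exact hF.add hG.neg

lemma sum {ι : Type*} (s : Finset ι) {f : ι → Config → ℝ} (hf : ∀ k ∈ s, Tame (f k)) :
    Tame (∑ k ∈ s, f k) :=
  Finset.sum_induction f Tame (fun _ _ ha hb => ha.add hb) (const 0) hf

lemma shift (hF : Tame F) (j : ℤ) : Tame (shift j F) :=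
  ⟨hF.smooth.shift j, hF.bdd.shift j, fun i => by rw [dp_shift]; exact (hF.bdd_dp _).shift j,
    fun i => by rw [dr_shift]; exact (hF.bdd_dr _).shift j⟩

lemma mom (i : ℤ) : Tame fun ω => (ω i).1 := by
  refine ⟨IsSmoothLocal.mom i, PolyBdd.mom i, fun k => ?_, fun k => ?_⟩
  · refine PolyBdd.of_bounded (C := 1) fun ω => ?_
    rw [dp_pair (fun p _ => p) i i k ω]
    split_ifs <;> simp
  · refine PolyBdd.of_bounded (C := 0) fun ω => ?_
    rw [dr_pair (fun p _ => p) i i k ω]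
    split_ifs <;> simp

lemma of_pos {f : ℝ → ℝ} (hf : ContDiff ℝ (⊤ : ℕ∞) f) (i : ℤ)
    (hb : PolyBdd fun ω => f (ω i).2) (hb' : PolyBdd fun ω => deriv f (ω i).2) :
    Tame fun ω => f (ω i).2 := by
  refine ⟨IsSmoothLocal.of_site (hf.comp contDiff_snd) i, hb, fun k => ?_, fun k => ?_⟩
  · refine PolyBdd.of_bounded (C := 0) fun ω => ?_
    rw [dp_pair (fun _ r => f r) i i k ω]
    split_ifs <;> simp
  · refine hb'.mono fun ω => ?_
    rw [dr_pair (fun _ r => f r) i i k ω]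
    split_ifs <;> simp

lemma pos (i : ℤ) : Tame fun ω => (ω i).2 := by
  refine of_pos (f := id) contDiff_id i (PolyBdd.pos i) ?_
  refine PolyBdd.of_bounded (C := 1) fun ω => ?_
  simp

lemma deriv_V (M : EnergyChain) (i : ℤ) : Tame fun ω => deriv M.V (ω i).2 := by
  refine of_pos M.contDiff_deriv_V i ?_ ?_
  · refine ((PolyBdd.const M.δp).mul (PolyBdd.pos i)).mono fun ω => ?_
    rw [Pi.mul_apply, abs_mul, abs_of_pos M.δp_pos]
    exact M.abs_deriv_V_le _
  · refine PolyBdd.of_bounded (C := M.δp) fun ω => ?_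
    rw [abs_of_nonneg (M.δm_pos.le.trans (M.le_V'' _))]
    exact M.V''_le _

lemma potential (M : EnergyChain) (i : ℤ) : Tame fun ω => M.V (ω i).2 := by
  refine of_pos M.V_smooth i ?_ (deriv_V M i).bdd
  refine ((PolyBdd.const M.δp).mul ((PolyBdd.pos i).mul (PolyBdd.pos i)) |>.add
    (PolyBdd.const (M.V 0))).mono fun ω => ?_
  simp only [Pi.add_apply, Pi.mul_apply]
  have key : ∀ r, M.V r ≤ M.δp * (r * r) + M.V 0 := by
    intro r
    have h1 : ∀ s, 0 ≤ s → M.V s ≤ M.δp * (s * s) + M.V 0 := by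
      intro s hs
      have := M.V_sub_le hs
      have h2 : 0 ≤ M.δp * s ^ 2 := mul_nonneg M.δp_pos.le (sq_nonneg s)
      nlinarith
    rcases le_total 0 r with h | h
    · exact h1 r h
    · have := h1 (-r) (by linarith)
      rw [M.V_symm] at this
      linarith
  rw [abs_of_nonneg (M.V_nonneg _), abs_of_nonneg]
  · exact key _
  · exact (M.V_nonneg _).trans (key _)

lemma energy (M : EnergyChain) (i : ℤ) : Tame (M.energy i) := by
  have h := (((mom i).mul (mom i)).smul (1 / 2)).add (potential M i)
  convert h using 1
  funext ω
  simp [EnergyChain.energy]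
  ring

variable (M : EnergyChain)

lemma bdd_Y (hF : Tame F) (i j : ℤ) : PolyBdd (M.Y i j F) :=
  ((PolyBdd.mom i).mul (hF.bdd_dr j)).sub ((deriv_V M j).bdd.mul (hF.bdd_dp i))

lemma memLp (hF : Tame F) : MemLp F 2 M.gibbs := hF.bdd.memLp M hF.smooth.measurable

lemma memLp_Y (hF : Tame F) (i j : ℤ) : MemLp (M.Y i j F) 2 M.gibbs :=
  (hF.bdd_Y M i j).memLp M (hF.smooth.Y M i j).measurable

lemma mem_smoothL2 (hF : Tame F) : F ∈ M.smoothL2 :=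
  ⟨hF.smooth, hF.memLp M, fun i => ⟨hF.memLp_Y M i i, hF.memLp_Y M i (i + 1)⟩⟩

/-- `Y_{i,j} F` is tame when the first derivatives of `F` are. -/
lemma Y (hp : ∀ i, Tame (dp i F)) (hr : ∀ i, Tame (dr i F)) (i j : ℤ) :
    Tame (M.Y i j F) :=
  ((mom i).mul (hr j)).sub ((deriv_V M j).mul (hp i))

end Tame

/-! ### Test functions -/

lemma IsSmoothLocalCompact.dp {F : Config → ℝ} (hF : IsSmoothLocalCompact F) (i : ℤ) :
    IsSmoothLocalCompact (dp i F) := by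
  obtain ⟨Λ, φ, hφ, hc, rfl⟩ := hF
  exact ⟨Λ, _, contDiff_fderiv_apply_const hφ (dirMom Λ i), hc.fderiv_apply ℝ _, dp_local hφ i⟩

lemma IsSmoothLocalCompact.dr {F : Config → ℝ} (hF : IsSmoothLocalCompact F) (i : ℤ) :
    IsSmoothLocalCompact (dr i F) := by
  obtain ⟨Λ, φ, hφ, hc, rfl⟩ := hF
  exact ⟨Λ, _, contDiff_fderiv_apply_const hφ (dirPos Λ i), hc.fderiv_apply ℝ _, dr_local hφ i⟩

lemma IsSmoothLocalCompact.polyBdd {F : Config → ℝ} (hF : IsSmoothLocalCompact F) :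
    PolyBdd F := by
  obtain ⟨Λ, φ, hφ, hc, rfl⟩ := hF
  obtain ⟨C, hC⟩ := hc.exists_bound_of_continuous hφ.continuous
  exact PolyBdd.of_bounded fun ω => hC _

lemma IsSmoothLocalCompact.tame {F : Config → ℝ} (hF : IsSmoothLocalCompact F) : Tame F :=
  ⟨by obtain ⟨Λ, φ, hφ, hc, rfl⟩ := hF; exact ⟨Λ, φ, hφ, rfl⟩, hF.polyBdd,
    fun i => (hF.dp i).polyBdd, fun i => (hF.dr i).polyBdd⟩

/-- Compact support is lost both under sums over different sites and under `Y_{i,i+1}`, which can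
introduce an unbounded `p_i`; polynomial growth survives both. The first derivatives are included
because the generator applies the vector fields twice. -/
lemma tame_of_mem_testSpace {M : EnergyChain} {F : Config → ℝ} (hF : F ∈ M.testSpace) :
    Tame F ∧ (∀ i, Tame (dp i F)) ∧ ∀ i, Tame (dr i F) := by
  induction hF using Submodule.span_induction with
  | mem F h => exact ⟨h.1.tame, fun i => (h.1.dp i).tame, fun i => (h.1.dr i).tame⟩
  | zero =>
    refine ⟨Tame.const 0, fun i => ?_, fun i => ?_⟩
    · have : dp i (0 : Config → ℝ) = 0 := dp_const 0 i
      rw [this]; exact Tame.const 0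
    · have : dr i (0 : Config → ℝ) = 0 := dr_const 0 i
      rw [this]; exact Tame.const 0
  | add F G _ _ hF hG =>
    refine ⟨hF.1.add hG.1, fun i => ?_, fun i => ?_⟩
    · rw [dp_add hF.1.smooth hG.1.smooth]; exact (hF.2.1 i).add (hG.2.1 i)
    · rw [dr_add hF.1.smooth hG.1.smooth]; exact (hF.2.2 i).add (hG.2.2 i)
  | smul c F _ hF =>
    have h : c • F = (fun _ => c) * F := by funext ω; simp
    refine ⟨hF.1.smul c, fun i => ?_, fun i => ?_⟩
    · rw [h, dp_mul (IsSmoothLocal.const c) hF.1.smooth, dp_const, zero_mul, zero_add]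
      exact (Tame.const c).mul (hF.2.1 i)
    · rw [h, dr_mul (IsSmoothLocal.const c) hF.1.smooth, dr_const, zero_mul, zero_add]
      exact (Tame.const c).mul (hF.2.2 i)

end EnergyChain

end

noncomputable section

namespace EnergyChain

/-! ### Integration by parts, the sector condition and moments of the Gibbs measure. -/

section Integration

variable (M : EnergyChain) {F G : Config → ℝ}

lemma Tame.integrable (hF : Tame F) : Integrable F M.gibbs :=
  hF.bdd.integrable M hF.smooth.measurable

lemma Tame.integrable_Y (hF : Tame F) (i j : ℤ) : Integrable (M.Y i j F) M.gibbs :=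
  (hF.bdd_Y M i j).integrable M (hF.smooth.Y M i j).measurable

lemma Tame.integrable_mul_Y (hF : Tame F) (hG : Tame G) (i j : ℤ) :
    Integrable (fun ω => F ω * M.Y i j G ω) M.gibbs :=
  (hF.bdd.mul (hG.bdd_Y M i j)).integrable M
    (hF.smooth.mul (hG.smooth.Y M i j)).measurable

lemma Tame.integrable_Y_sq (hF : Tame F) (i j : ℤ) :
    Integrable (fun ω => M.Y i j F ω ^ 2) M.gibbs :=
  (memLp_two_iff_integrable_sq (hF.smooth.Y M i j).measurable.aestronglyMeasurable).1
    (hF.memLp_Y M i j)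

/-- Condition on everything except `(p_i, r_j)`: on almost every fibre the integrand is the one-pair
Hamiltonian field applied to a smooth function. -/
lemma integral_Y (hF : Tame F) (i j : ℤ) : ∫ ω, M.Y i j F ω ∂M.gibbs = 0 := by
  have hi := hF.integrable_Y M i j
  rw [M.integral_resample i j hi]
  refine integral_eq_zero_of_ae ?_
  filter_upwards [(M.integrable_resample i j hi).prod_right_ae] with ω hω
  simp only [Y_resample] at hω ⊢
  exact M.integral_flowDeriv ((hF.smooth.contDiff_resample i j ω).of_le (by simp)) hω

/-- The operators `Y_{i,j}` are antisymmetric. -/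
lemma integral_mul_Y (hF : Tame F) (hG : Tame G) (i j : ℤ) :
    ∫ ω, F ω * M.Y i j G ω ∂M.gibbs = -∫ ω, M.Y i j F ω * G ω ∂M.gibbs := by
  have h := M.integral_Y (hF.mul hG) i j
  rw [Y_mul M hF.smooth hG.smooth] at h
  have h1 : Integrable (fun ω => M.Y i j F ω * G ω) M.gibbs := by
    simpa only [mul_comm] using hG.integrable_mul_Y M hF i j
  have h2 := integral_add h1 (hF.integrable_mul_Y M hG i j)
  have h3 : ∫ ω, (M.Y i j F * G + F * M.Y i j G) ω ∂M.gibbs =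
    ∫ ω, (M.Y i j F ω * G ω + F ω * M.Y i j G ω) ∂M.gibbs := rfl
  rw [h3, h2] at h
  linarith

lemma integral_self_mul_Y (hF : Tame F) (i j : ℤ) : ∫ ω, F ω * M.Y i j F ω ∂M.gibbs = 0 := by
  have h := M.integral_mul_Y hF hF i j
  simp_rw [mul_comm (M.Y i j F _)] at h
  linarith

/-- The sector condition for the operators `Y_{i,j}`. -/
lemma exists_sector : ∃ C : ℝ, 0 ≤ C ∧ ∀ F G : Config → ℝ, Tame F → Tame G → ∀ i j : ℤ,
    |∫ ω, F ω * M.Y i j G ω ∂M.gibbs| ≤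
      C * ((∫ ω, M.Y i j F ω ^ 2 ∂M.gibbs) + ∫ ω, M.Y i j G ω ^ 2 ∂M.gibbs) := by
  obtain ⟨C, hC, h⟩ := M.exists_sector_site
  refine ⟨C, hC, fun F G hF hG i j => ?_⟩
  have i1 := hF.integrable_mul_Y M hG i j
  have i2 := hF.integrable_Y_sq M i j
  have i3 := hG.integrable_Y_sq M i j
  have j1 := M.integrable_resample i j i1
  have j2 := M.integrable_resample i j i2
  have j3 := M.integrable_resample i j i3
  -- All three integrals are disintegrated over `(p_i, r_j)`; the one-site estimate then applies
  -- fibrewise, with a constant independent of the fibre and of `i, j`.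
  rw [M.integral_resample i j i1, M.integral_resample i j i2, M.integral_resample i j i3,
    ← integral_add j2.integral_prod_left j3.integral_prod_left, ← integral_const_mul]
  refine abs_integral_le_integral_abs.trans ?_
  refine integral_mono_ae j1.integral_prod_left.abs
    ((j2.integral_prod_left.add j3.integral_prod_left).const_mul C) ?_
  filter_upwards [j1.prod_right_ae, j2.prod_right_ae, j3.prod_right_ae] with ω k1 k2 k3
  simp only [Y_resample] at k1 k2 k3 ⊢
  exact h _ _ ((hF.smooth.contDiff_resample i j ω).of_le (by simp))
    ((hG.smooth.contDiff_resample i j ω).of_le (by simp)) k1 k2 k3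

/-! ### Moments -/

lemma measurePreserving_pair (i j : ℤ) :
    MeasurePreserving (fun ω : Config => ((ω i).1, (ω j).2)) M.gibbs M.siteMeasure := by
  refine MeasurePreserving.of_comp_eq (M.measurePreserving_resample i j) (by fun_prop)
    measurePreserving_snd ?_
  funext y
  simp [resample]

lemma integral_mom_mul_pos {f g : ℝ → ℝ} (hf : Continuous f) (hg : Continuous g) (i j : ℤ) :
    ∫ ω, f (ω i).1 * g (ω j).2 ∂M.gibbs = (∫ p, f p ∂M.momMeasure) * ∫ r, g r ∂M.posMeasure := by
  have h := M.measurePreserving_pair i j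
  rw [← integral_prod_mul, ← siteMeasure_eq_prod, ← h.map_eq,
    integral_map h.measurable.aemeasurable]
  exact (by fun_prop : Continuous fun z : ℝ × ℝ => f z.1 * g z.2).aestronglyMeasurable

lemma integral_mom_sq : ∫ p, p ^ 2 ∂M.momMeasure = M.β⁻¹ := by
  have h1 := ProbabilityTheory.variance_fun_id_gaussianReal (μ := 0) (v := M.β⁻¹.toNNReal)
  rw [ProbabilityTheory.variance_of_integral_eq_zero (by fun_prop) (by simp),
    Real.coe_toNNReal _ (inv_pos.2 M.β_pos).le] at h1
  exact h1

lemma Y_mom_mul_pos (i j : ℤ) :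
    M.Y i j (fun ω => (ω i).1 * (ω j).2) =
      fun ω => (ω i).1 ^ 2 - deriv M.V (ω j).2 * (ω j).2 := by
  funext ω
  rw [Y, dp_pair (fun p r => p * r), dr_pair (fun p r => p * r), if_pos rfl, if_pos rfl]
  have h1 : deriv (fun t : ℝ => (ω i).1 * t) (ω j).2 = (ω i).1 := by
    simp
  have h2 : deriv (fun t : ℝ => t * (ω j).2) (ω i).1 = (ω j).2 := by
    simp
  rw [h1, h2]
  ring

lemma tame_mom_mul_pos (i j : ℤ) : Tame fun ω => (ω i).1 * (ω j).2 :=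
  (Tame.mom i).mul (Tame.pos j)

lemma tame_mom_mul_deriv_V (i j : ℤ) : Tame fun ω => (ω i).1 * deriv M.V (ω j).2 :=
  (Tame.mom i).mul (Tame.deriv_V M j)

/-- The virial identity: `X_0 (p_0 r_0) = p_0² - V'(r_0) r_0` has mean zero, so `V'(r) r` has the
same mean as `p²`. -/
lemma integral_pos_mul_deriv_V : ∫ r, deriv M.V r * r ∂M.posMeasure = M.β⁻¹ := by
  have hc := M.differentiable_deriv_V.continuous
  have h := M.integral_Y (tame_mom_mul_pos 0 0) 0 0
  rw [Y_mom_mul_pos] at h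
  have i1 : Integrable (fun ω : Config => (ω 0).1 ^ 2) M.gibbs := by
    refine (((Tame.mom 0).mul (Tame.mom 0)).integrable M).congr (Eventually.of_forall fun ω => ?_)
    exact (sq _).symm
  have i2 := ((Tame.deriv_V M 0).mul (Tame.pos 0)).integrable M
  have h1 : ∫ ω : Config, ((ω 0).1 ^ 2 - deriv M.V (ω 0).2 * (ω 0).2) ∂M.gibbs =
      (∫ ω : Config, (ω 0).1 ^ 2 ∂M.gibbs) - ∫ ω : Config, deriv M.V (ω 0).2 * (ω 0).2 ∂M.gibbs :=
    integral_sub i1 i2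
  have h2 := M.integral_mom_mul_pos (f := fun p => p ^ 2) (g := fun _ => 1) (by fun_prop)
    (by fun_prop) 0 0
  have h3 := M.integral_mom_mul_pos (f := fun _ => 1) (g := fun r => deriv M.V r * r) (by fun_prop)
    (by fun_prop) 0 0
  simp only [mul_one, one_mul, integral_const, probReal_univ, smul_eq_mul] at h2 h3
  rw [M.integral_mom_sq] at h2
  rw [h1, h2, h3] at h
  linarith

lemma integral_gradient_current : ∫ ω : Config, (ω 0).1 * (ω 1).2 *
    ((ω 0).1 * deriv M.V (ω 1).2) ∂M.gibbs = M.β⁻¹ ^ 2 := by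
  have hc := M.differentiable_deriv_V.continuous
  have h := M.integral_mom_mul_pos (f := fun p => p ^ 2) (g := fun r => deriv M.V r * r)
    (by fun_prop) (by fun_prop) 0 1
  rw [M.integral_mom_sq, M.integral_pos_mul_deriv_V] at h
  rw [sq, ← h]
  refine integral_congr_ae (Eventually.of_forall fun ω => ?_)
  simp only
  ring

lemma integral_mom_pos_sq (j : ℤ) : ∫ ω : Config, ((ω 0).1 * (ω j).2) ^ 2 ∂M.gibbs =
    M.β⁻¹ * ∫ ω : Config, (ω 0).2 ^ 2 ∂M.gibbs := by
  have h1 := M.integral_mom_mul_pos (f := fun p => p ^ 2) (g := fun r => r ^ 2)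
    (by fun_prop) (by fun_prop) 0 j
  have h2 := M.integral_mom_mul_pos (f := fun _ => 1) (g := fun r => r ^ 2)
    (by fun_prop) (by fun_prop) 0 0
  simp only [one_mul, integral_const, probReal_univ, smul_eq_mul] at h2
  rw [h2, ← M.integral_mom_sq, ← h1]
  simp_rw [mul_pow]

end Integration

/-! ### The formal sums `Γ_F` -/

/-- `Y_{0,s} Γ_F`. -/
def gammaDeriv (M : EnergyChain) (s : ℤ) (F : Config → ℝ) : Config → ℝ := fun ω =>
  ∑ᶠ j : ℤ, M.Y 0 s (shift j F) ω

lemma XGamma_eq (M : EnergyChain) (F : Config → ℝ) : M.XGamma F = M.gammaDeriv 0 F := rfl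

lemma YGamma_eq (M : EnergyChain) (F : Config → ℝ) : M.YGamma F = M.gammaDeriv 1 F := rfl

/-- `J` contains all `k` for which `τ_k F` depends on site `0` or site `1`. -/
def IsWindow (M : EnergyChain) (F : Config → ℝ) (J : Finset ℤ) : Prop :=
  ∀ k ∉ J, M.Y 0 0 (shift k F) = 0 ∧ M.Y 0 1 (shift k F) = 0

/-- The finite sum `∑_{k ∈ J} τ_k F`. -/
def partialGamma (J : Finset ℤ) (F : Config → ℝ) : Config → ℝ := ∑ k ∈ J, shift k F

section Gamma

variable (M : EnergyChain) {F G : Config → ℝ} {J J' : Finset ℤ}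

lemma IsWindow.mono (h : M.IsWindow F J) (hJ : J ⊆ J') : M.IsWindow F J' :=
  fun k hk => h k fun h' => hk (hJ h')

lemma exists_isWindow (hF : IsSmoothLocal F) : ∃ J, M.IsWindow F J := by
  obtain ⟨Λ, hΛ⟩ := hF.exists_support
  classical
  -- If `F` lives on `Λ`, then `τ_k F` lives on `Λ + k`, which contains `0` or `1` only for `k ∈ -Λ`
  -- or `k ∈ 1 - Λ`.
  refine ⟨Λ.image (fun k => -k) ∪ Λ.image (fun k => 1 - k), fun k hk => ?_⟩
  have hs : ∀ ω ω' : Config, (∀ l ∈ Λ.image (· + k), ω l = ω' l) →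
      shift k F ω = shift k F ω' := by
    intro ω ω' h
    exact hΛ _ _ fun l hl => h _ (Finset.mem_image_of_mem _ hl)
  simp only [Finset.mem_union, Finset.mem_image, not_or, not_exists, not_and] at hk
  have h0 : (0 : ℤ) ∉ Λ.image (· + k) := by
    simp only [Finset.mem_image, not_exists, not_and]
    intro l hl h
    exact hk.1 l hl (by omega)
  have h1 : (1 : ℤ) ∉ Λ.image (· + k) := by
    simp only [Finset.mem_image, not_exists, not_and]
    intro l hl h
    exact hk.2 l hl (by omega)
  exact ⟨M.Y_eq_zero hs h0 h0, M.Y_eq_zero hs h0 h1⟩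

lemma IsWindow.Y_eq_zero (h : M.IsWindow F J) {s : ℤ} (hs : s = 0 ∨ s = 1) {k : ℤ} (hk : k ∉ J) :
    M.Y 0 s (shift k F) = 0 := by
  rcases hs with rfl | rfl
  · exact (h k hk).1
  · exact (h k hk).2

lemma Tame.partialGamma (hF : Tame F) (J : Finset ℤ) : Tame (partialGamma J F) :=
  Tame.sum J fun k _ => hF.shift k

lemma Y_partialGamma (hF : IsSmoothLocal F) (J : Finset ℤ) (i j : ℤ) :
    M.Y i j (partialGamma J F) = ∑ k ∈ J, M.Y i j (shift k F) :=
  (M.Y_sum J (fun k _ => hF.shift k) i j).1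

lemma gammaDeriv_eq (hF : IsSmoothLocal F) (h : M.IsWindow F J) {s : ℤ} (hs : s = 0 ∨ s = 1) :
    M.gammaDeriv s F = M.Y 0 s (partialGamma J F) := by
  rw [Y_partialGamma M hF]
  funext ω
  rw [gammaDeriv, Finset.sum_apply]
  refine finsum_eq_sum_of_support_subset _ fun k hk => ?_
  by_contra hkJ
  exact hk (congrFun (h.Y_eq_zero M hs hkJ) ω)

lemma gammaDeriv_add (hF : IsSmoothLocal F) (hG : IsSmoothLocal G) {s : ℤ} (hs : s = 0 ∨ s = 1) :
    M.gammaDeriv s (F + G) = M.gammaDeriv s F + M.gammaDeriv s G := by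
  classical
  obtain ⟨J1, h1⟩ := M.exists_isWindow hF
  obtain ⟨J2, h2⟩ := M.exists_isWindow hG
  obtain ⟨J3, h3⟩ := M.exists_isWindow (hF.add hG)
  have e1 := h1.mono M (J' := J1 ∪ J2 ∪ J3) (by intro x; simp; tauto)
  have e2 := h2.mono M (J' := J1 ∪ J2 ∪ J3) (by intro x; simp; tauto)
  have e3 := h3.mono M (J' := J1 ∪ J2 ∪ J3) (by intro x; simp; tauto)
  rw [M.gammaDeriv_eq hF e1 hs, M.gammaDeriv_eq hG e2 hs, M.gammaDeriv_eq (hF.add hG) e3 hs,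
    Y_partialGamma M hF, Y_partialGamma M hG, Y_partialGamma M (hF.add hG),
    ← Finset.sum_add_distrib]
  refine Finset.sum_congr rfl fun k _ => ?_
  exact M.Y_add (hF.shift k) (hG.shift k) 0 s

lemma gammaDeriv_smul (hF : IsSmoothLocal F) (c : ℝ) {s : ℤ} (hs : s = 0 ∨ s = 1) :
    M.gammaDeriv s (c • F) = c • M.gammaDeriv s F := by
  classical
  have hc : IsSmoothLocal (c • F) := by
    have h : c • F = (fun _ => c) * F := by funext ω; simp
    rw [h]; exact (IsSmoothLocal.const c).mul hF
  obtain ⟨J1, h1⟩ := M.exists_isWindow hF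
  obtain ⟨J2, h2⟩ := M.exists_isWindow hc
  rw [M.gammaDeriv_eq hF (h1.mono M Finset.subset_union_left) hs,
    M.gammaDeriv_eq hc (h2.mono M Finset.subset_union_right) hs,
    Y_partialGamma M hF, Y_partialGamma M hc, Finset.smul_sum]
  refine Finset.sum_congr rfl fun k _ => ?_
  exact M.Y_smul (hF.shift k) c 0 s

lemma memLp_gammaDeriv (hF : Tame F) {s : ℤ} (hs : s = 0 ∨ s = 1) :
    MemLp (M.gammaDeriv s F) 2 M.gibbs := by
  obtain ⟨J, h⟩ := M.exists_isWindow hF.smooth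
  rw [M.gammaDeriv_eq hF.smooth h hs]
  exact (hF.partialGamma J).memLp_Y M 0 s

/-- Enlarging the window does not change the pairing with a `Y_{0,s}`-derivative. -/
lemma integral_partialGamma_mul (hF : Tame F) (hG : Tame G) (h : M.IsWindow F J) (hJ : J ⊆ J')
    {s : ℤ} (hs : s = 0 ∨ s = 1) :
    ∫ ω, partialGamma J' F ω * M.Y 0 s G ω ∂M.gibbs =
      ∫ ω, partialGamma J F ω * M.Y 0 s G ω ∂M.gibbs := by
  -- After integrating by parts, the window enters only through `Y_{0,s}` of the partial sum, which
  -- is `Y_{0,s}Γ_F` for every window.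
  rw [M.integral_mul_Y (hF.partialGamma J') hG, M.integral_mul_Y (hF.partialGamma J) hG,
    ← M.gammaDeriv_eq hF.smooth h hs, ← M.gammaDeriv_eq hF.smooth (h.mono M hJ) hs]

end Gamma

end EnergyChain

end

noncomputable section

namespace EnergyChain

/-! ### Representation of fluctuations -/

/-- `(u, v)` represents `h`: the functional `(g, a) ↦ ≪g, h≫_* + a ≪h≫_**` is
`-⟨u, Y_{0,1} Γ_g + a p_0 V'(r_1)⟩ - ⟨v, X_0 Γ_g⟩`. -/
structure HasRep (M : EnergyChain) (h u v : Config → ℝ) : Prop where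
  memLp : MemLp h 2 M.gibbs
  memLp_fst : MemLp u 2 M.gibbs
  memLp_snd : MemLp v 2 M.gibbs
  star_finite : ∀ g ∈ M.testSpace,
    (Function.support fun i : ℤ => ∫ ω, g ω * shift i h ω ∂M.gibbs).Finite
  star_eq : ∀ g ∈ M.testSpace, M.starForm g h =
    -(∫ ω, u ω * M.YGamma g ω ∂M.gibbs) - ∫ ω, v ω * M.XGamma g ω ∂M.gibbs
  starStar_finite :
    (Function.support fun i : ℤ => (i : ℝ) * ∫ ω, h ω * M.energy i ω ∂M.gibbs).Finite
  starStar_eq : M.starStarForm h = -∫ ω, u ω * ((ω 0).1 * deriv M.V (ω 1).2) ∂M.gibbs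

lemma memLp_shift (M : EnergyChain) {h : Config → ℝ} (hh : MemLp h 2 M.gibbs) (i : ℤ) :
    MemLp (shift i h) 2 M.gibbs :=
  hh.comp_measurePreserving (M.measurePreserving_shift i)

lemma integral_add_mul {Ω : Type*} [MeasurableSpace Ω] {μ : Measure Ω} {u u' w : Ω → ℝ}
    (hu : MemLp u 2 μ) (hu' : MemLp u' 2 μ) (hw : MemLp w 2 μ) :
    ∫ ω, (u ω + u' ω) * w ω ∂μ = (∫ ω, u ω * w ω ∂μ) + ∫ ω, u' ω * w ω ∂μ := by
  simp_rw [add_mul]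
  exact integral_add (hu.integrable_mul hw) (hu'.integrable_mul hw)

section Rep

variable {M : EnergyChain} {h h' u u' v v' : Config → ℝ}

lemma tame_of_testSpace {g : Config → ℝ} (hg : g ∈ M.testSpace) : Tame g :=
  (tame_of_mem_testSpace hg).1

namespace HasRep

/-- A `finsum` is additive only for finite supports, which is why representations carry the support
conditions along with the identities. -/
lemma add (H : M.HasRep h u v) (H' : M.HasRep h' u' v') : M.HasRep (h + h') (u + u') (v + v') := by
  have hs : ∀ g ∈ M.testSpace, ∀ i, ∫ ω, g ω * shift i (h + h') ω ∂M.gibbs =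
      ∫ ω, g ω * shift i h ω ∂M.gibbs + ∫ ω, g ω * shift i h' ω ∂M.gibbs := by
    intro g hg i
    have := integral_add_mul (M.memLp_shift H.memLp i) (M.memLp_shift H'.memLp i)
      ((tame_of_testSpace hg).memLp M)
    simp only [mul_comm _ (g _)] at this
    exact this
  have hss : ∀ i : ℤ, (i : ℝ) * ∫ ω, (h + h') ω * M.energy i ω ∂M.gibbs =
      (i : ℝ) * ∫ ω, h ω * M.energy i ω ∂M.gibbs +
        (i : ℝ) * ∫ ω, h' ω * M.energy i ω ∂M.gibbs := by
    intro i
    rw [← mul_add]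
    exact congrArg _ (integral_add_mul H.memLp H'.memLp ((Tame.energy M i).memLp M))
  have hY : ∀ g ∈ M.testSpace, MemLp (M.YGamma g) 2 M.gibbs := fun g hg =>
    M.memLp_gammaDeriv (tame_of_testSpace hg) (Or.inr rfl)
  have hX : ∀ g ∈ M.testSpace, MemLp (M.XGamma g) 2 M.gibbs := fun g hg =>
    M.memLp_gammaDeriv (tame_of_testSpace hg) (Or.inl rfl)
  have hW := (M.tame_mom_mul_deriv_V 0 1).memLp M
  refine ⟨H.memLp.add H'.memLp, H.memLp_fst.add H'.memLp_fst, H.memLp_snd.add H'.memLp_snd,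
    fun g hg => ?_, fun g hg => ?_, ?_, ?_⟩
  · simp_rw [hs g hg]
    exact ((H.star_finite g hg).union (H'.star_finite g hg)).subset (Function.support_add _ _)
  · have e1 : M.starForm g (h + h') = M.starForm g h + M.starForm g h' := by
      unfold starForm
      simp_rw [hs g hg]
      exact finsum_add_distrib (H.star_finite g hg) (H'.star_finite g hg)
    rw [e1, H.star_eq g hg, H'.star_eq g hg]
    simp_rw [Pi.add_apply]
    rw [integral_add_mul H.memLp_fst H'.memLp_fst (hY g hg),
      integral_add_mul H.memLp_snd H'.memLp_snd (hX g hg)]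
    ring
  · simp_rw [hss]
    exact (H.starStar_finite.union H'.starStar_finite).subset (Function.support_add _ _)
  · have e1 : M.starStarForm (h + h') = M.starStarForm h + M.starStarForm h' := by
      unfold starStarForm
      simp_rw [hss]
      exact finsum_add_distrib H.starStar_finite H'.starStar_finite
    rw [e1, H.starStar_eq, H'.starStar_eq]
    simp_rw [Pi.add_apply]
    rw [integral_add_mul H.memLp_fst H'.memLp_fst hW]
    ring

lemma smul (H : M.HasRep h u v) (c : ℝ) : M.HasRep (c • h) (c • u) (c • v) := by
  have hs : ∀ g : Config → ℝ, ∀ i, ∫ ω, g ω * shift i (c • h) ω ∂M.gibbs =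
      c * ∫ ω, g ω * shift i h ω ∂M.gibbs := by
    intro g i
    rw [← integral_const_mul]
    refine integral_congr_ae (Eventually.of_forall fun ω => ?_)
    simp only [shift, Pi.smul_apply, smul_eq_mul]
    ring
  have hss : ∀ i : ℤ, (i : ℝ) * ∫ ω, (c • h) ω * M.energy i ω ∂M.gibbs =
      c * ((i : ℝ) * ∫ ω, h ω * M.energy i ω ∂M.gibbs) := by
    intro i
    rw [mul_left_comm, ← integral_const_mul c]
    congr 1
    refine integral_congr_ae (Eventually.of_forall fun ω => ?_)
    simp only [Pi.smul_apply, smul_eq_mul]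
    ring
  refine ⟨H.memLp.const_smul c, H.memLp_fst.const_smul c, H.memLp_snd.const_smul c,
    fun g hg => ?_, fun g hg => ?_, ?_, ?_⟩
  · simp_rw [hs g]
    exact (H.star_finite g hg).subset fun i hi h0 => hi (mul_eq_zero_of_right c h0)
  · have e1 : M.starForm g (c • h) = c * M.starForm g h := by
      unfold starForm
      simp_rw [hs g]
      exact (mul_finsum _ _).symm
    rw [e1, H.star_eq g hg]
    simp_rw [Pi.smul_apply, smul_eq_mul, mul_assoc, integral_const_mul]
    ring
  · simp_rw [hss]
    exact H.starStar_finite.subset fun i hi h0 => hi (mul_eq_zero_of_right c h0)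
  · have e1 : M.starStarForm (c • h) = c * M.starStarForm h := by
      unfold starStarForm
      simp_rw [hss]
      exact (mul_finsum _ _).symm
    rw [e1, H.starStar_eq]
    simp_rw [Pi.smul_apply, smul_eq_mul, mul_assoc, integral_const_mul]
    ring

lemma zero : M.HasRep 0 0 0 := by
  refine ⟨MemLp.zero, MemLp.zero, MemLp.zero, fun g _ => ?_, fun g _ => ?_, ?_, ?_⟩
  · simp [shift]
  · simp [starForm, shift]
  · simp
  · simp [starStarForm]

lemma sub (H : M.HasRep h u v) (H' : M.HasRep h' u' v') : M.HasRep (h - h') (u - u') (v - v') := by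
  have := H.add (H'.smul (-1))
  simpa [sub_eq_add_neg] using this

lemma sum {ι : Type*} (s : Finset ι) {h u v : ι → Config → ℝ}
    (H : ∀ i ∈ s, M.HasRep (h i) (u i) (v i)) :
    M.HasRep (∑ i ∈ s, h i) (∑ i ∈ s, u i) (∑ i ∈ s, v i) := by
  classical
  induction s using Finset.induction_on with
  | empty => simpa using zero
  | insert a s ha ih =>
    rw [Finset.sum_insert ha, Finset.sum_insert ha, Finset.sum_insert ha]
    exact (H a (Finset.mem_insert_self a s)).add
      (ih fun i hi => H i (Finset.mem_insert_of_mem hi))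

end HasRep

/-- The pairing of `g` with the translates of `Y_{i,i+s} F`. -/
lemma integral_mul_shift_Y {F g : Config → ℝ} (hF : Tame F) (hg : Tame g) (i s k : ℤ) :
    ∫ ω, g ω * shift k (M.Y i (i + s) F) ω ∂M.gibbs =
      -∫ ω, shift (-i) F ω * M.Y 0 s (shift (-(i + k)) g) ω ∂M.gibbs := by
  have h1 : shift k (M.Y i (i + s) F) = M.Y (i + k) (i + k + s) (shift k F) := by
    rw [Y_shift]
    congr 2 <;> ring
  rw [h1, M.integral_mul_Y hg (hF.shift k), ← M.integral_shift (-(i + k))]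
  congr 1
  refine integral_congr_ae (Eventually.of_forall fun ω => ?_)
  have h2 : shift (-(i + k)) (M.Y (i + k) (i + k + s) g) = M.Y 0 s (shift (-(i + k)) g) := by
    rw [Y_shift]
    congr 2 <;> ring
  have h3 : shift (-i) F = shift (-(i + k)) (shift k F) := by
    rw [shift_shift]
    congr 1
    ring
  simp only
  rw [← h2, h3]
  simp only [shift]
  ring

/-- Moving the vector field onto `g` by antisymmetry and translating site `i` to the origin turns
the sum over translates of `Y_{i,i+s} F` into `Y_{0,s}` of the sum of translates of `g`. -/
lemma star_Y {F g : Config → ℝ} (hF : Tame F) (hg : Tame g) (i : ℤ) {s : ℤ} (hs : s = 0 ∨ s = 1) :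
    (Function.support fun k : ℤ => ∫ ω, g ω * shift k (M.Y i (i + s) F) ω ∂M.gibbs).Finite ∧
    M.starForm g (M.Y i (i + s) F) =
      -∫ ω, shift (-i) F ω * M.gammaDeriv s g ω ∂M.gibbs := by
  obtain ⟨J, hJ⟩ := M.exists_isWindow hg.smooth
  -- Reindexing by `m = -(i + k)`, the translate of `g` left after site `i + k` is moved to the
  -- origin.
  let e : ℤ ≃ ℤ := (Equiv.addLeft i).trans (Equiv.neg ℤ)
  have he : ∀ k, e k = -(i + k) := fun k => rfl
  set f : ℤ → ℝ := fun m => -∫ ω, shift (-i) F ω * M.Y 0 s (shift m g) ω ∂M.gibbs with hf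
  have hsupp : Function.support f ⊆ J := by
    intro m hm
    by_contra hmJ
    refine hm ?_
    simp only [hf, hJ.Y_eq_zero M hs hmJ]
    simp
  have hcomp : (fun k : ℤ => ∫ ω, g ω * shift k (M.Y i (i + s) F) ω ∂M.gibbs) = f ∘ e :=
    funext fun k => integral_mul_shift_Y hF hg i s k
  constructor
  · rw [hcomp, Function.support_comp_eq_preimage]
    exact (J.finite_toSet.subset hsupp).preimage e.injective.injOn
  · have h1 : M.starForm g (M.Y i (i + s) F) = ∑ᶠ k, f (e k) := by
      unfold starForm
      exact congrArg finsum hcomp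
    rw [h1, finsum_comp_equiv e, finsum_eq_sum_of_support_subset f hsupp, hf,
      Finset.sum_neg_distrib, ← integral_finsetSum]
    · rw [M.gammaDeriv_eq hg.smooth hJ hs, M.Y_partialGamma hg.smooth]
      simp_rw [Finset.sum_apply, Finset.mul_sum]
    · intro m _
      exact (hF.shift (-i)).integrable_mul_Y M (hg.shift m) 0 s

lemma Y_energy (i j m : ℤ) : M.Y i j (M.energy m) = fun ω =>
    ((if j = m then 1 else 0) - if i = m then 1 else 0) * ((ω i).1 * deriv M.V (ω j).2) := by
  funext ω
  have h2 : deriv (fun t : ℝ => t ^ 2 / 2 + M.V (ω m).2) (ω m).1 = (ω m).1 := by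
    simp
  have h3 : deriv (fun t : ℝ => (ω m).1 ^ 2 / 2 + M.V t) (ω m).2 = deriv M.V (ω m).2 := by
    simp
  have h4 := dp_pair (fun p r => p ^ 2 / 2 + M.V r) m m i ω
  have h5 := dr_pair (fun p r => p ^ 2 / 2 + M.V r) m m j ω
  rw [h2] at h4
  rw [h3] at h5
  unfold energy Y
  rw [h4, h5]
  by_cases hi : i = m <;> by_cases hj : j = m
  all_goals simp [hi, hj]
  all_goals ring

/-- The field `Y_{i,i+s}` exchanges energy only between sites `i` and `i+s`, so just two terms
survive. Their position weights differ by `s`; hence the `X_i` do not contribute and the `Y_{i,i+1}`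
contribute one unit of transport. -/
lemma starStar_Y {F : Config → ℝ} (hF : Tame F) (i s : ℤ) :
    (Function.support fun m : ℤ => (m : ℝ) *
      ∫ ω, M.Y i (i + s) F ω * M.energy m ω ∂M.gibbs).Finite ∧
    M.starStarForm (M.Y i (i + s) F) =
      -(s * ∫ ω, shift (-i) F ω * ((ω 0).1 * deriv M.V (ω s).2) ∂M.gibbs) := by
  classical
  set c := ∫ ω, F ω * ((ω i).1 * deriv M.V (ω (i + s)).2) ∂M.gibbs with hc
  have h1 : ∀ m : ℤ, (m : ℝ) * ∫ ω, M.Y i (i + s) F ω * M.energy m ω ∂M.gibbs =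
      (if m = i then (i : ℝ) * c else 0) - if m = i + s then ((i : ℝ) + s) * c else 0 := by
    intro m
    have h2 := M.integral_mul_Y hF (Tame.energy M m) i (i + s)
    rw [Y_energy] at h2
    have h3 : ∫ ω, F ω * (((if i + s = m then 1 else 0) - if i = m then 1 else 0) *
        ((ω i).1 * deriv M.V (ω (i + s)).2)) ∂M.gibbs =
        ((if i + s = m then 1 else 0) - if i = m then 1 else 0) * c := by
      rw [hc, ← integral_const_mul]
      refine integral_congr_ae (Eventually.of_forall fun ω => ?_)
      simp only
      ring
    rw [h3] at h2
    have h4 : ∫ ω, M.Y i (i + s) F ω * M.energy m ω ∂M.gibbs =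
        -(((if i + s = m then 1 else 0) - if i = m then 1 else 0) * c) := by linarith
    rw [h4]
    by_cases hi : m = i <;> by_cases hj : m = i + s
    · rw [if_pos hi, if_pos hj, if_pos hj.symm, if_pos hi.symm]
      have : s = 0 := by omega
      subst this
      simp
    · rw [if_pos hi, if_neg hj, if_neg (Ne.symm hj), if_pos hi.symm, hi]
      ring
    · rw [if_neg hi, if_pos hj, if_pos hj.symm, if_neg (Ne.symm hi), hj]
      push_cast
      ring
    · rw [if_neg hi, if_neg hj, if_neg (Ne.symm hj), if_neg (Ne.symm hi)]
      ring
  have hs1 : (Function.support fun m : ℤ => if m = i then (i : ℝ) * c else 0).Finite :=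
    (Set.finite_singleton i).subset fun m hm => by
      by_contra h; exact hm (if_neg h)
  have hs2 : (Function.support fun m : ℤ => if m = i + s then ((i : ℝ) + s) * c else 0).Finite :=
    (Set.finite_singleton (i + s)).subset fun m hm => by
      by_contra h; exact hm (if_neg h)
  simp_rw [starStarForm, h1]
  refine ⟨(hs1.union hs2).subset (Function.support_sub _ _), ?_⟩
  rw [finsum_sub_distrib hs1 hs2, finsum_eq_single _ i (fun m hm => if_neg hm),
    finsum_eq_single _ (i + s) (fun m hm => if_neg hm), if_pos rfl, if_pos rfl]
  have h5 : c = ∫ ω, shift (-i) F ω * ((ω 0).1 * deriv M.V (ω s).2) ∂M.gibbs := by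
    rw [hc, ← M.integral_shift (-i)]
    refine integral_congr_ae (Eventually.of_forall fun ω => ?_)
    simp only [shift, add_neg_cancel, show i + s + -i = s by ring]
  rw [← h5]
  ring

lemma HasRep.X {F : Config → ℝ} (hF : Tame F) (i : ℤ) :
    M.HasRep (M.X i F) 0 (shift (-i) F) := by
  have h0 : M.X i F = M.Y i (i + 0) F := by rw [add_zero]; rfl
  rw [h0]
  refine ⟨hF.memLp_Y M _ _, MemLp.zero, (hF.shift _).memLp M,
    fun g hg => (star_Y hF (tame_of_testSpace hg) i (Or.inl rfl)).1,
    fun g hg => ?_, (starStar_Y hF i 0).1, ?_⟩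
  · rw [(star_Y hF (tame_of_testSpace hg) i (Or.inl rfl)).2, XGamma_eq]
    simp
  · rw [(starStar_Y hF i 0).2]
    simp

lemma HasRep.Y {F : Config → ℝ} (hF : Tame F) (i : ℤ) :
    M.HasRep (M.Y i (i + 1) F) (shift (-i) F) 0 := by
  refine ⟨hF.memLp_Y M _ _, (hF.shift _).memLp M, MemLp.zero,
    fun g hg => (star_Y hF (tame_of_testSpace hg) i (Or.inr rfl)).1,
    fun g hg => ?_, (starStar_Y hF i 1).1, ?_⟩
  · rw [(star_Y hF (tame_of_testSpace hg) i (Or.inr rfl)).2, YGamma_eq]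
    simp
  · rw [(starStar_Y hF i 1).2]
    simp

lemma Y_mom_mul_deriv_V : M.Y 0 1 (fun ω => (ω 0).1 * deriv M.V (ω 1).2) = fun ω =>
    (ω 0).1 ^ 2 * deriv (deriv M.V) (ω 1).2 - deriv M.V (ω 1).2 ^ 2 := by
  funext ω
  rw [EnergyChain.Y, dp_pair (fun p r => p * deriv M.V r), dr_pair (fun p r => p * deriv M.V r),
    if_pos rfl, if_pos rfl]
  have h1 : deriv (fun t : ℝ => (ω 0).1 * deriv M.V t) (ω 1).2 =
      (ω 0).1 * deriv (deriv M.V) (ω 1).2 := ((M.hasDerivAt_deriv_V _).const_mul _).deriv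
  have h2 : deriv (fun t : ℝ => t * deriv M.V (ω 1).2) (ω 0).1 = deriv M.V (ω 1).2 := by simp
  rw [h1, h2]
  ring

/-- The Hamiltonian current is `-Y_{0,1} ℰ_1`, and the noise current is `γ/2` times `Y_{0,1}`
applied once more to `Y_{0,1} ℰ_1 = p_0 V'(r_1)`. -/
lemma current_eq : M.current = M.Y 0 1 ((M.γ / 2) •
    (fun ω => (ω 0).1 * deriv M.V (ω 1).2) - M.energy 1) := by
  rw [sub_eq_add_neg, ← neg_one_smul ℝ (M.energy 1)]
  have h1 : IsSmoothLocal (fun ω => (ω 0).1 * deriv M.V (ω 1).2) :=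
    (M.tame_mom_mul_deriv_V 0 1).smooth
  rw [M.Y_add ((M.tame_mom_mul_deriv_V 0 1).smul _).smooth ((Tame.energy M 1).smul _).smooth,
    M.Y_smul h1, M.Y_smul (Tame.energy M 1).smooth, Y_energy, Y_mom_mul_deriv_V]
  funext ω
  simp [current]
  ring

/-- Both `p_1²` and `p_0²` are compared with the common quantity `V'(r_1) r_1`, through the virial
functions `p_1 r_1` and `p_0 r_1`. -/
lemma gradient_eq : gradient = M.X 1 (fun ω => (ω 1).1 * (ω 1).2) +
    M.Y 0 1 (-fun ω => (ω 0).1 * (ω 1).2) := by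
  rw [← neg_one_smul ℝ (fun ω : Config => (ω 0).1 * (ω 1).2),
    M.Y_smul (tame_mom_mul_pos 0 1).smooth]
  have h : M.X 1 (fun ω => (ω 1).1 * (ω 1).2) = M.Y 1 1 (fun ω => (ω 1).1 * (ω 1).2) := rfl
  rw [h, M.Y_mom_mul_pos, M.Y_mom_mul_pos]
  funext ω
  simp [gradient]

lemma hasRep_current : M.HasRep M.current ((M.γ / 2) •
    (fun ω => (ω 0).1 * deriv M.V (ω 1).2) - M.energy 1) 0 := by
  have h := HasRep.Y (M := M) (((M.tame_mom_mul_deriv_V 0 1).smul (M.γ / 2)).sub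
    (Tame.energy M 1)) 0
  rw [neg_zero, shift_zero, zero_add, ← current_eq] at h
  exact h

lemma hasRep_gradient : M.HasRep gradient (-fun ω => (ω 0).1 * (ω 1).2)
    (fun ω => (ω 0).1 * (ω 0).2) := by
  have h1 := HasRep.X (M := M) (tame_mom_mul_pos 1 1) 1
  have h2 := HasRep.Y (M := M) (tame_mom_mul_pos 0 1).neg 0
  have h := h1.add h2
  rw [zero_add 1, ← gradient_eq, neg_zero, shift_zero, zero_add, add_zero] at h
  exact h

lemma mem_fluctSpace (κ : ℝ) : M.current + κ • gradient ∈ M.fluctSpace := by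
  set G0 : Config → ℝ := ((M.γ / 2) • (fun ω => (ω 0).1 * deriv M.V (ω 1).2) - M.energy 1) +
    κ • (-fun ω => (ω 0).1 * (ω 1).2) with hG0
  have t1 : Tame ((M.γ / 2) • (fun ω => (ω 0).1 * deriv M.V (ω 1).2) - M.energy 1) :=
    ((M.tame_mom_mul_deriv_V 0 1).smul (M.γ / 2)).sub (Tame.energy M 1)
  have t2 : Tame (-fun ω => (ω 0).1 * (ω 1).2) := (tame_mom_mul_pos 0 1).neg
  have t3 : Tame G0 := t1.add (t2.smul κ)
  have t4 : Tame (κ • fun ω => (ω 1).1 * (ω 1).2) := (tame_mom_mul_pos 1 1).smul κ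
  refine ⟨{0, 1}, fun i => if i = 1 then κ • fun ω => (ω 1).1 * (ω 1).2 else fun _ => 0,
    fun i => if i = 0 then G0 else fun _ => 0, ?_, ?_⟩
  · intro i _
    refine ⟨?_, ?_⟩
    · dsimp only
      split_ifs
      · exact t4.mem_smoothL2 M
      · exact (Tame.const 0).mem_smoothL2 M
    · dsimp only
      split_ifs
      · exact t3.mem_smoothL2 M
      · exact (Tame.const 0).mem_smoothL2 M
  · rw [Finset.sum_pair (by norm_num)]
    have z1 : M.X 0 (fun _ => 0) = 0 := M.Y_const 0 0 0
    have z2 : M.Y 1 (1 + 1) (fun _ => 0) = 0 := M.Y_const 0 1 _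
    have z3 : M.X 1 (κ • fun ω => (ω 1).1 * (ω 1).2) =
        κ • M.X 1 (fun ω => (ω 1).1 * (ω 1).2) := M.Y_smul (tame_mom_mul_pos 1 1).smooth κ 1 1
    simp only [if_pos, zero_ne_one, one_ne_zero, if_false]
    rw [z1, z2, z3, zero_add, add_zero, zero_add, hG0, M.Y_add t1.smooth (t2.smul κ).smooth,
      M.Y_smul t2.smooth, ← current_eq, gradient_eq (M := M), smul_add]
    abel

/-- The generator on test functions as an element of the space of fluctuations. -/
lemma hasRep_L {F : Config → ℝ} (hF : F ∈ M.testSpace) {J : Finset ℤ} (hJ : M.IsWindow F J) :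
    M.HasRep (M.L F) ((M.γ / 2) • M.YGamma F - partialGamma J F)
      ((M.γ / 2) • M.XGamma F + partialGamma J F) := by
  obtain ⟨hT, hp, hr⟩ := tame_of_mem_testSpace hF
  have hX : ∀ i, Tame (M.X i F) := fun i => Tame.Y M hp hr i i
  have hY : ∀ i, Tame (M.Y i (i + 1) F) := fun i => Tame.Y M hp hr i (i + 1)
  have sX : ∀ i, M.Y 0 0 (shift (-i) F) = shift (-i) (M.X i F) := by
    intro i; rw [Y_shift]; simp [EnergyChain.X]
  have sY : ∀ i, M.Y 0 1 (shift (-i) F) = shift (-i) (M.Y i (i + 1) F) := by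
    intro i; rw [Y_shift]; simp [add_comm]
  have inj : ∀ i (G : Config → ℝ), shift (-i) G = 0 → G = 0 := by
    intro i G h
    have : shift i (shift (-i) G) = 0 := by rw [h]; rfl
    rwa [shift_shift, add_neg_cancel, shift_zero] at this
  -- The sign flips because `Y_{i,i+s} F` is a translate of `Y_{0,s} τ_{-i} F`.
  set I : Finset ℤ := J.map (Equiv.neg ℤ).toEmbedding with hI
  have hIX : ∀ i ∉ I, M.X i F = 0 ∧ M.Y i (i + 1) F = 0 := by
    intro i hi
    have : -i ∉ J := by
      intro h
      exact hi (Finset.mem_map.2 ⟨-i, h, neg_neg i⟩)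
    have := hJ _ this
    rw [sX, sY] at this
    exact ⟨inj i _ this.1, inj i _ this.2⟩
  -- Each summand of `L` is itself a vector field applied to a tame function: `(γ/2) X_i² + X_i` and
  -- `(γ/2) Y² - Y` are factored from the left, so the representations of `X_i` and `Y_{i,i+1}`
  -- apply termwise.
  have hL : M.L F = ∑ i ∈ I, (M.X i ((M.γ / 2) • M.X i F + F) +
      M.Y i (i + 1) ((M.γ / 2) • M.Y i (i + 1) F - F)) := by
    funext ω
    rw [L, Pi.add_apply, S, A, Finset.sum_apply,
      finsum_eq_sum_of_support_subset (s := I), finsum_eq_sum_of_support_subset (s := I),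
      Finset.mul_sum, ← Finset.sum_add_distrib]
    · refine Finset.sum_congr rfl fun i _ => ?_
      have e1 : M.X i ((M.γ / 2) • M.X i F + F) = (M.γ / 2) • M.X i (M.X i F) + M.X i F :=
        (M.Y_add ((hX i).smul _).smooth hT.smooth i i).trans
          (congrArg (· + M.X i F) (M.Y_smul (hX i).smooth _ i i))
      have e2 : M.Y i (i + 1) ((M.γ / 2) • M.Y i (i + 1) F - F) =
          (M.γ / 2) • M.Y i (i + 1) (M.Y i (i + 1) F) - M.Y i (i + 1) F := by
        rw [sub_eq_add_neg, ← neg_one_smul ℝ F, M.Y_add ((hY i).smul _).smooth (hT.smul _).smooth,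
          M.Y_smul (hY i).smooth, M.Y_smul hT.smooth, neg_one_smul, ← sub_eq_add_neg]
      rw [e1, e2]
      simp only [Pi.add_apply, Pi.sub_apply, Pi.smul_apply, smul_eq_mul]
      ring
    · intro i hi
      by_contra h
      refine hi ?_
      dsimp only
      rw [(hIX i h).1, (hIX i h).2]
      simp
    · intro i hi
      by_contra h
      refine hi ?_
      dsimp only
      rw [(hIX i h).1, (hIX i h).2]
      have z1 : M.X i 0 = 0 := M.Y_const 0 i i
      have z2 : M.Y i (i + 1) 0 = 0 := M.Y_const 0 i (i + 1)
      rw [z1, z2]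
      simp
  have hrep := HasRep.sum I fun i (_ : i ∈ I) =>
    (HasRep.X (M := M) (((hX i).smul (M.γ / 2)).add hT) i).add
      (HasRep.Y (((hY i).smul (M.γ / 2)).sub hT) i)
  rw [← hL] at hrep
  have hu : ∑ i ∈ I, (0 + shift (-i) ((M.γ / 2) • M.Y i (i + 1) F - F)) =
      (M.γ / 2) • M.YGamma F - partialGamma J F := by
    rw [YGamma_eq, M.gammaDeriv_eq hT.smooth hJ (Or.inr rfl), M.Y_partialGamma hT.smooth,
      partialGamma, Finset.smul_sum, ← Finset.sum_sub_distrib, hI, Finset.sum_map]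
    refine Finset.sum_congr rfl fun k _ => ?_
    have := sY (-k)
    rw [neg_neg] at this
    rw [zero_add, this]
    funext ω
    simp [shift]
  have hv : ∑ i ∈ I, (shift (-i) ((M.γ / 2) • M.X i F + F) + 0) =
      (M.γ / 2) • M.XGamma F + partialGamma J F := by
    rw [XGamma_eq, M.gammaDeriv_eq hT.smooth hJ (Or.inl rfl), M.Y_partialGamma hT.smooth,
      partialGamma, Finset.smul_sum, ← Finset.sum_add_distrib, hI, Finset.sum_map]
    refine Finset.sum_congr rfl fun k _ => ?_
    have := sX (-k)
    rw [neg_neg] at this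
    rw [add_zero, this]
    funext ω
    simp [shift]
  rw [hu, hv] at hrep
  exact hrep

/-- Telescoping sums over `ℤ`. -/
lemma finsum_telescope {a : ℤ → ℝ} {c : ℝ} {Λ : Finset ℤ} (ha : ∀ k ∉ Λ, a k = c) :
    ∑ᶠ k : ℤ, (a (1 + k) - a k) = 0 := by
  -- Subtracting the constant value at infinity makes both shifted sums finite, so they can be
  -- separated and reindexed.
  set b : ℤ → ℝ := fun k => a k - c with hb
  have hfin : (Function.support b).Finite := by
    refine Λ.finite_toSet.subset fun k hk => ?_
    by_contra h
    exact hk (by simp only [hb, ha k h, sub_self])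
  have hfin' : (Function.support fun k => b (1 + k)).Finite :=
    hfin.preimage (Equiv.addLeft (1 : ℤ)).injective.injOn
  have h1 : ∀ k, a (1 + k) - a k = b (1 + k) - b k := fun k => by simp only [hb]; ring
  simp_rw [h1]
  rw [finsum_sub_distrib hfin' hfin, sub_eq_zero]
  exact finsum_comp_equiv (Equiv.addLeft (1 : ℤ)) (f := b)

/-- With `a_k = ⟨g p_k²⟩` the sum is `∑_k (a_{k+1} - a_k)`, and by independence `a_k` is constant
for `k` outside the sites of `g`. -/
lemma starForm_gradient {g : Config → ℝ} (hg : g ∈ M.testSpace) : M.starForm g gradient = 0 := by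
  have hT := tame_of_testSpace hg
  obtain ⟨Λ, hΛ⟩ := hT.smooth.exists_support
  have hi : ∀ k : ℤ, Integrable (fun ω => g ω * (ω k).1 ^ 2) M.gibbs := by
    intro k
    refine ((hT.mul ((Tame.mom k).mul (Tame.mom k))).integrable M).congr
      (Eventually.of_forall fun ω => ?_)
    simp only [Pi.mul_apply, sq]
  set a : ℤ → ℝ := fun k => ∫ ω, g ω * (ω k).1 ^ 2 ∂M.gibbs with ha
  have h1 : ∀ k, ∫ ω, g ω * shift k gradient ω ∂M.gibbs = a (1 + k) - a k := by
    intro k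
    simp only [ha]
    rw [← integral_sub (hi _) (hi _)]
    refine integral_congr_ae (Eventually.of_forall fun ω => ?_)
    simp only [shift, gradient, zero_add]
    ring
  unfold starForm
  simp_rw [h1]
  refine finsum_telescope (c := (∫ ω, g ω ∂M.gibbs) * ∫ x, x.1 ^ 2 ∂M.siteMeasure) (Λ := Λ)
    fun k hk => ?_
  simp only [ha]
  rw [M.integral_resample k k (hi k), ← integral_mul_const]
  refine integral_congr_ae (Eventually.of_forall fun ω => ?_)
  simp only
  rw [← integral_const_mul]
  refine integral_congr_ae (Eventually.of_forall fun x => ?_)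
  have h2 : g (resample k k ω x) = g ω := by
    refine hΛ _ _ fun l hl => ?_
    have : l ≠ k := by rintro rfl; exact hk hl
    simp [resample, this]
  simp only [h2]
  simp [resample]

end Rep

end EnergyChain

end

noncomputable section

namespace EnergyChain

/-! ### The Hilbert space of pairs of square integrable functions -/

/-- Pairs of square integrable functions. -/
abbrev PairSpace (M : EnergyChain) : Type := WithLp 2 (Lp ℝ 2 M.gibbs × Lp ℝ 2 M.gibbs)

/-- The pair `(u, v)` in `L² × L²`. -/
def pair (M : EnergyChain) {u v : Config → ℝ} (hu : MemLp u 2 M.gibbs) (hv : MemLp v 2 M.gibbs) :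
    M.PairSpace := WithLp.toLp 2 (hu.toLp u, hv.toLp v)

section Final

variable (M : EnergyChain) {u v u' v' : Config → ℝ}

lemma pair_congr (hu : MemLp u 2 M.gibbs) (hv : MemLp v 2 M.gibbs) (hu' : MemLp u' 2 M.gibbs)
    (hv' : MemLp v' 2 M.gibbs) (h1 : u = u') (h2 : v = v') : M.pair hu hv = M.pair hu' hv' := by
  subst h1; subst h2; rfl

lemma pair_add (hu : MemLp u 2 M.gibbs) (hv : MemLp v 2 M.gibbs) (hu' : MemLp u' 2 M.gibbs)
    (hv' : MemLp v' 2 M.gibbs) :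
    M.pair hu hv + M.pair hu' hv' = M.pair (hu.add hu') (hv.add hv') := rfl

lemma pair_sub (hu : MemLp u 2 M.gibbs) (hv : MemLp v 2 M.gibbs) (hu' : MemLp u' 2 M.gibbs)
    (hv' : MemLp v' 2 M.gibbs) :
    M.pair hu hv - M.pair hu' hv' = M.pair (hu.sub hu') (hv.sub hv') := rfl

lemma pair_smul (c : ℝ) (hu : MemLp u 2 M.gibbs) (hv : MemLp v 2 M.gibbs) :
    c • M.pair hu hv = M.pair (hu.const_smul c) (hv.const_smul c) := rfl

lemma inner_toLp (hu : MemLp u 2 M.gibbs) (hv : MemLp v 2 M.gibbs) :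
    inner ℝ (hu.toLp u) (hv.toLp v) = ∫ ω, u ω * v ω ∂M.gibbs := by
  rw [L2.inner_def]
  refine integral_congr_ae ?_
  filter_upwards [hu.coeFn_toLp, hv.coeFn_toLp] with ω h1 h2
  rw [h1, h2, real_inner_eq_re_inner ℝ]
  simp [mul_comm]

lemma inner_pair (hu : MemLp u 2 M.gibbs) (hv : MemLp v 2 M.gibbs) (hu' : MemLp u' 2 M.gibbs)
    (hv' : MemLp v' 2 M.gibbs) : inner ℝ (M.pair hu hv) (M.pair hu' hv') =
      (∫ ω, u ω * u' ω ∂M.gibbs) + ∫ ω, v ω * v' ω ∂M.gibbs := by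
  rw [WithLp.prod_inner_apply, ← inner_toLp M hu hu', ← inner_toLp M hv hv']
  rfl

lemma norm_pair_sq (hu : MemLp u 2 M.gibbs) (hv : MemLp v 2 M.gibbs) : ‖M.pair hu hv‖ ^ 2 =
      (∫ ω, u ω ^ 2 ∂M.gibbs) + ∫ ω, v ω ^ 2 ∂M.gibbs := by
  rw [← real_inner_self_eq_norm_sq, inner_pair]
  simp_rw [sq]

lemma memLp_YGamma (g : M.testSpace) : MemLp (M.YGamma g) 2 M.gibbs :=
  M.memLp_gammaDeriv (tame_of_testSpace g.2) (Or.inr rfl)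

lemma memLp_XGamma (g : M.testSpace) : MemLp (M.XGamma g) 2 M.gibbs :=
  M.memLp_gammaDeriv (tame_of_testSpace g.2) (Or.inl rfl)

/-- The pair `(Y_{0,1} Γ_g, X_0 Γ_g)`. -/
def gammaMap : M.testSpace →ₗ[ℝ] M.PairSpace where
  toFun g := M.pair (M.memLp_YGamma g) (M.memLp_XGamma g)
  map_add' f g := by
    rw [pair_add]
    exact M.pair_congr _ _ _ _
      (M.gammaDeriv_add (tame_of_testSpace f.2).smooth (tame_of_testSpace g.2).smooth (Or.inr rfl))
      (M.gammaDeriv_add (tame_of_testSpace f.2).smooth (tame_of_testSpace g.2).smooth (Or.inl rfl))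
  map_smul' c f := by
    rw [RingHom.id_apply, pair_smul]
    exact M.pair_congr _ _ _ _
      (M.gammaDeriv_smul (tame_of_testSpace f.2).smooth c (Or.inr rfl))
      (M.gammaDeriv_smul (tame_of_testSpace f.2).smooth c (Or.inl rfl))

/-! ### The antisymmetric part and the pairings required by `FDData`. -/

/-- A window for the test function `f`. -/
def window (f : M.testSpace) : Finset ℤ :=
  (M.exists_isWindow (tame_of_testSpace f.2).smooth).choose

lemma isWindow_window (f : M.testSpace) : M.IsWindow f (M.window f) :=
  (M.exists_isWindow (tame_of_testSpace f.2).smooth).choose_spec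

lemma memLp_partialGamma (f : M.testSpace) (J : Finset ℤ) :
    MemLp (partialGamma J (f : Config → ℝ)) 2 M.gibbs :=
  ((tame_of_testSpace f.2).partialGamma J).memLp M

/-- The pair representing `A f`. -/
def antiMap (f : M.testSpace) : M.PairSpace :=
  M.pair (M.memLp_partialGamma f (M.window f)).neg (M.memLp_partialGamma f (M.window f))

lemma memLp_mom_mul_deriv_V : MemLp (fun ω : Config => (ω 0).1 * deriv M.V (ω 1).2) 2 M.gibbs :=
  (M.tame_mom_mul_deriv_V 0 1).memLp M

lemma memLp_mom_mul_pos (j : ℤ) : MemLp (fun ω : Config => (ω 0).1 * (ω j).2) 2 M.gibbs :=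
  (tame_mom_mul_pos 0 j).memLp M

/-- The pair representing the symmetric part of the current, up to the factor `γ / 2`. -/
def symCurrent : M.PairSpace := M.pair M.memLp_mom_mul_deriv_V MemLp.zero

/-- The pair representing the antisymmetric part of the current. -/
def antiCurrent : M.PairSpace := M.pair ((Tame.energy M 1).memLp M).neg MemLp.zero

/-- The pair representing `p_1² - p_0²`. -/
def gradPair : M.PairSpace := M.pair (M.memLp_mom_mul_pos 1).neg (M.memLp_mom_mul_pos 0)

lemma Y_energy_one : M.Y 0 1 (M.energy 1) = fun ω => (ω 0).1 * deriv M.V (ω 1).2 := by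
  rw [Y_energy]
  simp

/-- The window chosen for `f` is arbitrary, so `antiMap` is not itself linear. Pairings with
`gammaMap` do not depend on the window, and this formula lets several test functions share a common
one. -/
lemma inner_antiMap {f g : M.testSpace} {J J' : Finset ℤ} (hJ : M.window f ⊆ J)
    (hJ' : M.IsWindow g J') :
    inner ℝ (M.antiMap f) (M.gammaMap g) =
      (∫ ω, partialGamma J (f : Config → ℝ) ω * M.Y 0 0 (partialGamma J' g) ω ∂M.gibbs) -
        ∫ ω, partialGamma J (f : Config → ℝ) ω * M.Y 0 1 (partialGamma J' g) ω ∂M.gibbs := by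
  have hf := tame_of_testSpace f.2
  have hg := tame_of_testSpace g.2
  have h1 : inner ℝ (M.antiMap f) (M.gammaMap g) =
      (∫ ω, (-partialGamma (M.window f) (f : Config → ℝ)) ω * M.YGamma g ω ∂M.gibbs) +
        ∫ ω, partialGamma (M.window f) (f : Config → ℝ) ω * M.XGamma g ω ∂M.gibbs :=
    M.inner_pair _ _ _ _
  rw [h1, XGamma_eq, YGamma_eq, M.gammaDeriv_eq hg.smooth hJ' (Or.inl rfl),
    M.gammaDeriv_eq hg.smooth hJ' (Or.inr rfl),
    M.integral_partialGamma_mul hf (hg.partialGamma J') (M.isWindow_window f) hJ (Or.inl rfl),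
    M.integral_partialGamma_mul hf (hg.partialGamma J') (M.isWindow_window f) hJ (Or.inr rfl)]
  simp_rw [Pi.neg_apply, neg_mul]
  rw [integral_neg]
  ring

lemma inner_antiMap_add (f f' g : M.testSpace) :
    inner ℝ (M.antiMap (f + f')) (M.gammaMap g) =
      inner ℝ (M.antiMap f) (M.gammaMap g) + inner ℝ (M.antiMap f') (M.gammaMap g) := by
  classical
  have hf := tame_of_testSpace f.2
  have hf' := tame_of_testSpace f'.2
  have hg := tame_of_testSpace g.2
  set J := M.window f ∪ M.window f' ∪ M.window (f + f') with hJ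
  have h1 : M.window f ⊆ J := by rw [hJ]; intro x; simp; tauto
  have h2 : M.window f' ⊆ J := by rw [hJ]; intro x; simp; tauto
  have h3 : M.window (f + f') ⊆ J := by rw [hJ]; intro x; simp; tauto
  have hw := M.isWindow_window g
  rw [M.inner_antiMap h1 hw, M.inner_antiMap h2 hw, M.inner_antiMap h3 hw]
  have hsum : partialGamma J ((f + f' : M.testSpace) : Config → ℝ) =
      partialGamma J (f : Config → ℝ) + partialGamma J (f' : Config → ℝ) := by
    unfold partialGamma
    rw [← Finset.sum_add_distrib]
    rfl
  have key : ∀ s : ℤ, ∫ ω, partialGamma J ((f + f' : M.testSpace) : Config → ℝ) ω *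
      M.Y 0 s (partialGamma (M.window g) g) ω ∂M.gibbs =
      (∫ ω, partialGamma J (f : Config → ℝ) ω *
        M.Y 0 s (partialGamma (M.window g) g) ω ∂M.gibbs) +
      ∫ ω, partialGamma J (f' : Config → ℝ) ω *
        M.Y 0 s (partialGamma (M.window g) g) ω ∂M.gibbs := by
    intro s
    rw [hsum]
    exact integral_add_mul ((hf.partialGamma J).memLp M) ((hf'.partialGamma J).memLp M)
      ((hg.partialGamma _).memLp_Y M 0 s)
  rw [key, key]
  ring

lemma inner_antiMap_smul (t : ℝ) (f g : M.testSpace) :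
    inner ℝ (M.antiMap (t • f)) (M.gammaMap g) =
      t * inner ℝ (M.antiMap f) (M.gammaMap g) := by
  classical
  set J := M.window f ∪ M.window (t • f) with hJ
  have hw := M.isWindow_window g
  rw [M.inner_antiMap (J := J) Finset.subset_union_left hw,
    M.inner_antiMap (J := J) Finset.subset_union_right hw]
  have hsmul : partialGamma J ((t • f : M.testSpace) : Config → ℝ) =
      t • partialGamma J (f : Config → ℝ) := by
    unfold partialGamma
    rw [Finset.smul_sum]
    rfl
  rw [hsmul]
  simp_rw [Pi.smul_apply, smul_eq_mul, mul_assoc, integral_const_mul]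
  ring

lemma inner_antiMap_self (f : M.testSpace) : inner ℝ (M.antiMap f) (M.gammaMap f) = 0 := by
  have hf := tame_of_testSpace f.2
  rw [M.inner_antiMap (subset_refl _) (M.isWindow_window f),
    M.integral_self_mul_Y (hf.partialGamma _), M.integral_self_mul_Y (hf.partialGamma _), sub_self]

lemma norm_gammaMap_sq (f : M.testSpace) : ‖M.gammaMap f‖ ^ 2 =
    (∫ ω, M.Y 0 1 (partialGamma (M.window f) f) ω ^ 2 ∂M.gibbs) +
      ∫ ω, M.Y 0 0 (partialGamma (M.window f) f) ω ^ 2 ∂M.gibbs := by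
  have hf := tame_of_testSpace f.2
  rw [← M.gammaDeriv_eq hf.smooth (M.isWindow_window f) (Or.inl rfl),
    ← M.gammaDeriv_eq hf.smooth (M.isWindow_window f) (Or.inr rfl)]
  exact M.norm_pair_sq _ _

/-- Upgrades a sum-of-squares bound for a form linear in one argument to a product bound, by
rescaling that argument. -/
lemma _root_.le_two_mul_of_forall_pos {x C a b : ℝ} (hC : 0 ≤ C) (ha : 0 ≤ a) (hb : 0 ≤ b)
    (h : ∀ s : ℝ, 0 < s → s * x ≤ C * (s ^ 2 * a ^ 2 + b ^ 2)) : x ≤ 2 * C * a * b := by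
  have key : ∀ ε : ℝ, 0 < ε → x ≤ 2 * C * a * b + ε * (C * (a + b)) := by
    intro ε hε
    -- The optimal scale is `b / a`; adding `ε` to both avoids degenerate cases and is removed by a
    -- limit.
    have h1 := h ((b + ε) / (a + ε)) (by positivity)
    have h2 : x ≤ C * ((b + ε) / (a + ε) * a ^ 2 + (a + ε) / (b + ε) * b ^ 2) := by
      have h3 : C * (((b + ε) / (a + ε)) ^ 2 * a ^ 2 + b ^ 2) = (b + ε) / (a + ε) *
          (C * ((b + ε) / (a + ε) * a ^ 2 + (a + ε) / (b + ε) * b ^ 2)) := by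
        field_simp
      rw [h3] at h1
      exact le_of_mul_le_mul_left h1 (by positivity)
    have h4 : (b + ε) / (a + ε) * a ^ 2 ≤ (b + ε) * a := by
      rw [div_mul_eq_mul_div, div_le_iff₀ (by positivity)]
      nlinarith [mul_nonneg (mul_nonneg (by positivity : 0 ≤ b + ε) ha) hε.le]
    have h5 : (a + ε) / (b + ε) * b ^ 2 ≤ (a + ε) * b := by
      rw [div_mul_eq_mul_div, div_le_iff₀ (by positivity)]
      nlinarith [mul_nonneg (mul_nonneg (by positivity : 0 ≤ a + ε) hb) hε.le]
    have h6 := mul_le_mul_of_nonneg_left (add_le_add h4 h5) hC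
    linarith
  have hlim : Tendsto (fun ε : ℝ => 2 * C * a * b + ε * (C * (a + b))) (𝓝[>] 0)
      (𝓝 (2 * C * a * b)) := by
    have hc : Continuous fun ε : ℝ => 2 * C * a * b + ε * (C * (a + b)) := by fun_prop
    simpa using (hc.tendsto 0).mono_left (nhdsWithin_le_nhds (s := Set.Ioi 0))
  exact ge_of_tendsto hlim (by filter_upwards [self_mem_nhdsWithin] with ε hε using key ε hε)

/-- The sector condition. -/
lemma exists_sector_antiMap : ∃ C : ℝ, ∀ f g : M.testSpace,
    |inner ℝ (M.antiMap f) (M.gammaMap g)| ≤ C * ‖M.gammaMap f‖ * ‖M.gammaMap g‖ := by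
  obtain ⟨C, hC, h⟩ := M.exists_sector
  have h1 : ∀ f g : M.testSpace, |inner ℝ (M.antiMap f) (M.gammaMap g)| ≤
      C * (‖M.gammaMap f‖ ^ 2 + ‖M.gammaMap g‖ ^ 2) := by
    intro f g
    have hf := (tame_of_testSpace f.2).partialGamma (M.window f)
    have hg := (tame_of_testSpace g.2).partialGamma (M.window g)
    rw [M.inner_antiMap (subset_refl _) (M.isWindow_window g), norm_gammaMap_sq, norm_gammaMap_sq]
    refine (abs_sub _ _).trans ?_
    have a1 := h _ _ hf hg 0 0
    have a2 := h _ _ hf hg 0 1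
    linarith
  refine ⟨2 * C, fun f g => le_two_mul_of_forall_pos hC (norm_nonneg _) (norm_nonneg _)
    fun s hs => ?_⟩
  have h2 := h1 (s • f) g
  rw [inner_antiMap_smul, abs_mul, abs_of_pos hs, map_smul, norm_smul, mul_pow,
    Real.norm_of_nonneg hs.le] at h2
  exact h2

/-- Since `p_0 V'(r_1) = Y_{0,1} ℰ_1`, this is antisymmetry of `Y_{0,1}` applied to `Γ_f` and `ℰ_1`.
-/
lemma inner_antiMap_symCurrent (f : M.testSpace) :
    inner ℝ (M.antiMap f) M.symCurrent = -inner ℝ M.antiCurrent (M.gammaMap f) := by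
  have hf := tame_of_testSpace f.2
  have h1 : inner ℝ (M.antiMap f) M.symCurrent =
      (∫ ω, (-partialGamma (M.window f) (f : Config → ℝ)) ω *
        ((ω 0).1 * deriv M.V (ω 1).2) ∂M.gibbs) +
        ∫ ω, partialGamma (M.window f) (f : Config → ℝ) ω * (0 : Config → ℝ) ω ∂M.gibbs :=
    M.inner_pair _ _ _ _
  have h2 : inner ℝ M.antiCurrent (M.gammaMap f) =
      (∫ ω, (-M.energy 1) ω * M.YGamma f ω ∂M.gibbs) +
        ∫ ω, (0 : Config → ℝ) ω * M.XGamma f ω ∂M.gibbs := M.inner_pair _ _ _ _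
  have h3 := M.integral_mul_Y (hf.partialGamma (M.window f)) (Tame.energy M 1) 0 1
  rw [Y_energy_one, ← M.gammaDeriv_eq hf.smooth (M.isWindow_window f) (Or.inr rfl),
    ← YGamma_eq] at h3
  rw [h1, h2]
  simp only [Pi.neg_apply, neg_mul, integral_neg, Pi.zero_apply, mul_zero, zero_mul,
    integral_zero, add_zero, neg_neg]
  rw [h3, neg_neg]
  simp_rw [mul_comm]

/-- The pairing is `-⟨ℰ_1 Y_{0,1} ℰ_1⟩`, zero by antisymmetry. -/
lemma inner_antiCurrent_symCurrent : inner ℝ M.antiCurrent M.symCurrent = 0 := by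
  have h1 : inner ℝ M.antiCurrent M.symCurrent =
      (∫ ω, (-M.energy 1) ω * ((ω 0).1 * deriv M.V (ω 1).2) ∂M.gibbs) +
        ∫ ω, (0 : Config → ℝ) ω * (0 : Config → ℝ) ω ∂M.gibbs := M.inner_pair _ _ _ _
  have h2 := M.integral_self_mul_Y (Tame.energy M 1) 0 1
  rw [Y_energy_one] at h2
  rw [h1]
  simp only [Pi.neg_apply, neg_mul, integral_neg, Pi.zero_apply, mul_zero, integral_zero, add_zero]
  rw [h2, neg_zero]

/-- The pair `d` represents `p_1² - p_0²`, so this pairing is minus the sum of `⟨g, τ_i(p_1² -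
p_0²)⟩`, which telescopes to zero. -/
lemma inner_gradPair_gammaMap (g : M.testSpace) : inner ℝ M.gradPair (M.gammaMap g) = 0 := by
  have h1 : inner ℝ M.gradPair (M.gammaMap g) =
      (∫ ω, (-fun ω : Config => (ω 0).1 * (ω 1).2) ω * M.YGamma g ω ∂M.gibbs) +
        ∫ ω, (fun ω : Config => (ω 0).1 * (ω 0).2) ω * M.XGamma g ω ∂M.gibbs :=
    M.inner_pair _ _ _ _
  have h2 := (hasRep_gradient (M := M)).star_eq g g.2
  rw [starForm_gradient g.2] at h2
  rw [h1]
  linarith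

lemma inner_gradPair_symCurrent : inner ℝ M.gradPair M.symCurrent = -M.β⁻¹ ^ 2 := by
  have h1 : inner ℝ M.gradPair M.symCurrent =
      (∫ ω, (-fun ω : Config => (ω 0).1 * (ω 1).2) ω *
        ((ω 0).1 * deriv M.V (ω 1).2) ∂M.gibbs) +
        ∫ ω, (fun ω : Config => (ω 0).1 * (ω 0).2) ω * (0 : Config → ℝ) ω ∂M.gibbs :=
    M.inner_pair _ _ _ _
  rw [h1, ← M.integral_gradient_current]
  simp only [Pi.neg_apply, neg_mul, integral_neg, Pi.zero_apply, mul_zero, integral_zero, add_zero]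

lemma norm_gradPair_sq : ‖M.gradPair‖ ^ 2 =
    2 * M.β⁻¹ * ∫ ω : Config, (ω 0).2 ^ 2 ∂M.gibbs := by
  have h1 : ‖M.gradPair‖ ^ 2 =
      (∫ ω, (-fun ω : Config => (ω 0).1 * (ω 1).2) ω ^ 2 ∂M.gibbs) +
        ∫ ω : Config, ((ω 0).1 * (ω 0).2) ^ 2 ∂M.gibbs := M.norm_pair_sq _ _
  rw [h1]
  simp only [Pi.neg_apply, neg_sq]
  rw [M.integral_mom_pos_sq 1, M.integral_mom_pos_sq 0]
  ring

/-- The fluctuation-dissipation problem of the chain. -/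
def fdData : FDData M.testSpace M.PairSpace where
  ξ := M.gammaMap
  α := M.antiMap
  e := M.symCurrent
  d := M.gradPair
  w := M.antiCurrent
  lam := M.γ / 2
  c := M.β⁻¹ ^ 2
  C := M.exists_sector_antiMap.choose
  lam_pos := half_pos M.γ_pos
  c_pos := pow_pos (inv_pos.2 M.β_pos) 2
  α_add := M.inner_antiMap_add
  α_smul := M.inner_antiMap_smul
  sector := M.exists_sector_antiMap.choose_spec
  α_self := M.inner_antiMap_self
  α_e := M.inner_antiMap_symCurrent
  w_e := M.inner_antiCurrent_symCurrent
  d_ξ := M.inner_gradPair_gammaMap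
  d_e := M.inner_gradPair_symCurrent

/-- The seminorm of `W_{0,1} + κ (p_1² - p_0²) - L F` as a dual norm in `L² × L²`. -/
lemma normSq_eq_dualSq (κ : ℝ) (F : M.testSpace) :
    M.normSq (M.current + κ • gradient - M.L F) =
      dualSq M.gammaMap M.symCurrent (M.γ / 2) (M.fdData.rep κ F) := by
  have H := ((hasRep_current (M := M)).add ((hasRep_gradient (M := M)).smul κ)).sub
    (hasRep_L F.2 (M.isWindow_window F))
  have hrep : M.fdData.rep κ F = M.pair H.memLp_fst H.memLp_snd := by
    unfold FDData.rep
    change (M.γ / 2) • M.symCurrent + M.antiCurrent + κ • M.gradPair -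
      ((M.γ / 2) • M.gammaMap F + M.antiMap F) = _
    have hg : M.gammaMap F = M.pair (M.memLp_YGamma F) (M.memLp_XGamma F) := rfl
    rw [hg, symCurrent, antiCurrent, gradPair, antiMap, pair_smul, pair_smul, pair_smul, pair_add,
      pair_add, pair_add, pair_sub]
    refine M.pair_congr _ _ _ _ ?_ ?_
    · simp only [sub_eq_add_neg]
    · simp
  unfold normSq dualSq
  refine iSup_congr fun g => iSup_congr fun a => congrArg _ ?_
  have hz : MemLp (0 : Config → ℝ) 2 M.gibbs := MemLp.zero
  have hx : M.gammaMap g + a • M.symCurrent =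
      M.pair ((M.memLp_YGamma g).add (M.memLp_mom_mul_deriv_V.const_smul a))
        ((M.memLp_XGamma g).add (hz.const_smul a)) := rfl
  rw [hx, hrep, inner_pair, norm_pair_sq, H.star_eq g g.2, H.starStar_eq]
  set U := (M.γ / 2) • (fun ω : Config => (ω 0).1 * deriv M.V (ω 1).2) - M.energy 1 +
    κ • (-fun ω : Config => (ω 0).1 * (ω 1).2) -
    ((M.γ / 2) • M.YGamma F - partialGamma (M.window F) F) with hU
  have e1 : ∫ ω, U ω * (M.YGamma g +
      a • fun ω : Config => (ω 0).1 * deriv M.V (ω 1).2) ω ∂M.gibbs =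
      (∫ ω, U ω * M.YGamma g ω ∂M.gibbs) +
        a * ∫ ω, U ω * ((ω 0).1 * deriv M.V (ω 1).2) ∂M.gibbs := by
    have h1 := integral_add_mul (M.memLp_YGamma g) (M.memLp_mom_mul_deriv_V.const_smul a)
      H.memLp_fst
    rw [← integral_const_mul]
    have h2 : ∀ ω : Config, a * (U ω * ((ω 0).1 * deriv M.V (ω 1).2)) =
        (a • fun ω : Config => (ω 0).1 * deriv M.V (ω 1).2) ω * U ω := by
      intro ω
      simp only [Pi.smul_apply, smul_eq_mul]
      ring
    simp_rw [h2, mul_comm (U _)]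
    exact h1
  rw [e1]
  have e2 : ∫ ω : Config, (a * ((ω 0).1 * deriv M.V (ω 1).2) + M.YGamma g ω) ^ 2 ∂M.gibbs =
      ∫ ω, (M.YGamma g + a • fun ω : Config => (ω 0).1 * deriv M.V (ω 1).2) ω ^ 2 ∂M.gibbs := by
    refine integral_congr_ae (Eventually.of_forall fun ω => ?_)
    simp only [Pi.add_apply, Pi.smul_apply, smul_eq_mul]
    ring
  rw [e2, smul_zero, add_zero]
  ring

lemma isDiffusionConstant_iff (κ : ℝ) : M.IsDiffusionConstant κ ↔ M.fdData.IsLimit κ := by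
  unfold IsDiffusionConstant MemClosureL FDData.IsLimit
  rw [and_iff_right (mem_fluctSpace κ)]
  simp_rw [normSq_eq_dualSq]
  rfl

end Final

end EnergyChain

end

theorem mainTheorem4 (M : EnergyChain) :
    (∃! κ : ℝ, M.IsDiffusionConstant κ) ∧
      ∀ κ : ℝ, M.IsDiffusionConstant κ →
        M.γ / (4 * M.β * ∫ ω, (ω 0).2 ^ 2 ∂M.gibbs) ≤ κ := by
  simp_rw [EnergyChain.isDiffusionConstant_iff]
  refine ⟨?_, fun κ hκ => ?_⟩
  · obtain ⟨κ, hκ⟩ := M.fdData.exists_isLimit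
    exact ⟨κ, hκ, fun κ' hκ' => M.fdData.unique hκ' hκ⟩
  · have hβ := M.β_pos
    -- The pairing of `d` with `e` is nonzero, so `d` is too; this also forces `⟨r_0²⟩` to be
    -- nonzero below.
    have hd : M.gradPair ≠ 0 := by
      intro h
      have h1 := M.inner_gradPair_symCurrent
      rw [h, inner_zero_left] at h1
      have : 0 < M.β⁻¹ ^ 2 := by positivity
      linarith
    have h1 := M.fdData.lower_bound hd hκ
    have h2 : 0 < ‖M.gradPair‖ ^ 2 := pow_pos (norm_pos_iff.2 hd) 2
    have h3 := M.norm_gradPair_sq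
    have hR : (∫ ω : EnergyChain.Config, (ω 0).2 ^ 2 ∂M.gibbs) ≠ 0 := by
      intro h
      rw [h3, h, mul_zero] at h2
      exact lt_irrefl _ h2
    -- Here `lam = γ/2`, `c = β⁻²` and `‖d‖² = 2 β⁻¹ ⟨r_0²⟩`, which produces the factor `4 β`.
    have h4 : M.fdData.lam * M.fdData.c / ‖M.fdData.d‖ ^ 2 =
        M.γ / (4 * M.β * ∫ ω, (ω 0).2 ^ 2 ∂M.gibbs) := by
      change M.γ / 2 * M.β⁻¹ ^ 2 / ‖M.gradPair‖ ^ 2 = _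
      rw [h3]
      field_simp
      norm_num
    rwa [h4] at h1
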